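/- **Theorem (Global existence).** For $p>1$ let $$\exp L^p(\mathbb R^n)=\Big\{u\in L^1_{loc}(\mathbb R^n):\ \int_{\mathbb R^n}\big(e^{|u(x)|^p/k^p}-1\big)\,dx<\infty\ \text{for some }k>0\Big\},$$ with the Luxemburg norm $\|u\|_{\exp L^p}=\inf\{k>0:\ \int_{\mathbb R^n}(e^{|u(x)|^p/k^p}-1)\,dx\le 1\}$, and let $$L^1(\ln L)^{1/p}(\mathbb R^n)=\Big\{\varphi\in L^1_{loc}(\mathbb R^n):\ \int_{\mathbb R^n}|\varphi|\,\ln^{1/p}(2+|\varphi|)\,dx<\infty\Big\}.$$ For $t>0$ put $e^{-t(-\Delta)^{\beta/2}}\varphi=S_\beta(\cdot,t)*\varphi$, where $S_\beta(x,t)=(2\pi)^{-n}\int_{\mathbb R^n}e^{ix\cdot\xi-t|\xi|^\beta}\,d\xi$. Let $n\ge 1$, $0<\beta<2$, $1<p\le \frac{n(m-1)}{\beta}$ and $m\ge p$. Let $f:\mathbb R\to\mathbb R$ satisfy $f(0)=0$ and, for some constants $C,\lambda>0$, $$|f(u)-f(v)|\le C|u-v|\big(|u|^{m-1}e^{\lambda|u|^p}+|v|^{m-1}e^{\lambda|v|^p}\big)\qquad\text{for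 all }u,v\in\mathbb R.$$ Then there is $\varepsilon>0$ such that for every $u_0\in\exp L^p(\mathbb R^n)$ with $\|u_0\|_{\exp L^p}\le\varepsilon$ there is a global weak-mild solution $u$ of $u_t+(-\Delta)^{\beta/2}u=f(u)$, $u(0)=u_0$; that is, $u\in L^\infty((0,\infty);\exp L^p(\mathbb R^n))$, $$u(t)=e^{-t(-\Delta)^{\beta/2}}u_0+\int_0^te^{-(t-s)(-\Delta)^{\beta/2}}f(u(s))\,ds\quad\text{in }\exp L^p(\mathbb R^n)\text{ for almost every }t>0,$$ and $u(t)\to u_0$ in the weak$^*$ sense: $\lim_{t\to0^+}\int_{\mathbb R^n}\big(u(t,x)\varphi(x)-u_0(x)\varphi(x)\big)\,dx=0$ for every $\varphi\in L^1(\ln L)^{1/p}(\mathbb R^n)$. This solution satisfies $$\lim_{t\to0^+}\big\|u(t)-e^{-t(-\Delta)^{\beta/2}}u_0\big\|_{\exp L^p}=0 .$$ Moreover, for every real $q$ in the range below one has $\sigma:=\frac1{m-1}-\frac{n}{\beta q}>0$, and there is a constant $K>0$ with $$\|u(t)\|_{L^q(\mathbb R^n)}\le K\,t^{-\sigma}\qquad\text{for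 all }t>0 .$$ With $a_+=\max(a,0)$ and the convention $\frac1{0}=\infty$, the range is - $\frac{n(m-1)}{\beta}<q<\frac{n(m-1)}{\beta}\cdot\frac1{(2-m)_+}$ if $\beta\le\frac{n(p-1)}{p}$; - $\frac{(m-1)p}{p-1}<q<\frac{n(m-1)}{\beta}\cdot\frac1{(2-m)_+}$ if $\beta>\frac{n(p-1)}{p}$ and $(2-m)_+<\frac{n(p-1)}{p\beta}$. -/

import Mathlib

open MeasureTheory Filter Topology
open scoped ENNReal NNReal

noncomputable section

namespace FracHeat

/-- The modular `∫ (exp ((|u x| / k) ^ p) - 1) dx`, with values in `[0, ∞]`. -/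
def expModular {n : ℕ} (p : ℝ) (u : EuclideanSpace ℝ (Fin n) → ℝ) (k : ℝ) : ℝ≥0∞ :=
  ∫⁻ x, ENNReal.ofReal (Real.exp ((|u x| / k) ^ p) - 1)

/-- Membership in the Orlicz space `exp L^p(ℝⁿ)`. -/
def MemExpL {n : ℕ} (p : ℝ) (u : EuclideanSpace ℝ (Fin n) → ℝ) : Prop :=
  LocallyIntegrable u volume ∧ ∃ k : ℝ, 0 < k ∧ expModular p u k < ∞

/-- The Luxemburg norm of `exp L^p(ℝⁿ)`, with values in `[0, ∞]` (the infimum of the empty set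
is `∞`). -/
def expLNorm {n : ℕ} (p : ℝ) (u : EuclideanSpace ℝ (Fin n) → ℝ) : ℝ≥0∞ :=
  ⨅ (k : ℝ) (_ : 0 < k) (_ : expModular p u k ≤ 1), ENNReal.ofReal k

/-- Membership in `L^1 (ln L)^{1/p}(ℝⁿ)`. -/
def MemLLogL {n : ℕ} (p : ℝ) (φ : EuclideanSpace ℝ (Fin n) → ℝ) : Prop :=
  LocallyIntegrable φ volume ∧
    ∫⁻ x, ENNReal.ofReal (|φ x| * Real.log (2 + |φ x|) ^ (1 / p)) < ∞

/-- The fundamental solution of `u_t + (-Δ)^{β/2} u = 0` at time `t > 0`, normalized to have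
integral one: `(2π)^{-n} ∫ exp (i x·ξ - t |ξ|^β) dξ`. The integral is real. -/
def kernel {n : ℕ} (β t : ℝ) (x : EuclideanSpace ℝ (Fin n)) : ℝ :=
  ((2 * Real.pi) ^ n)⁻¹ *
    (∫ ξ : EuclideanSpace ℝ (Fin n),
      Complex.exp (Complex.I * ((inner ℝ x ξ : ℝ) : ℂ) - ((t * ‖ξ‖ ^ β : ℝ) : ℂ))).re

/-- `e^{-t(-Δ)^{β/2}} φ`, the convolution of `φ` with the fundamental solution. -/
def semigroup {n : ℕ} (β t : ℝ) (φ : EuclideanSpace ℝ (Fin n) → ℝ)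
    (x : EuclideanSpace ℝ (Fin n)) : ℝ :=
  ∫ y, kernel β t (x - y) * φ y

/-- The term `∫_0^t e^{-(t-s)(-Δ)^{β/2}} f(u(s)) ds`. -/
def duhamel {n : ℕ} (β : ℝ) (f : ℝ → ℝ) (u : ℝ → EuclideanSpace ℝ (Fin n) → ℝ) (t : ℝ)
    (x : EuclideanSpace ℝ (Fin n)) : ℝ :=
  ∫ s in (0 : ℝ)..t, semigroup β (t - s) (fun y => f (u s y)) x

/-- `u ∈ L^∞((0,∞); exp L^p(ℝⁿ))`: `u` takes values in `exp L^p`, it is strongly measurable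
(an almost everywhere limit, in the Luxemburg norm, of simple functions of time with values in
`exp L^p`), and its norm is essentially bounded. -/
def MemLInftyExpL {n : ℕ} (p : ℝ) (u : ℝ → EuclideanSpace ℝ (Fin n) → ℝ) : Prop :=
  (∀ t : ℝ, 0 < t → MemExpL p (u t)) ∧
  (∃ s : ℕ → SimpleFunc ℝ (EuclideanSpace ℝ (Fin n) → ℝ),
    (∀ k t, MemExpL p (s k t)) ∧
    ∀ᵐ t ∂(volume.restrict (Set.Ioi (0 : ℝ))),
      Tendsto (fun k => expLNorm p (fun x => u t x - s k t x)) atTop (𝓝 0)) ∧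
  ∃ M : ℝ≥0, ∀ᵐ t ∂(volume.restrict (Set.Ioi (0 : ℝ))), expLNorm p (u t) ≤ M

/-- `u(t) → u₀` in the weak-* topology as `t → 0⁺`. -/
def WeakStarInitial {n : ℕ} (p : ℝ) (u : ℝ → EuclideanSpace ℝ (Fin n) → ℝ)
    (u₀ : EuclideanSpace ℝ (Fin n) → ℝ) : Prop :=
  ∀ φ : EuclideanSpace ℝ (Fin n) → ℝ, MemLLogL p φ →
    Tendsto (fun t => ∫ x, (u t x * φ x - u₀ x * φ x)) (𝓝[>] 0) (𝓝 0)

/-- `u` is a global weak-mild solution of `u_t + (-Δ)^{β/2} u = f(u)`, `u(0) = u₀`. The function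
`(t, x) ↦ u t x` is a jointly measurable version, and the integral equation holds in `exp L^p`
for almost every `t > 0`, with an absolutely convergent integral term. -/
structure IsGlobalWeakMildSolution {n : ℕ} (β p : ℝ) (f : ℝ → ℝ)
    (u₀ : EuclideanSpace ℝ (Fin n) → ℝ) (u : ℝ → EuclideanSpace ℝ (Fin n) → ℝ) : Prop where
  jointly_measurable : AEStronglyMeasurable (Function.uncurry u)
    ((volume.restrict (Set.Ioi (0 : ℝ))).prod volume)
  bounded : MemLInftyExpL p u
  absolutely_convergent : ∀ᵐ t ∂(volume.restrict (Set.Ioi (0 : ℝ))), ∀ᵐ x,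
    Integrable (fun z : ℝ × EuclideanSpace ℝ (Fin n) =>
      kernel β (t - z.1) (x - z.2) * f (u z.1 z.2))
      ((volume.restrict (Set.Ioo 0 t)).prod volume)
  integral_equation : ∀ᵐ t ∂(volume.restrict (Set.Ioi (0 : ℝ))),
    MemExpL p (semigroup β t u₀) ∧ MemExpL p (duhamel β f u t) ∧
      ∀ᵐ x, u t x = semigroup β t u₀ x + duhamel β f u t x
  weak_star : WeakStarInitial p u u₀

/-- The upper bound `q < (n(m-1)/β) / (2-m)₊`, which reads `q < ∞` if `m ≥ 2`. -/
def BelowUpper (n : ℕ) (β m q : ℝ) : Prop :=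
  q * max (2 - m) 0 < n * (m - 1) / β

/-- The range of exponents `q` of the decay estimate. -/
def DecayRange (n : ℕ) (β p m q : ℝ) : Prop :=
  (β = n * (p - 1) / p ∧ n * (m - 1) / β < q ∧ BelowUpper n β m q) ∨
  (β < n * (p - 1) / p ∧ n * (m - 1) / β < q ∧ BelowUpper n β m q) ∨
  ((n * (p - 1) / p < β ∧ max (2 - m) 0 < n * (p - 1) / (p * β)) ∧
    (m - 1) * p / (p - 1) < q ∧ BelowUpper n β m q)

/-- The decay exponent `σ = 1/(m-1) - n/(βq)`. -/
def decayExponent (n : ℕ) (β m q : ℝ) : ℝ :=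
  1 / (m - 1) - n / (β * q)

end FracHeat

end

/-! Write `A = (-Δ)^{β/2}`, `U(t) = e^{-tA}u₀`, and look for the solution as `u = U + w`. Put `κ =
1/(m-1)` and `γ = κ(p-1)`. The linear part `U` is in general only in the Orlicz space near `t = 0`,
but the Duhamel part `w` is better: it is bounded and integrable at each time. It is found by
contraction in the set `|w(t)| ≤ k(1+t)^{-κ}`, `∫|w(t)| ≤ k(1+t)^γ` (the relation `Close`). The two
weights cancel on interpolation, because `κ(p-1) = γ`: this gives `‖w(t)‖_p ≤ k` at all times, and
with boundedness a uniform bound in `exp L^p`.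

Why the estimates close. By Jensen the modular of `U` never grows. Since `exp L^p ⊂ L^r` for `r =
n(m-1)/β ≥ p`, smoothing gives `|U(t)| ≤ B k t^{-κ}`. Hence for `t ≥ 1` the exponential in `f` is
harmless and `|u|^{m-1}` is of order `(1+t)^{-1}`. For `t ≤ 1` the function `U` may be unbounded,
but `k` is small, so `e^{λ|u|^p}` is dominated by the power `1/R` of the Young function, with `R =
2n/β > 1`; smoothing from `L^R` to `L^∞` then costs `τ^{-1/2}`, which is integrable in time. Both
regimes are recorded in `SourceBound`, proved for `f(U)` in `exists_sourceBound_free` and for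
differences in `exists_sourceBound_mul`. `SourceBound.lintegral_heatL_decay` returns from the source
to the weight `(1+t)^{-κ}`; it needs `γ + κ ≤ n/β`, which is the hypothesis `p ≤ n(m-1)/β`. The
contraction constant is a multiple of `k^{m-1}`, so small data suffice (`exists_duhamelPart`).

All of this uses that the kernel is a probability density with parabolic scaling. Positivity is
subordination: `e^{-t|ξ|^β}` is a limit of positive combinations of Gaussians. Mass one follows by
Gaussian regularization.

The other assertions follow from the same bounds. As `t → 0` the Duhamel part vanishes in `L^1 ∩
L^∞`, hence in `exp L^p`. Norm continuity on `(0,∞)` gives strong measurability. Weak-star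
convergence of `U` combines density in `L^p` with a Young inequality between `exp L^p` and `L^1(ln
L)^{1/p}`. Decay in `L^q` is interpolation between the `L^p` bound and the uniform decay `t^{-κ}`.
-/

noncomputable section

namespace FracHeat

/-! ### Functions with nonnegative Gaussian-regularized cosine transform -/

section Positivity

variable {V : Type*} [NormedAddCommGroup V] [InnerProductSpace ℝ V] [FiniteDimensional ℝ V]
  [MeasurableSpace V] [BorelSpace V]

lemma integrable_gaussian {δ : ℝ} (hδ : 0 < δ) :
    Integrable (fun ξ : V => Real.exp (-δ * ‖ξ‖ ^ 2)) := by
  have h := (GaussianFourier.integrable_cexp_neg_mul_sq_norm_add (V := V) (b := (δ : ℂ))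
    (by simpa using hδ) 0 0).norm
  refine h.congr (Eventually.of_forall fun ξ => ?_)
  simp only [Complex.norm_exp]
  norm_cast
  simp

lemma integral_cos_mul_gaussian {δ : ℝ} (hδ : 0 < δ) (x : V) :
    ∫ ξ : V, Real.cos (inner ℝ x ξ) * Real.exp (-δ * ‖ξ‖ ^ 2) =
      (Real.pi / δ) ^ (Module.finrank ℝ V / 2 : ℝ) * Real.exp (-(‖x‖ ^ 2 / (4 * δ))) := by
  have hb : 0 < (δ : ℂ).re := by simpa using hδ
  have h := GaussianFourier.integral_cexp_neg_mul_sq_norm_add (V := V) hb Complex.I x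
  have hi := GaussianFourier.integrable_cexp_neg_mul_sq_norm_add (V := V) hb Complex.I x
  have h2 := congrArg Complex.re h
  have h3 : (∫ v : V, Complex.exp (-(δ : ℂ) * ‖v‖ ^ 2 + Complex.I * (inner ℝ x v : ℝ))).re =
      ∫ v : V, (Complex.exp (-(δ : ℂ) * ‖v‖ ^ 2 + Complex.I * (inner ℝ x v : ℝ))).re :=
    (integral_re hi).symm
  rw [h3] at h2
  have h4 : ∀ v : V, (Complex.exp (-(δ : ℂ) * ‖v‖ ^ 2 + Complex.I * (inner ℝ x v : ℝ))).re =
      Real.cos (inner ℝ x v) * Real.exp (-δ * ‖v‖ ^ 2) := by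
    intro v
    rw [Complex.exp_re]
    have e0 : -(δ : ℂ) * ‖v‖ ^ 2 + Complex.I * (inner ℝ x v : ℝ) =
        ((-δ * ‖v‖ ^ 2 : ℝ) : ℂ) + ((inner ℝ x v : ℝ) : ℂ) * Complex.I := by push_cast; ring
    rw [e0, Complex.add_re, Complex.add_im, Complex.ofReal_re, Complex.ofReal_im,
      Complex.re_ofReal_mul, Complex.im_ofReal_mul, Complex.I_re, Complex.I_im, mul_zero, add_zero,
      zero_add, mul_one, mul_comm]
  simp_rw [h4] at h2
  rw [h2]
  have h5 : ((Real.pi : ℂ) / δ) ^ (Module.finrank ℝ V / 2 : ℂ) *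
      Complex.exp (Complex.I ^ 2 * ‖x‖ ^ 2 / (4 * δ)) =
      (((Real.pi / δ) ^ (Module.finrank ℝ V / 2 : ℝ) *
        Real.exp (-(‖x‖ ^ 2 / (4 * δ))) : ℝ) : ℂ) := by
    push_cast
    rw [Complex.ofReal_cpow (by positivity)]
    push_cast
    congr 2
    rw [Complex.I_sq]
    ring
  rw [h5, Complex.ofReal_re]

/-- Functions whose product with every centred Gaussian has a nonnegative cosine transform. -/
def GaussPos (φ : V → ℝ) : Prop :=
  ∀ δ : ℝ, 0 < δ → ∀ x : V,
    0 ≤ ∫ ξ : V, Real.cos (inner ℝ x ξ) * φ ξ * Real.exp (-δ * ‖ξ‖ ^ 2)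

lemma gaussPos_one : GaussPos (fun _ : V => (1 : ℝ)) := by
  intro δ hδ x
  simp only [mul_one]
  rw [integral_cos_mul_gaussian hδ]
  positivity

lemma GaussPos.integrand_integrable {φ : V → ℝ} (hm : Measurable φ) {M : ℝ}
    (hM : ∀ ξ, |φ ξ| ≤ M) {δ : ℝ} (hδ : 0 < δ) (x : V) :
    Integrable (fun ξ : V => Real.cos (inner ℝ x ξ) * φ ξ * Real.exp (-δ * ‖ξ‖ ^ 2)) := by
  refine ((integrable_gaussian (V := V) hδ).const_mul M).mono' ?_ (Eventually.of_forall fun ξ => ?_)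
  · exact Measurable.aestronglyMeasurable (by fun_prop)
  · rw [norm_mul, norm_mul, Real.norm_eq_abs, Real.norm_eq_abs, Real.norm_eq_abs, Real.abs_exp]
    have h1 := Real.abs_cos_le_one (inner ℝ x ξ)
    have h2 := hM ξ
    have : |Real.cos (inner ℝ x ξ)| * |φ ξ| ≤ 1 * M :=
      mul_le_mul h1 h2 (abs_nonneg _) zero_le_one
    rw [one_mul] at this
    gcongr

lemma GaussPos.add {φ ψ : V → ℝ} (hφ : GaussPos φ) (hψ : GaussPos ψ)
    (hmφ : Measurable φ) (hmψ : Measurable ψ) {M N : ℝ} (hM : ∀ ξ, |φ ξ| ≤ M)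
    (hN : ∀ ξ, |ψ ξ| ≤ N) : GaussPos (fun ξ => φ ξ + ψ ξ) := by
  intro δ hδ x
  have := integral_add (GaussPos.integrand_integrable hmφ hM hδ x)
    (GaussPos.integrand_integrable hmψ hN hδ x)
  have h2 : ∀ ξ : V, Real.cos (inner ℝ x ξ) * (φ ξ + ψ ξ) * Real.exp (-δ * ‖ξ‖ ^ 2) =
    Real.cos (inner ℝ x ξ) * φ ξ * Real.exp (-δ * ‖ξ‖ ^ 2) +
    Real.cos (inner ℝ x ξ) * ψ ξ * Real.exp (-δ * ‖ξ‖ ^ 2) := fun ξ => by ring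
  simp_rw [h2]
  rw [this]
  exact add_nonneg (hφ δ hδ x) (hψ δ hδ x)

lemma GaussPos.const_mul {φ : V → ℝ} (hφ : GaussPos φ) {c : ℝ} (hc : 0 ≤ c) :
    GaussPos (fun ξ => c * φ ξ) := by
  intro δ hδ x
  have h2 : ∀ ξ : V, Real.cos (inner ℝ x ξ) * (c * φ ξ) * Real.exp (-δ * ‖ξ‖ ^ 2) =
    c * (Real.cos (inner ℝ x ξ) * φ ξ * Real.exp (-δ * ‖ξ‖ ^ 2)) := fun ξ => by ring
  simp_rw [h2]
  rw [integral_const_mul]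
  exact mul_nonneg hc (hφ δ hδ x)

lemma GaussPos.of_tendsto {φ : ℕ → V → ℝ} {ψ : V → ℝ} (hφ : ∀ j, GaussPos (φ j))
    (hm : ∀ j, Measurable (φ j)) {M : ℝ} (hM : ∀ j ξ, |φ j ξ| ≤ M)
    (hlim : ∀ ξ, Tendsto (fun j => φ j ξ) atTop (𝓝 (ψ ξ))) : GaussPos ψ := by
  intro δ hδ x
  refine ge_of_tendsto' (tendsto_integral_of_dominated_convergence
    (F := fun j ξ => Real.cos (inner ℝ x ξ) * φ j ξ * Real.exp (-δ * ‖ξ‖ ^ 2))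
    (fun ξ => M * Real.exp (-δ * ‖ξ‖ ^ 2)) (fun j => ?_)
    ((integrable_gaussian (V := V) hδ).const_mul M) (fun j => Eventually.of_forall fun ξ => ?_)
    (Eventually.of_forall fun ξ => ?_)) (fun j => hφ j δ hδ x)
  · exact (GaussPos.integrand_integrable (hm j) (hM j) hδ x).aestronglyMeasurable
  · rw [norm_mul, norm_mul, Real.norm_eq_abs, Real.norm_eq_abs, Real.norm_eq_abs, Real.abs_exp]
    have : |Real.cos (inner ℝ x ξ)| * |φ j ξ| ≤ 1 * M :=
      mul_le_mul (Real.abs_cos_le_one _) (hM j ξ) (abs_nonneg _) zero_le_one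
    rw [one_mul] at this
    gcongr
  · exact ((hlim ξ).const_mul _).mul_const _

/-- Truncated Laplace transform of the Lévy density `τ ^ (-1 - α)`. -/
def levyLaplace (α ε s : ℝ) : ℝ :=
  ∫ τ in Set.Ioi ε, Real.exp (-τ * s) * τ ^ (-1 - α)

lemma integrableOn_levy {α ε : ℝ} (hα : 0 < α) (hε : 0 < ε) :
    IntegrableOn (fun τ : ℝ => τ ^ (-1 - α)) (Set.Ioi ε) :=
  integrableOn_Ioi_rpow_of_lt (by linarith) hε

lemma integrableOn_levyLaplace {α ε s : ℝ} (hα : 0 < α) (hε : 0 < ε) (hs : 0 ≤ s) :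
    IntegrableOn (fun τ : ℝ => Real.exp (-τ * s) * τ ^ (-1 - α)) (Set.Ioi ε) := by
  refine (integrableOn_levy hα hε).mono' ?_ ?_
  · exact Measurable.aestronglyMeasurable (by fun_prop)
  · refine (ae_restrict_iff' measurableSet_Ioi).2 (Eventually.of_forall fun τ hτ => ?_)
    have hτ0 : 0 < τ := hε.trans hτ
    rw [norm_mul, Real.norm_of_nonneg (Real.exp_nonneg _),
      Real.norm_of_nonneg (Real.rpow_nonneg hτ0.le _)]
    refine mul_le_of_le_one_left (Real.rpow_nonneg hτ0.le _) (Real.exp_le_one_iff.2 ?_)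
    nlinarith

lemma levyLaplace_nonneg {α ε s : ℝ} (hε : 0 < ε) : 0 ≤ levyLaplace α ε s :=
  setIntegral_nonneg measurableSet_Ioi fun _ hτ =>
    mul_nonneg (Real.exp_nonneg _) (Real.rpow_nonneg (hε.trans hτ).le _)

lemma levyLaplace_le {α ε s : ℝ} (hα : 0 < α) (hε : 0 < ε) (hs : 0 ≤ s) :
    levyLaplace α ε s ≤ levyLaplace α ε 0 := by
  refine setIntegral_mono_on (integrableOn_levyLaplace hα hε hs)
    (integrableOn_levyLaplace hα hε le_rfl) measurableSet_Ioi fun τ hτ => ?_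
  have hτ0 : 0 < τ := hε.trans hτ
  refine mul_le_mul_of_nonneg_right (Real.exp_le_exp.2 ?_) (Real.rpow_nonneg hτ0.le _)
  nlinarith

lemma measurable_levyLaplace {α ε : ℝ} : Measurable (levyLaplace α ε) := by
  have : StronglyMeasurable (fun z : ℝ × ℝ => Real.exp (-z.2 * z.1) * z.2 ^ (-1 - α)) :=
    Measurable.stronglyMeasurable (by fun_prop)
  exact (this.integral_prod_right (ν := volume.restrict (Set.Ioi ε))).measurable

/-- The new factor is a positive mixture of Gaussians `e^{-τ|ξ|²}`. By Fubini each of them merges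
with the test Gaussian and turns `δ` into `δ + τ`, which is why `GaussPos` quantifies over all `δ`.
-/
lemma GaussPos.mul_levyLaplace {φ : V → ℝ} (hφ : GaussPos φ) (hm : Measurable φ) {M : ℝ}
    (hM : ∀ ξ, |φ ξ| ≤ M) {α ε : ℝ} (hα : 0 < α) (hε : 0 < ε) :
    GaussPos (fun ξ => levyLaplace α ε (‖ξ‖ ^ 2) * φ ξ) := by
  intro δ hδ x
  have hM0 : 0 ≤ M := (abs_nonneg _).trans (hM 0)
  set G : V → ℝ → ℝ := fun ξ τ => Real.cos (inner ℝ x ξ) * φ ξ * Real.exp (-δ * ‖ξ‖ ^ 2) *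
    (Real.exp (-τ * ‖ξ‖ ^ 2) * τ ^ (-1 - α)) with hG
  have h1 : ∀ ξ : V, Real.cos (inner ℝ x ξ) * (levyLaplace α ε (‖ξ‖ ^ 2) * φ ξ) *
      Real.exp (-δ * ‖ξ‖ ^ 2) = ∫ τ in Set.Ioi ε, G ξ τ := by
    intro ξ
    rw [hG]
    simp only
    rw [integral_const_mul, levyLaplace]
    ring
  simp_rw [h1]
  rw [integral_integral_swap]
  · refine setIntegral_nonneg measurableSet_Ioi fun τ hτ => ?_
    have hτ0 : 0 < τ := hε.trans hτ
    have h2 : ∀ ξ : V, G ξ τ = τ ^ (-1 - α) *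
        (Real.cos (inner ℝ x ξ) * φ ξ * Real.exp (-(δ + τ) * ‖ξ‖ ^ 2)) := by
      intro ξ
      have : -(δ + τ) * ‖ξ‖ ^ 2 = -δ * ‖ξ‖ ^ 2 + -τ * ‖ξ‖ ^ 2 := by ring
      rw [this, Real.exp_add, hG]
      ring
    simp_rw [h2]
    rw [integral_const_mul]
    exact mul_nonneg (Real.rpow_nonneg hτ0.le _) (hφ _ (by linarith) x)
  · have hdom : Integrable (fun z : V × ℝ => (M * Real.exp (-δ * ‖z.1‖ ^ 2)) * z.2 ^ (-1 - α))
        (volume.prod (volume.restrict (Set.Ioi ε))) :=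
      ((integrable_gaussian (V := V) hδ).const_mul M).mul_prod (integrableOn_levy hα hε)
    refine hdom.mono' ?_ ?_
    · exact Measurable.aestronglyMeasurable (by rw [hG]; fun_prop)
    · have hae : ∀ᵐ z : V × ℝ ∂(volume.prod (volume.restrict (Set.Ioi ε))), z.2 ∈ Set.Ioi ε :=
        Measure.quasiMeasurePreserving_snd.ae (ae_restrict_mem measurableSet_Ioi)
      filter_upwards [hae] with z hz
      have hτ0 : 0 < z.2 := hε.trans hz
      simp only [Function.uncurry, hG]
      rw [norm_mul, norm_mul, norm_mul, norm_mul, Real.norm_eq_abs, Real.norm_eq_abs,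
        Real.norm_of_nonneg (Real.exp_nonneg _), Real.norm_of_nonneg (Real.exp_nonneg _),
        Real.norm_of_nonneg (Real.rpow_nonneg hτ0.le _)]
      have h3 : |Real.cos (inner ℝ x z.1)| * |φ z.1| ≤ 1 * M :=
        mul_le_mul (Real.abs_cos_le_one _) (hM _) (abs_nonneg _) zero_le_one
      rw [one_mul] at h3
      have h4 : Real.exp (-z.2 * ‖z.1‖ ^ 2) ≤ 1 := Real.exp_le_one_iff.2 (by nlinarith [sq_nonneg ‖z.1‖])
      have h5 : Real.exp (-z.2 * ‖z.1‖ ^ 2) * z.2 ^ (-1 - α) ≤ z.2 ^ (-1 - α) :=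
        mul_le_of_le_one_left (Real.rpow_nonneg hτ0.le _) h4
      gcongr

lemma gaussPos_levyLaplace_pow {α ε : ℝ} (hα : 0 < α) (hε : 0 < ε) (k : ℕ) :
    GaussPos (fun ξ : V => levyLaplace α ε (‖ξ‖ ^ 2) ^ k) := by
  induction k with
  | zero => simpa using gaussPos_one (V := V)
  | succ k ih =>
    have := ih.mul_levyLaplace (M := levyLaplace α ε 0 ^ k)
      ((measurable_levyLaplace.comp (by fun_prop)).pow_const k) (fun ξ => ?_) hα hε
    · simpa only [pow_succ'] using this
    · rw [abs_of_nonneg (pow_nonneg (levyLaplace_nonneg hε) _)]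
      exact pow_le_pow_left₀ (levyLaplace_nonneg hε) (levyLaplace_le hα hε (by positivity)) _

/-- In the power series of the exponential every term is a nonnegative multiple of a power already
treated, and all partial sums stay below the value at `ξ = 0`. -/
lemma gaussPos_exp_levyLaplace {α ε a : ℝ} (hα : 0 < α) (hε : 0 < ε) (ha : 0 ≤ a) :
    GaussPos (fun ξ : V => Real.exp (a * levyLaplace α ε (‖ξ‖ ^ 2))) := by
  have hmeas : ∀ N : ℕ, Measurable (fun ξ : V =>
      ∑ k ∈ Finset.range N, (a * levyLaplace α ε (‖ξ‖ ^ 2)) ^ k / k.factorial) := by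
    intro N
    have : Measurable (fun ξ : V => levyLaplace α ε (‖ξ‖ ^ 2)) :=
      measurable_levyLaplace.comp (by fun_prop)
    fun_prop
  have hbd : ∀ (N : ℕ) (ξ : V),
      |∑ k ∈ Finset.range N, (a * levyLaplace α ε (‖ξ‖ ^ 2)) ^ k / k.factorial| ≤
        Real.exp (a * levyLaplace α ε 0) := by
    intro N ξ
    have h0 : 0 ≤ a * levyLaplace α ε (‖ξ‖ ^ 2) := mul_nonneg ha (levyLaplace_nonneg hε)
    rw [abs_of_nonneg (Finset.sum_nonneg fun k _ => by positivity)]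
    refine (Real.sum_le_exp_of_nonneg h0 N).trans (Real.exp_le_exp.2 ?_)
    exact mul_le_mul_of_nonneg_left (levyLaplace_le hα hε (by positivity)) ha
  refine GaussPos.of_tendsto (φ := fun N ξ =>
      ∑ k ∈ Finset.range N, (a * levyLaplace α ε (‖ξ‖ ^ 2)) ^ k / k.factorial)
    (fun N => ?_) hmeas hbd (fun ξ => ?_)
  · induction N with
    | zero => intro δ hδ x; simp
    | succ N ih =>
      simp_rw [Finset.sum_range_succ]
      have h1 : GaussPos (fun ξ : V => (a * levyLaplace α ε (‖ξ‖ ^ 2)) ^ N / N.factorial) := by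
        have := (gaussPos_levyLaplace_pow (V := V) hα hε N).const_mul
          (c := a ^ N / N.factorial) (by positivity)
        refine (funext fun ξ => ?_ : (fun ξ : V => _) = _) ▸ this
        ring
      refine ih.add h1 (hmeas N) ?_ (hbd N) (N := Real.exp (a * levyLaplace α ε 0)) (fun ξ => ?_)
      · have : Measurable (fun ξ : V => levyLaplace α ε (‖ξ‖ ^ 2)) :=
          measurable_levyLaplace.comp (by fun_prop)
        fun_prop
      · have h0 : 0 ≤ a * levyLaplace α ε (‖ξ‖ ^ 2) := mul_nonneg ha (levyLaplace_nonneg hε)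
        rw [abs_of_nonneg (by positivity)]
        refine (Real.pow_div_factorial_le_exp _ h0 N).trans (Real.exp_le_exp.2 ?_)
        exact mul_le_mul_of_nonneg_left (levyLaplace_le hα hε (by positivity)) ha
  · have := (NormedSpace.expSeries_div_hasSum_exp (a * levyLaplace α ε (‖ξ‖ ^ 2))).tendsto_sum_nat
    rwa [← Real.exp_eq_exp_ℝ] at this

end Positivity

/-! ### Subordination: `s^α` as an integral of `1 - e^{-τs}` -/

section Bernstein

/-- Near zero `1 - e^{-τs} ≤ τs` leaves `τ^{-α}`, integrable because `α < 1`; at infinity the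
density alone is integrable because `α > 0`. -/
lemma integrableOn_one_sub_exp_levy {α : ℝ} (hα : 0 < α) (hα1 : α < 1) {s : ℝ} (hs : 0 ≤ s) :
    IntegrableOn (fun τ : ℝ => (1 - Real.exp (-τ * s)) * τ ^ (-1 - α)) (Set.Ioi 0) := by
  rw [← Set.Ioc_union_Ioi_eq_Ioi (zero_le_one' ℝ)]
  have hmeas : Measurable (fun τ : ℝ => (1 - Real.exp (-τ * s)) * τ ^ (-1 - α)) := by fun_prop
  have key : ∀ τ : ℝ, 0 < τ → 0 ≤ 1 - Real.exp (-τ * s) := fun τ hτ => by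
    have : Real.exp (-τ * s) ≤ 1 := Real.exp_le_one_iff.2 (by nlinarith)
    linarith
  refine IntegrableOn.union ?_ ?_
  · have h1 : IntegrableOn (fun τ : ℝ => s * τ ^ (-α)) (Set.Ioc 0 1) := by
      have := (intervalIntegral.intervalIntegrable_rpow' (a := 0) (b := 1)
        (show -1 < -α by linarith)).const_mul s
      rwa [intervalIntegrable_iff_integrableOn_Ioc_of_le zero_le_one] at this
    refine h1.mono' hmeas.aestronglyMeasurable ?_
    refine (ae_restrict_iff' measurableSet_Ioc).2 (Eventually.of_forall fun τ hτ => ?_)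
    have h0 := key τ hτ.1
    rw [Real.norm_of_nonneg (mul_nonneg h0 (Real.rpow_nonneg hτ.1.le _))]
    have h2 : 1 - Real.exp (-τ * s) ≤ τ * s := by
      have := Real.add_one_le_exp (-τ * s)
      linarith
    calc (1 - Real.exp (-τ * s)) * τ ^ (-1 - α) ≤ (τ * s) * τ ^ (-1 - α) :=
          mul_le_mul_of_nonneg_right h2 (Real.rpow_nonneg hτ.1.le _)
      _ = s * τ ^ (-α) := by
          have : τ ^ (-α) = τ * τ ^ (-1 - α) := by
            rw [← Real.rpow_one_add' hτ.1.le (by linarith)]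
            congr 1; ring
          rw [this]; ring
  · refine (integrableOn_levy hα zero_lt_one).mono' hmeas.aestronglyMeasurable ?_
    refine (ae_restrict_iff' measurableSet_Ioi).2 (Eventually.of_forall fun τ hτ => ?_)
    have hτ0 : (0 : ℝ) < τ := zero_lt_one.trans hτ
    rw [Real.norm_of_nonneg (mul_nonneg (key τ hτ0) (Real.rpow_nonneg hτ0.le _))]
    refine mul_le_of_le_one_left (Real.rpow_nonneg hτ0.le _) ?_
    linarith [Real.exp_pos (-τ * s)]

/-- The constant `∫ (1 - e^{-τ}) τ^{-1-α} dτ` in the integral representation of `s ^ α`. -/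
def bernsteinConst (α : ℝ) : ℝ := ∫ τ in Set.Ioi (0 : ℝ), (1 - Real.exp (-τ * 1)) * τ ^ (-1 - α)

lemma integral_one_sub_exp_levy {α : ℝ} (hα : 0 < α) {s : ℝ} (hs : 0 ≤ s) :
    ∫ τ in Set.Ioi (0 : ℝ), (1 - Real.exp (-τ * s)) * τ ^ (-1 - α) =
      bernsteinConst α * s ^ α := by
  rcases hs.eq_or_lt with rfl | hs
  · simp [Real.zero_rpow hα.ne']
  have h := integral_comp_mul_left_Ioi
    (fun τ : ℝ => (1 - Real.exp (-τ * 1)) * τ ^ (-1 - α)) 0 hs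
  rw [mul_zero, smul_eq_mul] at h
  have h2 : ∀ τ ∈ Set.Ioi (0 : ℝ), (1 - Real.exp (-τ * s)) * τ ^ (-1 - α) =
      s ^ (1 + α) * ((1 - Real.exp (-(s * τ) * 1)) * (s * τ) ^ (-1 - α)) := by
    intro τ hτ
    rw [Real.mul_rpow hs.le (le_of_lt hτ)]
    have : s ^ (1 + α) * s ^ (-1 - α) = 1 := by
      rw [← Real.rpow_add hs]; ring_nf; simp
    have e : -(s * τ) * 1 = -τ * s := by ring
    rw [e]
    linear_combination (-(1 - Real.exp (-τ * s)) * τ ^ (-1 - α)) * this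
  rw [setIntegral_congr_fun measurableSet_Ioi h2, integral_const_mul, h]
  have : s ^ (1 + α) * s⁻¹ = s ^ α := by
    rw [Real.rpow_add hs, Real.rpow_one]; field_simp
  rw [bernsteinConst, ← mul_assoc, this, mul_comm]

lemma bernsteinConst_pos {α : ℝ} (hα : 0 < α) (hα1 : α < 1) : 0 < bernsteinConst α := by
  have hpos : ∀ τ ∈ Set.Ioi (0 : ℝ), 0 < (1 - Real.exp (-τ * 1)) * τ ^ (-1 - α) := by
    intro τ hτ
    have hτ0 : (0 : ℝ) < τ := hτ
    have : Real.exp (-τ * 1) < 1 := Real.exp_lt_one_iff.2 (by linarith)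
    exact mul_pos (by linarith) (Real.rpow_pos_of_pos hτ0 _)
  rw [bernsteinConst, setIntegral_pos_iff_support_of_nonneg_ae]
  · have : Set.Ioi (0 : ℝ) ⊆
        Function.support (fun τ : ℝ => (1 - Real.exp (-τ * 1)) * τ ^ (-1 - α)) ∩ Set.Ioi 0 :=
      fun τ hτ => ⟨(hpos τ hτ).ne', hτ⟩
    refine lt_of_lt_of_le ?_ (measure_mono this)
    simp
  · exact (ae_restrict_iff' measurableSet_Ioi).2 (Eventually.of_forall fun τ hτ => (hpos τ hτ).le)
  · exact integrableOn_one_sub_exp_levy hα hα1 zero_le_one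

lemma tendsto_levyLaplace_sub {α : ℝ} (hα : 0 < α) (hα1 : α < 1) {s : ℝ} (hs : 0 ≤ s) :
    Tendsto (fun j : ℕ => levyLaplace α (1 / (j + 1)) 0 - levyLaplace α (1 / (j + 1)) s) atTop
      (𝓝 (bernsteinConst α * s ^ α)) := by
  rw [← integral_one_sub_exp_levy hα hs]
  have hU : ⋃ j : ℕ, Set.Ioi (1 / ((j : ℝ) + 1)) = Set.Ioi (0 : ℝ) := by
    ext τ
    simp only [Set.mem_iUnion, Set.mem_Ioi]
    constructor
    · rintro ⟨j, hj⟩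
      exact lt_trans (by positivity) hj
    · exact fun h => exists_nat_one_div_lt h
  have hmono : Monotone (fun j : ℕ => Set.Ioi (1 / ((j : ℝ) + 1))) := by
    intro i j hij
    exact Set.Ioi_subset_Ioi (one_div_le_one_div_of_le (by positivity) (by gcongr))
  have := tendsto_setIntegral_of_monotone
    (f := fun τ : ℝ => (1 - Real.exp (-τ * s)) * τ ^ (-1 - α)) (μ := volume)
    (fun j : ℕ => (measurableSet_Ioi : MeasurableSet (Set.Ioi (1 / ((j : ℝ) + 1))))) hmono
    (by rw [hU]; exact integrableOn_one_sub_exp_levy hα hα1 hs)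
  rw [hU] at this
  refine this.congr fun j => ?_
  have hj : (0 : ℝ) < 1 / ((j : ℝ) + 1) := by positivity
  rw [levyLaplace, levyLaplace, ← integral_sub (integrableOn_levyLaplace hα hj le_rfl)
    (integrableOn_levyLaplace hα hj hs)]
  refine integral_congr_ae (Eventually.of_forall fun τ => ?_)
  simp
  ring

variable {V : Type*} [NormedAddCommGroup V] [InnerProductSpace ℝ V] [FiniteDimensional ℝ V]
  [MeasurableSpace V] [BorelSpace V]

/-- With `α = β/2`, the power `|ξ|^β` is `c⁻¹ ∫ (1 - e^{-τ|ξ|²}) τ^{-1-α} dτ`. Cutting the integral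
off at `1/(j+1)` separates the constant `1` from the Gaussian part, so the exponential becomes a
positive constant times `exp((t/c) · levyLaplace)`; then `j → ∞`. -/
lemma gaussPos_exp_neg_rpow {β t : ℝ} (hβ : 0 < β) (hβ2 : β < 2) (ht : 0 < t) :
    GaussPos (fun ξ : V => Real.exp (-(t * ‖ξ‖ ^ β))) := by
  set α := β / 2 with hαd
  have hα : 0 < α := by positivity
  have hα1 : α < 1 := by rw [hαd]; linarith
  set c := bernsteinConst α
  have hc : 0 < c := bernsteinConst_pos hα hα1
  have hform : ∀ (j : ℕ) (ξ : V), Real.exp (-(t / c) * levyLaplace α (1 / (j + 1)) 0) *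
      Real.exp (t / c * levyLaplace α (1 / (j + 1)) (‖ξ‖ ^ 2)) =
      Real.exp (-(t / c * (levyLaplace α (1 / (j + 1)) 0 -
        levyLaplace α (1 / (j + 1)) (‖ξ‖ ^ 2)))) := by
    intro j ξ
    rw [← Real.exp_add]
    congr 1
    ring
  refine GaussPos.of_tendsto (M := 1) (φ := fun (j : ℕ) ξ =>
    Real.exp (-(t / c) * levyLaplace α (1 / (j + 1)) 0) *
      Real.exp (t / c * levyLaplace α (1 / (j + 1)) (‖ξ‖ ^ 2))) (fun j => ?_) (fun j => ?_)
    (fun j ξ => ?_) (fun ξ => ?_)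
  · exact (gaussPos_exp_levyLaplace hα (by positivity) (by positivity)).const_mul
      (Real.exp_nonneg _)
  · have : Measurable (fun ξ : V => levyLaplace α (1 / (j + 1)) (‖ξ‖ ^ 2)) :=
      measurable_levyLaplace.comp (by fun_prop)
    fun_prop
  · rw [hform, Real.abs_exp]
    refine Real.exp_le_one_iff.2 (neg_nonpos.2 (mul_nonneg (by positivity) ?_))
    exact sub_nonneg.2 (levyLaplace_le hα (by positivity) (by positivity))
  · simp_rw [hform]
    have h1 := (tendsto_levyLaplace_sub hα hα1 (s := ‖ξ‖ ^ 2) (by positivity)).const_mul (t / c)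
    have h2 : t / c * (bernsteinConst α * (‖ξ‖ ^ 2) ^ α) = t * ‖ξ‖ ^ β := by
      have : (‖ξ‖ ^ 2) ^ α = ‖ξ‖ ^ β := by
        rw [← Real.rpow_natCast, ← Real.rpow_mul (norm_nonneg _)]
        congr 1
        rw [hαd]; push_cast; ring
      rw [this]
      change t / c * (c * _) = _
      field_simp
    rw [h2] at h1
    exact (Real.continuous_exp.tendsto _).comp h1.neg

end Bernstein

/-! ### The fundamental solution: positivity, scaling, unit mass -/

section Kernel

variable {n : ℕ} {β : ℝ}

lemma measurable_kernel :
    Measurable (fun z : ℝ × EuclideanSpace ℝ (Fin n) => kernel β z.1 z.2) := by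
  have h : StronglyMeasurable
      (fun z : (ℝ × EuclideanSpace ℝ (Fin n)) × EuclideanSpace ℝ (Fin n) =>
        Complex.exp (Complex.I * ((inner ℝ z.1.2 z.2 : ℝ) : ℂ) -
          ((z.1.1 * ‖z.2‖ ^ β : ℝ) : ℂ))) :=
    Measurable.stronglyMeasurable (by fun_prop)
  have h2 := (h.integral_prod_right' (ν := (volume : Measure (EuclideanSpace ℝ (Fin n))))).measurable
  exact (Complex.measurable_re.comp h2).const_mul _

@[fun_prop]
lemma measurable_kernel_comp {X : Type*} [MeasurableSpace X] {g : X → ℝ}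
    {h : X → EuclideanSpace ℝ (Fin n)} (hg : Measurable g) (hh : Measurable h) :
    Measurable (fun a => kernel β (g a) (h a)) := by
  have h1 := (measurable_kernel (n := n) (β := β)).comp (hg.prodMk hh)
  exact h1

variable [NeZero n]

lemma integrable_exp_neg_mul_norm_rpow (hβ : 0 < β) {t : ℝ} (ht : 0 < t) :
    Integrable (fun ξ : EuclideanSpace ℝ (Fin n) => Real.exp (-(t * ‖ξ‖ ^ β))) := by
  have h := (integrable_fun_norm_addHaar (E := EuclideanSpace ℝ (Fin n)) volume
    (f := fun r : ℝ => Real.exp (-(t * r ^ β)))).2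
  refine h ?_
  have h2 := integrableOn_rpow_mul_exp_neg_mul_rpow (p := β) (s := (n : ℝ) - 1) (b := t)
    (by have : (0 : ℝ) < n := Nat.cast_pos.2 (NeZero.pos n)
        linarith) hβ ht
  refine h2.congr_fun (fun r hr => ?_) measurableSet_Ioi
  have hn : (n : ℝ) - 1 = ((n - 1 : ℕ) : ℝ) := by
    rw [Nat.cast_sub (NeZero.one_le)]; simp
  simp only [smul_eq_mul, finrank_euclideanSpace, Fintype.card_fin]
  rw [hn, Real.rpow_natCast, neg_mul]

lemma integrable_kernel_integrand (hβ : 0 < β) {t : ℝ} (ht : 0 < t)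
    (x : EuclideanSpace ℝ (Fin n)) :
    Integrable (fun ξ : EuclideanSpace ℝ (Fin n) =>
      Real.cos (inner ℝ x ξ) * Real.exp (-(t * ‖ξ‖ ^ β))) := by
  refine (integrable_exp_neg_mul_norm_rpow hβ ht).mono'
    (Measurable.aestronglyMeasurable (by fun_prop)) (Eventually.of_forall fun ξ => ?_)
  rw [norm_mul, Real.norm_eq_abs, Real.norm_eq_abs, Real.abs_exp]
  exact mul_le_of_le_one_left (Real.exp_nonneg _) (Real.abs_cos_le_one _)

lemma kernel_eq (hβ : 0 < β) {t : ℝ} (ht : 0 < t) (x : EuclideanSpace ℝ (Fin n)) :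
    kernel β t x = ((2 * Real.pi) ^ n)⁻¹ *
      ∫ ξ : EuclideanSpace ℝ (Fin n), Real.cos (inner ℝ x ξ) * Real.exp (-(t * ‖ξ‖ ^ β)) := by
  have e0 : ∀ ξ : EuclideanSpace ℝ (Fin n),
      Complex.I * ((inner ℝ x ξ : ℝ) : ℂ) - ((t * ‖ξ‖ ^ β : ℝ) : ℂ) =
      ((-(t * ‖ξ‖ ^ β) : ℝ) : ℂ) + ((inner ℝ x ξ : ℝ) : ℂ) * Complex.I := by
    intro ξ; push_cast; ring
  have hi : Integrable (fun ξ : EuclideanSpace ℝ (Fin n) =>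
      Complex.exp (Complex.I * ((inner ℝ x ξ : ℝ) : ℂ) - ((t * ‖ξ‖ ^ β : ℝ) : ℂ))) := by
    refine (integrable_exp_neg_mul_norm_rpow hβ ht).mono'
      (Measurable.aestronglyMeasurable (by fun_prop)) (Eventually.of_forall fun ξ => ?_)
    rw [e0, Complex.norm_exp, Complex.add_re, Complex.ofReal_re, Complex.re_ofReal_mul,
      Complex.I_re, mul_zero, add_zero]
  rw [kernel]
  congr 1
  refine (integral_re hi).symm.trans (integral_congr_ae (Eventually.of_forall fun ξ => ?_))
  change (Complex.exp _).re = _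
  rw [e0, Complex.exp_re, Complex.add_re, Complex.add_im, Complex.ofReal_re, Complex.ofReal_im,
    Complex.re_ofReal_mul, Complex.im_ofReal_mul, Complex.I_re, Complex.I_im, mul_zero, add_zero,
    zero_add, mul_one, mul_comm]

/-- `GaussPos` gives the sign in the presence of a Gaussian factor; dominated convergence removes
that factor. -/
lemma kernel_nonneg (hβ : 0 < β) (hβ2 : β < 2) {t : ℝ} (ht : 0 < t)
    (x : EuclideanSpace ℝ (Fin n)) : 0 ≤ kernel β t x := by
  rw [kernel_eq hβ ht]
  refine mul_nonneg (by positivity) ?_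
  refine ge_of_tendsto' (tendsto_integral_of_dominated_convergence
    (F := fun (j : ℕ) (ξ : EuclideanSpace ℝ (Fin n)) =>
      Real.cos (inner ℝ x ξ) * Real.exp (-(t * ‖ξ‖ ^ β)) * Real.exp (-(1 / ((j : ℝ) + 1)) * ‖ξ‖ ^ 2))
    (fun ξ => Real.exp (-(t * ‖ξ‖ ^ β))) (fun j => ?_)
    (integrable_exp_neg_mul_norm_rpow hβ ht) (fun j => Eventually.of_forall fun ξ => ?_)
    (Eventually.of_forall fun ξ => ?_)) (fun j => ?_)
  · exact Measurable.aestronglyMeasurable (by fun_prop)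
  · rw [norm_mul, norm_mul, Real.norm_eq_abs, Real.norm_eq_abs, Real.norm_eq_abs, Real.abs_exp,
      Real.abs_exp]
    have h1 := Real.abs_cos_le_one (inner ℝ x ξ)
    have h2 : Real.exp (-(1 / ((j : ℝ) + 1)) * ‖ξ‖ ^ 2) ≤ 1 :=
      Real.exp_le_one_iff.2 (mul_nonpos_of_nonpos_of_nonneg
        (neg_nonpos.2 (by positivity)) (by positivity))
    calc _ ≤ 1 * Real.exp (-(t * ‖ξ‖ ^ β)) * 1 := by gcongr
      _ = _ := by ring
  · have h1 : Tendsto (fun j : ℕ => -(1 / ((j : ℝ) + 1)) * ‖ξ‖ ^ 2) atTop (𝓝 (-0 * ‖ξ‖ ^ 2)) :=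
      (tendsto_one_div_add_atTop_nhds_zero_nat.neg).mul_const _
    have h2 := ((Real.continuous_exp.tendsto _).comp h1).const_mul
      (Real.cos (inner ℝ x ξ) * Real.exp (-(t * ‖ξ‖ ^ β)))
    simpa using h2
  · exact gaussPos_exp_neg_rpow hβ hβ2 ht _ (by positivity) x

lemma kernel_scale (hβ : 0 < β) {t : ℝ} (ht : 0 < t) (x : EuclideanSpace ℝ (Fin n)) :
    kernel β t x = t ^ (-(n / β)) * kernel β 1 (t ^ (-(1 / β)) • x) := by
  rw [kernel_eq hβ ht, kernel_eq hβ one_pos]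
  have h := Measure.integral_comp_smul (volume : Measure (EuclideanSpace ℝ (Fin n)))
    (fun ξ => Real.cos (inner ℝ (t ^ (-(1 / β)) • x) ξ) * Real.exp (-(1 * ‖ξ‖ ^ β))) (t ^ (1 / β))
  have h2 : ∀ ξ : EuclideanSpace ℝ (Fin n),
      Real.cos (inner ℝ (t ^ (-(1 / β)) • x) (t ^ (1 / β) • ξ)) *
        Real.exp (-(1 * ‖t ^ (1 / β) • ξ‖ ^ β)) =
      Real.cos (inner ℝ x ξ) * Real.exp (-(t * ‖ξ‖ ^ β)) := by
    intro ξ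
    have e1 : t ^ (-(1 / β)) * t ^ (1 / β) = 1 := by
      rw [← Real.rpow_add ht]; simp
    have e2 : (t ^ (1 / β)) ^ β = t := by
      rw [← Real.rpow_mul ht.le]; field_simp; simp
    rw [real_inner_smul_left, real_inner_smul_right, ← mul_assoc, e1, one_mul, norm_smul,
      Real.norm_of_nonneg (by positivity), Real.mul_rpow (by positivity) (norm_nonneg _), e2,
      one_mul]
  simp_rw [h2] at h
  rw [h, smul_eq_mul, finrank_euclideanSpace, Fintype.card_fin, abs_of_nonneg (by positivity)]
  have e3 : ((t ^ (1 / β)) ^ n)⁻¹ = t ^ (-(n / β)) := by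
    rw [← Real.rpow_natCast, ← Real.rpow_mul ht.le, ← Real.rpow_neg ht.le]
    congr 1
    ring
  rw [e3]
  ring

lemma abs_kernel_one_le (hβ : 0 < β) (x : EuclideanSpace ℝ (Fin n)) :
    |kernel β 1 x| ≤ kernel β 1 (0 : EuclideanSpace ℝ (Fin n)) := by
  rw [kernel_eq hβ one_pos, kernel_eq hβ one_pos, abs_mul, abs_of_nonneg (by positivity)]
  refine mul_le_mul_of_nonneg_left ?_ (by positivity)
  rw [← Real.norm_eq_abs]
  refine (norm_integral_le_integral_norm _).trans ?_
  refine integral_mono (integrable_kernel_integrand hβ one_pos x).norm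
    (integrable_kernel_integrand hβ one_pos 0) fun ξ => ?_
  simp only [norm_mul, Real.norm_eq_abs, Real.abs_exp, inner_zero_left, Real.cos_zero, one_mul]
  exact mul_le_of_le_one_left (Real.exp_nonneg _) (Real.abs_cos_le_one _)

/-- The maximum of the fundamental solution at time one. -/
def kernelMax (n : ℕ) (β : ℝ) : ℝ := kernel β 1 (0 : EuclideanSpace ℝ (Fin n))

lemma kernelMax_nonneg (hβ : 0 < β) : 0 ≤ kernelMax n β :=
  (abs_nonneg _).trans (abs_kernel_one_le hβ (0 : EuclideanSpace ℝ (Fin n)))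

lemma kernel_le (hβ : 0 < β) {t : ℝ} (ht : 0 < t) (x : EuclideanSpace ℝ (Fin n)) :
    kernel β t x ≤ kernelMax n β * t ^ (-(n / β)) := by
  rw [kernel_scale hβ ht, mul_comm]
  exact mul_le_mul_of_nonneg_right ((le_abs_self _).trans (abs_kernel_one_le hβ _)) (by positivity)

lemma continuous_kernel_one (hβ : 0 < β) :
    Continuous (kernel β 1 : EuclideanSpace ℝ (Fin n) → ℝ) := by
  have : (kernel β 1 : EuclideanSpace ℝ (Fin n) → ℝ) = fun x => ((2 * Real.pi) ^ n)⁻¹ *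
      ∫ ξ : EuclideanSpace ℝ (Fin n), Real.cos (inner ℝ x ξ) * Real.exp (-(1 * ‖ξ‖ ^ β)) :=
    funext fun x => kernel_eq hβ one_pos x
  rw [this]
  refine continuous_const.mul (continuous_of_dominated
    (bound := fun ξ : EuclideanSpace ℝ (Fin n) => Real.exp (-(1 * ‖ξ‖ ^ β))) (fun x => ?_)
    (fun x => Eventually.of_forall fun ξ => ?_) (integrable_exp_neg_mul_norm_rpow hβ one_pos)
    (Eventually.of_forall fun ξ => ?_))
  · exact (integrable_kernel_integrand hβ one_pos x).aestronglyMeasurable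
  · rw [norm_mul, Real.norm_eq_abs, Real.norm_eq_abs, Real.abs_exp]
    exact mul_le_of_le_one_left (Real.exp_nonneg _) (Real.abs_cos_le_one _)
  · fun_prop

/-- Fubini moves the Gaussian to the frequency side, and the substitution `ξ = rζ` leaves `r` in the
symbol only, so the limit `r → 0` can be read off. -/
lemma integral_kernel_mul_gaussian (hβ : 0 < β) {r : ℝ} (hr : 0 < r) :
    Integrable (fun x : EuclideanSpace ℝ (Fin n) =>
      kernel β 1 x * Real.exp (-(r ^ 2 / 4) * ‖x‖ ^ 2)) ∧
    ∫ x : EuclideanSpace ℝ (Fin n), kernel β 1 x * Real.exp (-(r ^ 2 / 4) * ‖x‖ ^ 2) =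
      (Real.pi ^ (n / 2 : ℝ))⁻¹ *
        ∫ ζ : EuclideanSpace ℝ (Fin n), Real.exp (-(r ^ β * ‖ζ‖ ^ β)) * Real.exp (-1 * ‖ζ‖ ^ 2) := by
  have hδ : 0 < r ^ 2 / 4 := by positivity
  constructor
  · refine ((integrable_gaussian hδ).const_mul (kernelMax n β)).mono'
      (Measurable.aestronglyMeasurable (by fun_prop)) (Eventually.of_forall fun x => ?_)
    rw [norm_mul, Real.norm_eq_abs, Real.norm_eq_abs, Real.abs_exp]
    exact mul_le_mul_of_nonneg_right (abs_kernel_one_le hβ x) (Real.exp_nonneg _)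
  have h1 : ∀ x : EuclideanSpace ℝ (Fin n),
      kernel β 1 x * Real.exp (-(r ^ 2 / 4) * ‖x‖ ^ 2) =
      ((2 * Real.pi) ^ n)⁻¹ * ∫ ξ : EuclideanSpace ℝ (Fin n),
        Real.cos (inner ℝ x ξ) * Real.exp (-(1 * ‖ξ‖ ^ β)) *
          Real.exp (-(r ^ 2 / 4) * ‖x‖ ^ 2) := by
    intro x
    rw [kernel_eq hβ one_pos, integral_mul_const]
    ring
  simp_rw [h1]
  rw [integral_const_mul, integral_integral_swap]
  · have h2 : ∀ ξ : EuclideanSpace ℝ (Fin n), ∫ x : EuclideanSpace ℝ (Fin n),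
        Real.cos (inner ℝ x ξ) * Real.exp (-(1 * ‖ξ‖ ^ β)) *
          Real.exp (-(r ^ 2 / 4) * ‖x‖ ^ 2) =
        (Real.pi / (r ^ 2 / 4)) ^ (n / 2 : ℝ) *
          (Real.exp (-(r ^ β * ‖r⁻¹ • ξ‖ ^ β)) * Real.exp (-1 * ‖r⁻¹ • ξ‖ ^ 2)) := by
      intro ξ
      have h3 := integral_cos_mul_gaussian hδ ξ
      rw [finrank_euclideanSpace, Fintype.card_fin] at h3
      have h4 : ∀ x : EuclideanSpace ℝ (Fin n),
          Real.cos (inner ℝ x ξ) * Real.exp (-(1 * ‖ξ‖ ^ β)) *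
          Real.exp (-(r ^ 2 / 4) * ‖x‖ ^ 2) = Real.exp (-(1 * ‖ξ‖ ^ β)) *
          (Real.cos (inner ℝ ξ x) * Real.exp (-(r ^ 2 / 4) * ‖x‖ ^ 2)) := by
        intro x
        rw [real_inner_comm]
        ring
      simp_rw [h4]
      rw [integral_const_mul, h3, norm_smul, norm_inv, Real.norm_of_nonneg hr.le,
        Real.mul_rpow (by positivity) (norm_nonneg _), Real.inv_rpow hr.le]
      have e1 : r ^ β * ((r ^ β)⁻¹ * ‖ξ‖ ^ β) = 1 * ‖ξ‖ ^ β := by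
        have : r ^ β ≠ 0 := (Real.rpow_pos_of_pos hr _).ne'
        field_simp
      have e2 : -1 * (r⁻¹ * ‖ξ‖) ^ 2 = -(‖ξ‖ ^ 2 / (4 * (r ^ 2 / 4))) := by
        field_simp
      rw [e1, e2]
      ring
    simp_rw [h2]
    rw [integral_const_mul, Measure.integral_comp_smul (volume : Measure (EuclideanSpace ℝ (Fin n)))
      (fun ζ => Real.exp (-(r ^ β * ‖ζ‖ ^ β)) * Real.exp (-1 * ‖ζ‖ ^ 2)) r⁻¹, smul_eq_mul,
      finrank_euclideanSpace, Fintype.card_fin, abs_of_nonneg (by positivity)]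
    rw [← mul_assoc, ← mul_assoc]
    congr 1
    have e3 : (Real.pi / (r ^ 2 / 4)) ^ (n / 2 : ℝ) = (Real.pi ^ (n / 2 : ℝ))⁻¹ *
        ((2 * Real.pi) ^ n * (r⁻¹) ^ n) := by
      have e4 : Real.pi / (r ^ 2 / 4) = Real.pi⁻¹ * ((2 * Real.pi) * r⁻¹) ^ 2 := by
        field_simp
        ring
      rw [e4, Real.mul_rpow (by positivity) (by positivity), Real.inv_rpow Real.pi_pos.le,
        ← mul_pow]
      congr 1
      rw [← Real.rpow_natCast _ 2, ← Real.rpow_mul (by positivity), ← Real.rpow_natCast _ n]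
      congr 1
      push_cast
      ring
    rw [e3]
    have : (2 * Real.pi) ^ n ≠ 0 := by positivity
    have : r ^ n ≠ 0 := by positivity
    field_simp
  · have hdom := (integrable_gaussian (V := EuclideanSpace ℝ (Fin n)) hδ).mul_prod
      (integrable_exp_neg_mul_norm_rpow (n := n) hβ one_pos)
    refine hdom.mono' (Measurable.aestronglyMeasurable (by fun_prop))
      (Eventually.of_forall fun z => ?_)
    simp only [Function.uncurry]
    rw [norm_mul, norm_mul, Real.norm_eq_abs, Real.norm_eq_abs, Real.norm_eq_abs, Real.abs_exp,
      Real.abs_exp, mul_comm]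
    refine mul_le_mul_of_nonneg_left ?_ (Real.exp_nonneg _)
    exact mul_le_of_le_one_left (Real.exp_nonneg _) (Real.abs_cos_le_one _)

/-- Let `r → 0` in the preceding identity: monotone convergence on the kernel side, which relies on
positivity, and dominated convergence on the symbol side. Integrability of the kernel is a
consequence, hence the extended integral. -/
lemma lintegral_kernel_one (hβ : 0 < β) (hβ2 : β < 2) :
    ∫⁻ x : EuclideanSpace ℝ (Fin n), ENNReal.ofReal (kernel β 1 x) = 1 := by
  set r : ℕ → ℝ := fun j => 1 / ((j : ℝ) + 1) with hrd
  have hr : ∀ j, 0 < r j := fun j => by rw [hrd]; positivity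
  have hr0 : Tendsto r atTop (𝓝 0) := tendsto_one_div_add_atTop_nhds_zero_nat
  have hranti : Antitone r := fun i j hij =>
    one_div_le_one_div_of_le (by positivity) (by gcongr)
  have hlim1 : Tendsto (fun j => ∫⁻ x : EuclideanSpace ℝ (Fin n),
      ENNReal.ofReal (kernel β 1 x * Real.exp (-(r j ^ 2 / 4) * ‖x‖ ^ 2))) atTop
      (𝓝 (∫⁻ x : EuclideanSpace ℝ (Fin n), ENNReal.ofReal (kernel β 1 x))) := by
    refine lintegral_tendsto_of_tendsto_of_monotone (fun j => ?_)
      (Eventually.of_forall fun x i j hij => ?_) (Eventually.of_forall fun x => ?_)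
    · exact Measurable.aemeasurable (by fun_prop)
    · refine ENNReal.ofReal_le_ofReal (mul_le_mul_of_nonneg_left (Real.exp_le_exp.2 ?_)
        (kernel_nonneg hβ hβ2 one_pos x))
      have := hranti hij
      have h0 := (hr j).le
      have : r j ^ 2 ≤ r i ^ 2 := pow_le_pow_left₀ h0 this 2
      nlinarith [sq_nonneg ‖x‖]
    · refine ENNReal.tendsto_ofReal ?_
      have h1 : Tendsto (fun j => -(r j ^ 2 / 4) * ‖x‖ ^ 2) atTop
          (𝓝 (-((0 : ℝ) ^ 2 / 4) * ‖x‖ ^ 2)) :=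
        (((hr0.pow 2).div_const 4).neg).mul_const _
      have h2 := ((Real.continuous_exp.tendsto _).comp h1).const_mul (kernel β 1 x)
      simpa using h2
  have hlim2 : Tendsto (fun j => ∫ x : EuclideanSpace ℝ (Fin n),
      kernel β 1 x * Real.exp (-(r j ^ 2 / 4) * ‖x‖ ^ 2)) atTop (𝓝 1) := by
    have h1 : ∀ j, ∫ x : EuclideanSpace ℝ (Fin n),
        kernel β 1 x * Real.exp (-(r j ^ 2 / 4) * ‖x‖ ^ 2) = _ := fun j =>
      (integral_kernel_mul_gaussian hβ (hr j)).2
    simp_rw [h1]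
    have h2 : (Real.pi ^ (n / 2 : ℝ))⁻¹ *
        ∫ ζ : EuclideanSpace ℝ (Fin n), Real.exp (-1 * ‖ζ‖ ^ 2) = 1 := by
      rw [GaussianFourier.integral_rexp_neg_mul_sq_norm one_pos, finrank_euclideanSpace,
        Fintype.card_fin, div_one, inv_mul_cancel₀ (by positivity)]
    rw [show 𝓝 (1 : ℝ) = 𝓝 ((Real.pi ^ (n / 2 : ℝ))⁻¹ *
        ∫ ζ : EuclideanSpace ℝ (Fin n), Real.exp (-1 * ‖ζ‖ ^ 2)) by rw [h2]]
    refine Tendsto.const_mul _ (tendsto_integral_of_dominated_convergence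
      (fun ζ => Real.exp (-1 * ‖ζ‖ ^ 2)) (fun j => ?_) (integrable_gaussian one_pos)
      (fun j => Eventually.of_forall fun ζ => ?_) (Eventually.of_forall fun ζ => ?_))
    · exact Measurable.aestronglyMeasurable (by fun_prop)
    · rw [norm_mul, Real.norm_eq_abs, Real.norm_eq_abs, Real.abs_exp, Real.abs_exp]
      refine mul_le_of_le_one_left (Real.exp_nonneg _) (Real.exp_le_one_iff.2 ?_)
      have := (hr j).le
      exact neg_nonpos.2 (by positivity)
    · have h3 : Tendsto (fun j => -(r j ^ β * ‖ζ‖ ^ β)) atTop (𝓝 (-((0 : ℝ) ^ β * ‖ζ‖ ^ β))) :=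
        ((hr0.rpow_const (Or.inr hβ.le)).mul_const _).neg
      have h4 := ((Real.continuous_exp.tendsto _).comp h3).mul_const (Real.exp (-1 * ‖ζ‖ ^ 2))
      simpa [Real.zero_rpow hβ.ne'] using h4
  have hlim3 := ENNReal.tendsto_ofReal hlim2
  rw [ENNReal.ofReal_one] at hlim3
  refine tendsto_nhds_unique hlim1 (hlim3.congr fun j => ?_)
  rw [ofReal_integral_eq_lintegral_ofReal (integral_kernel_mul_gaussian hβ (hr j)).1]
  exact Eventually.of_forall fun x =>
    mul_nonneg (kernel_nonneg hβ hβ2 one_pos x) (Real.exp_nonneg _)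

lemma integrable_kernel_one (hβ : 0 < β) (hβ2 : β < 2) :
    Integrable (kernel β 1 : EuclideanSpace ℝ (Fin n) → ℝ) := by
  refine ⟨Measurable.aestronglyMeasurable (by fun_prop), ?_⟩
  rw [hasFiniteIntegral_iff_ofReal (Eventually.of_forall fun x => kernel_nonneg hβ hβ2 one_pos x),
    lintegral_kernel_one hβ hβ2]
  exact ENNReal.one_lt_top

lemma integral_kernel_one (hβ : 0 < β) (hβ2 : β < 2) :
    ∫ x : EuclideanSpace ℝ (Fin n), kernel β 1 x = 1 := by
  rw [integral_eq_lintegral_of_nonneg_ae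
    (Eventually.of_forall fun x => kernel_nonneg hβ hβ2 one_pos x)
    (Measurable.aestronglyMeasurable (by fun_prop)), lintegral_kernel_one hβ hβ2]
  simp

lemma integral_kernel_mul_comp (hβ : 0 < β) {t : ℝ} (ht : 0 < t)
    (h : EuclideanSpace ℝ (Fin n) → ℝ) :
    ∫ x, kernel β t x * h x = ∫ z, kernel β 1 z * h (t ^ (1 / β) • z) := by
  have h1 := Measure.integral_comp_smul (volume : Measure (EuclideanSpace ℝ (Fin n)))
    (fun x => kernel β t x * h x) (t ^ (1 / β))
  rw [smul_eq_mul, finrank_euclideanSpace, Fintype.card_fin, abs_of_nonneg (by positivity)] at h1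
  have e3 : ((t ^ (1 / β)) ^ n)⁻¹ = t ^ (-(n / β)) := by
    rw [← Real.rpow_natCast, ← Real.rpow_mul ht.le, ← Real.rpow_neg ht.le]
    congr 1
    ring
  have h2 : ∀ z : EuclideanSpace ℝ (Fin n), kernel β t (t ^ (1 / β) • z) * h (t ^ (1 / β) • z) =
      t ^ (-(n / β)) * (kernel β 1 z * h (t ^ (1 / β) • z)) := by
    intro z
    rw [kernel_scale hβ ht, smul_smul, ← Real.rpow_add ht]
    simp [mul_assoc]
  simp_rw [h2] at h1
  rw [integral_const_mul, e3] at h1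
  exact (mul_left_cancel₀ (Real.rpow_pos_of_pos ht _).ne' h1).symm

lemma integrable_kernel (hβ : 0 < β) (hβ2 : β < 2) {t : ℝ} (ht : 0 < t) :
    Integrable (kernel β t : EuclideanSpace ℝ (Fin n) → ℝ) := by
  have h := (integrable_kernel_one (n := n) hβ hβ2).comp_smul
    (R := t ^ (-(1 / β))) (Real.rpow_pos_of_pos ht _).ne'
  have h2 : (kernel β t : EuclideanSpace ℝ (Fin n) → ℝ) =
      fun x => t ^ (-(n / β)) * kernel β 1 (t ^ (-(1 / β)) • x) :=
    funext fun x => kernel_scale hβ ht x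
  rw [h2]
  exact h.const_mul _

lemma integral_kernel (hβ : 0 < β) (hβ2 : β < 2) {t : ℝ} (ht : 0 < t) :
    ∫ x : EuclideanSpace ℝ (Fin n), kernel β t x = 1 := by
  simpa [integral_kernel_one hβ hβ2] using
    integral_kernel_mul_comp (n := n) hβ ht (fun _ => 1)

lemma lintegral_kernel (hβ : 0 < β) (hβ2 : β < 2) {t : ℝ} (ht : 0 < t) :
    ∫⁻ x : EuclideanSpace ℝ (Fin n), ENNReal.ofReal (kernel β t x) = 1 := by
  rw [← ofReal_integral_eq_lintegral_ofReal (integrable_kernel hβ hβ2 ht)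
    (Eventually.of_forall fun x => kernel_nonneg hβ hβ2 ht x), integral_kernel hβ hβ2 ht]
  simp

end Kernel

/-! ### Continuity of the kernel in time, relative to its age -/

section TimeModulus

variable {n : ℕ} [NeZero n] {β : ℝ}

lemma kernel_mul_scale (hβ : 0 < β) {a r : ℝ} (ha : 0 < a) (hr : 0 < r)
    (x : EuclideanSpace ℝ (Fin n)) :
    kernel β (a * r) x = a ^ (-(n / β)) * kernel β r (a ^ (-(1 / β)) • x) := by
  rw [kernel_scale hβ (mul_pos ha hr), kernel_scale hβ hr, smul_smul,
    Real.mul_rpow ha.le hr.le, Real.mul_rpow ha.le hr.le, mul_assoc,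
    mul_comm (r ^ (-(1 / β)))]

lemma tendsto_kernel_time (hβ : 0 < β) (x : EuclideanSpace ℝ (Fin n)) :
    Tendsto (fun r => kernel β r x) (𝓝 1) (𝓝 (kernel β 1 x)) := by
  have h1 : Tendsto (fun r : ℝ => r ^ (-(n / β)) * kernel β 1 (r ^ (-(1 / β)) • x)) (𝓝 1)
      (𝓝 ((1 : ℝ) ^ (-(n / β)) * kernel β 1 ((1 : ℝ) ^ (-(1 / β)) • x))) := by
    have hc : ∀ q : ℝ, Tendsto (fun r : ℝ => r ^ q) (𝓝 1) (𝓝 ((1 : ℝ) ^ q)) := fun q =>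
      (Real.continuousAt_rpow_const 1 q (Or.inl one_ne_zero)).tendsto
    exact (hc _).mul (((continuous_kernel_one hβ).tendsto _).comp ((hc _).smul_const x))
  simp only [Real.one_rpow, one_mul, one_smul] at h1
  refine h1.congr' ?_
  filter_upwards [lt_mem_nhds (zero_lt_one' ℝ)] with r hr
  exact (kernel_scale hβ hr x).symm

/-- Scheffé's argument: `|a - b| = a + b - 2 min(a, b)`, both kernels have mass one, and the minimum
is dominated by the kernel at time one. -/
lemma tendsto_integral_abs_kernel_sub (hβ : 0 < β) (hβ2 : β < 2) :
    Tendsto (fun r => ∫ x : EuclideanSpace ℝ (Fin n), |kernel β 1 x - kernel β r x|) (𝓝 1)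
      (𝓝 0) := by
  have hmin : Tendsto (fun r => ∫ x : EuclideanSpace ℝ (Fin n), min (kernel β 1 x) (kernel β r x))
      (𝓝 1) (𝓝 (∫ x : EuclideanSpace ℝ (Fin n), kernel β 1 x)) := by
    refine tendsto_integral_filter_of_dominated_convergence (fun x => kernel β 1 x)
      (Eventually.of_forall fun r => Measurable.aestronglyMeasurable (by fun_prop)) ?_
      (integrable_kernel_one hβ hβ2) (Eventually.of_forall fun x => ?_)
    · filter_upwards [lt_mem_nhds (zero_lt_one' ℝ)] with r hr
      refine Eventually.of_forall fun x => ?_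
      rw [Real.norm_of_nonneg (le_min (kernel_nonneg hβ hβ2 one_pos x) (kernel_nonneg hβ hβ2 hr x))]
      exact min_le_left _ _
    · have := (tendsto_const_nhds (x := kernel β 1 x)).min (tendsto_kernel_time hβ x)
      rwa [min_self] at this
  rw [integral_kernel_one hβ hβ2] at hmin
  have h2 : Tendsto (fun r => 2 - 2 * ∫ x : EuclideanSpace ℝ (Fin n),
      min (kernel β 1 x) (kernel β r x)) (𝓝 1) (𝓝 (2 - 2 * 1)) := (hmin.const_mul 2).const_sub 2
  rw [mul_one, sub_self] at h2
  refine h2.congr' ?_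
  filter_upwards [lt_mem_nhds (zero_lt_one' ℝ)] with r hr
  have i1 := integrable_kernel_one (n := n) hβ hβ2
  have ir := integrable_kernel (n := n) hβ hβ2 hr
  have e : ∀ x : EuclideanSpace ℝ (Fin n), |kernel β 1 x - kernel β r x| =
      (kernel β 1 x + kernel β r x) - 2 * min (kernel β 1 x) (kernel β r x) := by
    intro x
    rcases le_total (kernel β 1 x) (kernel β r x) with h | h
    · rw [min_eq_left h, abs_of_nonpos (by linarith)]; ring
    · rw [min_eq_right h, abs_of_nonneg (by linarith)]; ring
  simp_rw [e]
  have imin : Integrable (fun x : EuclideanSpace ℝ (Fin n) => min (kernel β 1 x) (kernel β r x)) :=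
    i1.inf ir
  have iadd : Integrable (fun x : EuclideanSpace ℝ (Fin n) => kernel β 1 x + kernel β r x) :=
    i1.add ir
  rw [integral_sub iadd (imin.const_mul 2), integral_const_mul, integral_add i1 ir, integral_kernel_one hβ hβ2, integral_kernel hβ hβ2 hr]
  norm_num

/-- The `L^1` distance of the symbols bounds the uniform distance of the kernels. For `r > 1/2` the
symbol at time `1/2` provides domination. -/
lemma tendsto_integral_abs_symbol_sub (hβ : 0 < β) :
    Tendsto (fun r : ℝ => ((2 * Real.pi) ^ n)⁻¹ * ∫ ξ : EuclideanSpace ℝ (Fin n),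
      |Real.exp (-(1 * ‖ξ‖ ^ β)) - Real.exp (-(r * ‖ξ‖ ^ β))|) (𝓝 1) (𝓝 0) := by
  have h : Tendsto (fun r : ℝ => ∫ ξ : EuclideanSpace ℝ (Fin n),
      |Real.exp (-(1 * ‖ξ‖ ^ β)) - Real.exp (-(r * ‖ξ‖ ^ β))|) (𝓝 1)
      (𝓝 (∫ _ : EuclideanSpace ℝ (Fin n), (0 : ℝ))) := by
    refine tendsto_integral_filter_of_dominated_convergence
      (fun ξ => Real.exp (-(1 * ‖ξ‖ ^ β)) + Real.exp (-(1 / 2 * ‖ξ‖ ^ β)))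
      (Eventually.of_forall fun r => Measurable.aestronglyMeasurable (by fun_prop)) ?_
      ((integrable_exp_neg_mul_norm_rpow hβ one_pos).add
        (integrable_exp_neg_mul_norm_rpow hβ (by norm_num))) (Eventually.of_forall fun ξ => ?_)
    · filter_upwards [lt_mem_nhds (show (1 / 2 : ℝ) < 1 by norm_num)] with r hr
      refine Eventually.of_forall fun ξ => ?_
      rw [Real.norm_eq_abs, abs_abs]
      refine (abs_sub _ _).trans ?_
      rw [Real.abs_exp, Real.abs_exp]
      have h0 : 0 ≤ ‖ξ‖ ^ β := by positivity
      have : -(r * ‖ξ‖ ^ β) ≤ -(1 / 2 * ‖ξ‖ ^ β) := by nlinarith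
      have := Real.exp_le_exp.2 this
      linarith
    · have : Continuous (fun r : ℝ => |Real.exp (-(1 * ‖ξ‖ ^ β)) - Real.exp (-(r * ‖ξ‖ ^ β))|) := by
        fun_prop
      simpa using this.tendsto 1
  simpa using h.const_mul ((2 * Real.pi) ^ n)⁻¹

lemma abs_kernel_sub_le (hβ : 0 < β) {r : ℝ} (hr : 0 < r) (x : EuclideanSpace ℝ (Fin n)) :
    |kernel β 1 x - kernel β r x| ≤ ((2 * Real.pi) ^ n)⁻¹ * ∫ ξ : EuclideanSpace ℝ (Fin n),
      |Real.exp (-(1 * ‖ξ‖ ^ β)) - Real.exp (-(r * ‖ξ‖ ^ β))| := by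
  rw [kernel_eq hβ one_pos, kernel_eq hβ hr, ← mul_sub,
    ← integral_sub (integrable_kernel_integrand hβ one_pos x) (integrable_kernel_integrand hβ hr x),
    abs_mul, abs_of_nonneg (by positivity : (0 : ℝ) ≤ ((2 * Real.pi) ^ n)⁻¹)]
  refine mul_le_mul_of_nonneg_left ?_ (by positivity)
  rw [← Real.norm_eq_abs]
  refine norm_integral_le_of_norm_le (((integrable_exp_neg_mul_norm_rpow hβ one_pos).sub
    (integrable_exp_neg_mul_norm_rpow hβ hr)).abs) (Eventually.of_forall fun ξ => ?_)
  rw [← mul_sub, norm_mul]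
  exact mul_le_of_le_one_left (norm_nonneg _) (Real.abs_cos_le_one _)

/-- The kernels at two times of ratio close to one are close in `L¹` and in `L^∞`. -/
lemma exists_kernel_time_modulus (hβ : 0 < β) (hβ2 : β < 2) {e : ℝ} (he : 0 < e) :
    ∃ ρ : ℝ, 0 < ρ ∧ ∀ a b : ℝ, 0 < a → 0 < b → |b / a - 1| < ρ →
      (∫ x : EuclideanSpace ℝ (Fin n), |kernel β a x - kernel β b x|) ≤ e ∧
      ∀ x : EuclideanSpace ℝ (Fin n), |kernel β a x - kernel β b x| ≤ e * a ^ (-(n / β)) := by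
  have h1 := (tendsto_integral_abs_kernel_sub (n := n) hβ hβ2).eventually (gt_mem_nhds he)
  have h2 := (tendsto_integral_abs_symbol_sub (n := n) hβ).eventually (gt_mem_nhds he)
  obtain ⟨ρ, hρ, hball⟩ := Metric.eventually_nhds_iff.1 (h1.and h2)
  refine ⟨ρ, hρ, fun a b ha hb hab => ?_⟩
  obtain ⟨h3, h4⟩ := hball (y := b / a) (by rwa [Real.dist_eq])
  have hr : 0 < b / a := by positivity
  have hb' : a * (b / a) = b := by field_simp
  -- Scaling reduces `a` to one and leaves only the ratio `b / a`: the `L^1` distance is invariant,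
  -- while the uniform distance acquires `a^{-n/β}`.
  have e1 : ∀ x : EuclideanSpace ℝ (Fin n), |kernel β a x - kernel β b x| =
      a ^ (-(n / β)) * |kernel β 1 (a ^ (-(1 / β)) • x) - kernel β (b / a) (a ^ (-(1 / β)) • x)| := by
    intro x
    rw [← hb', kernel_mul_scale hβ ha hr, kernel_scale hβ ha, ← mul_sub, abs_mul,
      abs_of_pos (Real.rpow_pos_of_pos ha _), hb']
  constructor
  · simp_rw [e1]
    rw [integral_const_mul, Measure.integral_comp_smul
      (volume : Measure (EuclideanSpace ℝ (Fin n)))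
      (fun z => |kernel β 1 z - kernel β (b / a) z|) (a ^ (-(1 / β))), smul_eq_mul,
      finrank_euclideanSpace, Fintype.card_fin, abs_of_nonneg (by positivity)]
    have e3 : a ^ (-(n / β)) * ((a ^ (-(1 / β))) ^ n)⁻¹ = 1 := by
      rw [← Real.rpow_natCast, ← Real.rpow_mul ha.le, ← Real.rpow_neg ha.le, ← Real.rpow_add ha]
      have : -(n / β) + -(-(1 / β) * n) = 0 := by ring
      rw [this, Real.rpow_zero]
    rw [← mul_assoc, e3, one_mul]
    exact h3.le
  · intro x
    rw [e1, mul_comm]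
    exact mul_le_mul_of_nonneg_right ((abs_kernel_sub_le hβ hr _).trans h4.le) (by positivity)

end TimeModulus

/-! ### The semigroup on functions with values in `[0, ∞]` -/

section HeatL

variable {n : ℕ} {β : ℝ}

/-- The heat semigroup acting on functions with values in `[0, ∞]`. -/
def heatL (β τ : ℝ) (H : EuclideanSpace ℝ (Fin n) → ℝ≥0∞) (x : EuclideanSpace ℝ (Fin n)) : ℝ≥0∞ :=
  ∫⁻ y, ENNReal.ofReal (kernel β τ (x - y)) * H y

lemma heatL_mono {τ : ℝ} {H G : EuclideanSpace ℝ (Fin n) → ℝ≥0∞} (h : ∀ y, H y ≤ G y)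
    (x : EuclideanSpace ℝ (Fin n)) : heatL β τ H x ≤ heatL β τ G x :=
  lintegral_mono fun y => by gcongr; exact h y

lemma heatL_const_mul {τ : ℝ} {c : ℝ≥0∞} (hc : c ≠ ∞) (H : EuclideanSpace ℝ (Fin n) → ℝ≥0∞)
    (x : EuclideanSpace ℝ (Fin n)) : heatL β τ (fun y => c * H y) x = c * heatL β τ H x := by
  rw [heatL, heatL, ← lintegral_const_mul' _ _ hc]
  exact lintegral_congr fun y => by ring

lemma heatL_add {τ : ℝ} {H G : EuclideanSpace ℝ (Fin n) → ℝ≥0∞} (hH : Measurable H)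
    (x : EuclideanSpace ℝ (Fin n)) :
    heatL β τ (fun y => H y + G y) x = heatL β τ H x + heatL β τ G x := by
  rw [heatL, heatL, heatL, ← lintegral_add_left (by fun_prop)]
  exact lintegral_congr fun y => by ring

variable [NeZero n]

lemma lintegral_kernel_sub (hβ : 0 < β) (hβ2 : β < 2) {τ : ℝ} (hτ : 0 < τ)
    (x : EuclideanSpace ℝ (Fin n)) : ∫⁻ y, ENNReal.ofReal (kernel β τ (x - y)) = 1 := by
  rw [lintegral_sub_left_eq_self (fun z => ENNReal.ofReal (kernel β τ z)) x,
    lintegral_kernel hβ hβ2 hτ]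

lemma heatL_le_const (hβ : 0 < β) (hβ2 : β < 2) {τ : ℝ} (hτ : 0 < τ)
    {H : EuclideanSpace ℝ (Fin n) → ℝ≥0∞} {M : ℝ≥0∞} (h : ∀ y, H y ≤ M)
    (x : EuclideanSpace ℝ (Fin n)) : heatL β τ H x ≤ M := by
  refine (heatL_mono h x).trans ?_
  rw [heatL, lintegral_mul_const _ (by fun_prop), lintegral_kernel_sub hβ hβ2 hτ, one_mul]

lemma lintegral_heatL (hβ : 0 < β) (hβ2 : β < 2) {τ : ℝ} (hτ : 0 < τ)
    {H : EuclideanSpace ℝ (Fin n) → ℝ≥0∞} (hH : Measurable H) :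
    ∫⁻ x, heatL β τ H x = ∫⁻ y, H y := by
  simp only [heatL]
  rw [lintegral_lintegral_swap (Measurable.aemeasurable (by fun_prop))]
  refine lintegral_congr fun y => ?_
  rw [lintegral_mul_const _ (by fun_prop),
    lintegral_sub_right_eq_self (fun z => ENNReal.ofReal (kernel β τ z)) y,
    lintegral_kernel hβ hβ2 hτ, one_mul]

lemma heatL_le_lintegral (hβ : 0 < β) {τ : ℝ} (hτ : 0 < τ)
    (H : EuclideanSpace ℝ (Fin n) → ℝ≥0∞) (x : EuclideanSpace ℝ (Fin n)) :
    heatL β τ H x ≤ ENNReal.ofReal (kernelMax n β * τ ^ (-(n / β))) * ∫⁻ y, H y := by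
  rw [← lintegral_const_mul' _ _ ENNReal.ofReal_ne_top]
  exact lintegral_mono fun y => by gcongr; exact kernel_le hβ hτ _

/-- Jensen's inequality for powers. -/
lemma heatL_le_rpow (hβ : 0 < β) (hβ2 : β < 2) {τ : ℝ} (hτ : 0 < τ) {r : ℝ} (hr : 1 < r)
    {H : EuclideanSpace ℝ (Fin n) → ℝ≥0∞} (hH : Measurable H) (x : EuclideanSpace ℝ (Fin n)) :
    heatL β τ H x ≤ (heatL β τ (fun y => H y ^ r) x) ^ (1 / r) := by
  set μ : Measure (EuclideanSpace ℝ (Fin n)) :=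
    volume.withDensity (fun y => ENNReal.ofReal (kernel β τ (x - y))) with hμ
  have hm : Measurable (fun y => ENNReal.ofReal (kernel β τ (x - y))) := by fun_prop
  have e : ∀ G : EuclideanSpace ℝ (Fin n) → ℝ≥0∞, Measurable G →
      heatL β τ G x = ∫⁻ y, G y ∂μ := by
    intro G hG
    rw [hμ, lintegral_withDensity_eq_lintegral_mul _ hm hG]
    rfl
  have h1 : ∫⁻ _, 1 ∂μ = 1 := by
    rw [← e _ measurable_const, heatL]
    simpa using lintegral_kernel_sub hβ hβ2 hτ x
  rw [e H hH, e _ (by fun_prop)]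
  have hc := Real.HolderConjugate.conjExponent hr
  have h2 := ENNReal.lintegral_mul_le_Lp_mul_Lq μ hc hH.aemeasurable
    (g := fun _ => 1) aemeasurable_const
  simpa [h1] using h2

end HeatL

/-! ### Jensen's inequality for the Young function -/

section Jensen

/-- The Young function `exp (z ^ p) - 1`. -/
def young (p z : ℝ) : ℝ := Real.exp (z ^ p) - 1

lemma young_nonneg {p z : ℝ} (hz : 0 ≤ z) : 0 ≤ young p z := by
  have := Real.add_one_le_exp (z ^ p)
  have := Real.rpow_nonneg hz p
  rw [young]
  linarith

lemma rpow_le_young (p z : ℝ) : z ^ p ≤ young p z := by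
  have := Real.add_one_le_exp (z ^ p)
  rw [young]
  linarith

lemma young_mono {p : ℝ} (hp : 0 ≤ p) {y z : ℝ} (hy : 0 ≤ y) (hyz : y ≤ z) :
    young p y ≤ young p z :=
  sub_le_sub_right (Real.exp_le_exp.2 (Real.rpow_le_rpow hy hyz hp)) 1

@[fun_prop]
lemma measurable_young {X : Type*} [MeasurableSpace X] {p : ℝ} {g : X → ℝ} (hg : Measurable g) :
    Measurable (fun a => young p (g a)) := by
  unfold young
  fun_prop

lemma continuous_young {p : ℝ} (hp : 0 ≤ p) : Continuous (young p) :=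
  (Real.continuous_exp.comp (Real.continuous_rpow_const hp)).sub continuous_const

lemma convexOn_young {p : ℝ} (hp : 1 ≤ p) : ConvexOn ℝ (Set.Ici 0) (young p) := by
  have h1 : ConvexOn ℝ (Set.Ici (0 : ℝ)) (fun z : ℝ => Real.exp (z ^ p)) :=
    ⟨convex_Ici 0, fun x hx y hy a b ha hb hab =>
      (Real.exp_le_exp.2 ((convexOn_rpow hp).2 hx hy ha hb hab)).trans
        (convexOn_exp.2 (Set.mem_univ _) (Set.mem_univ _) ha hb hab)⟩
  exact h1.sub (concaveOn_const 1 (convex_Ici 0))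

lemma le_one_add_young {p z : ℝ} (hp : 1 ≤ p) (hz : 0 ≤ z) : z ≤ 1 + young p z := by
  rcases le_total z 1 with h | h
  · linarith [young_nonneg (p := p) hz]
  · have : z ≤ z ^ p := by simpa using Real.rpow_le_rpow_of_exponent_le h hp
    linarith [rpow_le_young p z]

/-- No integrability has to be assumed: if the right side is finite, then `z ≤ 1 + young p z` makes
`v` integrable and the usual Jensen inequality applies. -/
lemma ofReal_young_integral_le {X : Type*} [MeasurableSpace X] {μ : Measure X}
    [IsProbabilityMeasure μ] {p : ℝ} (hp : 1 ≤ p) {v : X → ℝ} (hv : Measurable v)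
    (hv0 : ∀ a, 0 ≤ v a) :
    ENNReal.ofReal (young p (∫ a, v a ∂μ)) ≤ ∫⁻ a, ENNReal.ofReal (young p (v a)) ∂μ := by
  by_cases htop : ∫⁻ a, ENNReal.ofReal (young p (v a)) ∂μ = ∞
  · rw [htop]; exact le_top
  have hy : Integrable (fun a => young p (v a)) μ := by
    refine ⟨Measurable.aestronglyMeasurable (by fun_prop), ?_⟩
    rw [hasFiniteIntegral_iff_ofReal (Eventually.of_forall fun a => young_nonneg (hv0 a))]
    exact lt_top_iff_ne_top.2 htop
  have hvi : Integrable v μ := by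
    refine ((integrable_const 1).add hy).mono' hv.aestronglyMeasurable
      (Eventually.of_forall fun a => ?_)
    rw [Real.norm_of_nonneg (hv0 a)]
    exact le_one_add_young hp (hv0 a)
  have h := (convexOn_young hp).map_integral_le
    (continuous_young (by linarith)).continuousOn isClosed_Ici
    (Eventually.of_forall fun a => hv0 a) hvi hy
  rw [← ofReal_integral_eq_lintegral_ofReal hy
    (Eventually.of_forall fun a => young_nonneg (hv0 a))]
  exact ENNReal.ofReal_le_ofReal h

variable {n : ℕ}

lemma expModular_eq {p : ℝ} (u : EuclideanSpace ℝ (Fin n) → ℝ) (k : ℝ) :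
    expModular p u k = ∫⁻ x, ENNReal.ofReal (young p (|u x| / k)) := rfl

/-- Convolution with an integrable function acts on the exponential Orlicz space. -/
lemma expModular_conv_le {p : ℝ} (hp : 1 ≤ p) {g u : EuclideanSpace ℝ (Fin n) → ℝ}
    (hg : Measurable g) (hgi : Integrable g) {A : ℝ} (hA : 0 < A) (hgA : ∫ x, |g x| ≤ A)
    (hu : Measurable u) {k : ℝ} (hk : 0 < k) :
    expModular p (fun x => ∫ y, g (x - y) * u y) (A * k) ≤ expModular p u k := by
  set A' := ∫ x, |g x| with hA'
  have hA'0 : 0 ≤ A' := integral_nonneg fun x => abs_nonneg _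
  -- If `g` vanishes almost everywhere, `|g|` cannot be normalized to a probability density, so this
  -- case is separate.
  rcases hA'0.eq_or_lt with h0 | hpos
  · have hz : g =ᵐ[volume] 0 := by
      have := (integral_eq_zero_iff_of_nonneg (fun x => abs_nonneg _) hgi.abs).1 h0.symm
      filter_upwards [this] with x hx
      simpa using hx
    have hz2 : ∀ x, ∫ y, g (x - y) * u y = 0 := by
      intro x
      refine integral_eq_zero_of_ae ?_
      have : (fun y => g (x - y)) =ᵐ[volume] fun _ => 0 :=
        (quasiMeasurePreserving_sub_left volume x).ae_eq_comp hz
      filter_upwards [this] with y hy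
      simp [hy]
    simp_rw [hz2]
    rw [expModular_eq]
    simp [young, Real.zero_rpow (by linarith : p ≠ 0)]
  have hlint : ∫⁻ x, ENNReal.ofReal (|g x| / A') = 1 := by
    rw [← ofReal_integral_eq_lintegral_ofReal (hgi.abs.div_const A')
      (Eventually.of_forall fun x => by positivity), integral_div, ← hA', div_self hpos.ne',
      ENNReal.ofReal_one]
  -- Jensen for the probability density `|g(x - y)| / A'` in `y`. Integrating in `x` afterwards
  -- removes this density by Fubini.
  have key : ∀ x, ENNReal.ofReal (young p (|∫ y, g (x - y) * u y| / (A * k))) ≤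
      ∫⁻ y, ENNReal.ofReal (|g (x - y)| / A') * ENNReal.ofReal (young p (|u y| / k)) := by
    intro x
    have hm : Measurable (fun y => (|g (x - y)| / A').toNNReal) := by fun_prop
    set μ : Measure (EuclideanSpace ℝ (Fin n)) :=
      volume.withDensity (fun y => ((|g (x - y)| / A').toNNReal : ℝ≥0∞)) with hμ
    have hprob : IsProbabilityMeasure μ := by
      refine ⟨?_⟩
      rw [hμ, withDensity_apply _ MeasurableSet.univ, Measure.restrict_univ]
      exact (lintegral_sub_left_eq_self (fun z => ENNReal.ofReal (|g z| / A')) x).trans hlint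
    have h1 := ofReal_young_integral_le (μ := μ) hp (v := fun y => |u y| / k) (by fun_prop)
      (fun y => by positivity)
    have h2 : ∫⁻ y, ENNReal.ofReal (young p (|u y| / k)) ∂μ =
        ∫⁻ y, ENNReal.ofReal (|g (x - y)| / A') * ENNReal.ofReal (young p (|u y| / k)) := by
      rw [hμ, lintegral_withDensity_eq_lintegral_mul _ (by fun_prop) (by fun_prop)]
      rfl
    rw [h2] at h1
    refine le_trans (ENNReal.ofReal_le_ofReal (young_mono (by linarith) (by positivity) ?_)) h1
    rw [hμ, integral_withDensity_eq_integral_smul hm]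
    have h3 : ∀ y, (|g (x - y)| / A').toNNReal • (|u y| / k) = |g (x - y) * u y| / (A' * k) := by
      intro y
      rw [NNReal.smul_def, Real.coe_toNNReal _ (by positivity), smul_eq_mul, abs_mul]
      field_simp
    simp_rw [h3]
    rw [integral_div]
    have h4 : |∫ y, g (x - y) * u y| ≤ ∫ y, |g (x - y) * u y| := by
      simpa [Real.norm_eq_abs] using norm_integral_le_integral_norm (fun y => g (x - y) * u y)
    gcongr
  rw [expModular_eq]
  refine (lintegral_mono key).trans ?_
  rw [lintegral_lintegral_swap (Measurable.aemeasurable (by fun_prop)), expModular_eq]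
  refine (lintegral_congr fun y => ?_).le
  rw [lintegral_mul_const _ (by fun_prop),
    lintegral_sub_right_eq_self (fun z => ENNReal.ofReal (|g z| / A')) y, hlint, one_mul]

end Jensen

/-! ### Powers and exponentials dominated by the Young function -/

section Elementary

/-- Raise `x ≤ e^x` at `x = bz/a` to the power `a`. -/
lemma rpow_le_const_mul_exp {a b z : ℝ} (ha : 0 ≤ a) (hb : 0 < b) (hz : 0 ≤ z) :
    z ^ a ≤ (a / b) ^ a * Real.exp (b * z) := by
  rcases ha.eq_or_lt with rfl | ha
  · simp only [Real.rpow_zero, one_mul]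
    exact Real.one_le_exp (by positivity)
  have h1 : z ≤ a / b * Real.exp (b * z / a) := by
    have h := Real.add_one_le_exp (b * z / a)
    have h2 : a / b * (b * z / a) = z := by field_simp
    calc z = a / b * (b * z / a) := h2.symm
      _ ≤ a / b * Real.exp (b * z / a) := by gcongr; linarith
  calc z ^ a ≤ (a / b * Real.exp (b * z / a)) ^ a := Real.rpow_le_rpow hz h1 ha.le
    _ = (a / b) ^ a * Real.exp (b * z) := by
      rw [Real.mul_rpow (by positivity) (Real.exp_nonneg _), ← Real.exp_mul]
      congr 2
      field_simp

lemma exp_le_two_mul_young {p y : ℝ} (hp : 0 ≤ p) (hy : 1 ≤ y) :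
    Real.exp (y ^ p) ≤ 2 * young p y := by
  have h1 : (1 : ℝ) ≤ y ^ p := Real.one_le_rpow hy hp
  have h2 := Real.add_one_le_exp (y ^ p)
  rw [young]
  linarith

/-- For `y ≤ 1` the Young function is at least `y^p ≥ y^r`, which is where `p ≤ r` matters. For `y ≥
1` half of the exponent `y^p` pays for `θ y^p` and the other half for the power. -/
lemma exists_rpow_mul_exp_le_young {p r : ℝ} (hp : 0 < p) (hr : p ≤ r) :
    ∃ c : ℝ, 0 < c ∧ ∀ θ y : ℝ, θ ≤ 1 / 2 → 0 ≤ y →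
      y ^ r * Real.exp (θ * y ^ p) ≤ c * young p y := by
  set a := r / p with ha
  have ha1 : 1 ≤ a := (one_le_div hp).2 hr
  refine ⟨Real.exp (1 / 2) + 2 * (a / (1 / 2)) ^ a, by positivity, fun θ y hθ hy => ?_⟩
  have hz : 0 ≤ y ^ p := Real.rpow_nonneg hy p
  have hyr : y ^ r = (y ^ p) ^ a := by
    rw [← Real.rpow_mul hy, ha]; congr 1; field_simp
  have hq := young_nonneg (p := p) hy
  have h3 : Real.exp (θ * y ^ p) ≤ Real.exp (1 / 2 * y ^ p) :=
    Real.exp_le_exp.2 (mul_le_mul_of_nonneg_right hθ hz)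
  rcases le_total y 1 with h | h
  · have hz1 : y ^ p ≤ 1 := Real.rpow_le_one hy h hp.le
    have h1 : (y ^ p) ^ a ≤ young p y := by
      refine le_trans ?_ (rpow_le_young p y)
      simpa using Real.rpow_le_rpow_of_exponent_ge' hz hz1 zero_le_one ha1
    have h2 : Real.exp (θ * y ^ p) ≤ Real.exp (1 / 2) :=
      h3.trans (Real.exp_le_exp.2 (by linarith))
    rw [hyr]
    calc (y ^ p) ^ a * Real.exp (θ * y ^ p) ≤ young p y * Real.exp (1 / 2) := by gcongr
      _ ≤ (Real.exp (1 / 2) + 2 * (a / (1 / 2)) ^ a) * young p y := by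
        have : 0 ≤ 2 * (a / (1 / 2)) ^ a * young p y := by positivity
        linarith
  · have h1 := rpow_le_const_mul_exp (a := a) (b := 1 / 2) (by linarith) (by norm_num) hz
    rw [hyr]
    calc (y ^ p) ^ a * Real.exp (θ * y ^ p)
        ≤ ((a / (1 / 2)) ^ a * Real.exp (1 / 2 * y ^ p)) * Real.exp (1 / 2 * y ^ p) := by gcongr
      _ = (a / (1 / 2)) ^ a * Real.exp (y ^ p) := by
        rw [mul_assoc, ← Real.exp_add]; congr 2; ring
      _ ≤ (a / (1 / 2)) ^ a * (2 * young p y) := by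
        gcongr
        exact exp_le_two_mul_young hp.le h
      _ ≤ (Real.exp (1 / 2) + 2 * (a / (1 / 2)) ^ a) * young p y := by
        have : 0 ≤ Real.exp (1 / 2) * young p y := by positivity
        linarith

/-- Only the power `1/R` of the Young function appears, so that the right side can be smoothed from
`L^R`. The shift by one leaves room for the bounded Duhamel part; since `1 + y ≤ 2y` for `y ≥ 1`, it
costs the factor `2^p` in the smallness of `θ`. -/
lemma exists_shift_rpow_mul_exp_le {p R a : ℝ} (hp : 0 < p) (hR : 0 < R) (ha : 0 ≤ a) :
    ∃ c : ℝ, 0 < c ∧ ∀ θ y : ℝ, 0 ≤ θ → θ * 2 ^ p ≤ 1 / (2 * R) → 0 ≤ y →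
      (1 + y) ^ a * Real.exp (θ * (1 + y) ^ p) ≤ c * (1 + young p y ^ (1 / R)) := by
  set c1 : ℝ := 2 ^ a * Real.exp (1 / (2 * R))
  set c2 : ℝ := 2 ^ a * ((a / p) / (1 / (2 * R))) ^ (a / p) * 2 ^ (1 / R)
  have hc1 : 0 < c1 := by positivity
  have hc2 : 0 ≤ c2 := by positivity
  refine ⟨c1 + c2, by positivity, fun θ y hθ hθ2 hy => ?_⟩
  have hq : 0 ≤ young p y ^ (1 / R) := Real.rpow_nonneg (young_nonneg hy) _
  rcases le_total y 1 with h | h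
  · calc (1 + y) ^ a * Real.exp (θ * (1 + y) ^ p)
        ≤ 2 ^ a * Real.exp (1 / (2 * R)) := by
          have e1 : 1 + y ≤ 2 := by linarith
          have e2 : θ * (1 + y) ^ p ≤ 1 / (2 * R) := by
            refine le_trans ?_ hθ2
            gcongr
          gcongr
      _ = c1 * 1 := by ring
      _ ≤ (c1 + c2) * (1 + young p y ^ (1 / R)) := by
        gcongr <;> linarith
  · have e1 : 1 + y ≤ 2 * y := by linarith
    have e2 : θ * (1 + y) ^ p ≤ 1 / (2 * R) * y ^ p := by
      calc θ * (1 + y) ^ p ≤ θ * (2 * y) ^ p := by gcongr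
        _ = θ * 2 ^ p * y ^ p := by rw [Real.mul_rpow (by norm_num) hy]; ring
        _ ≤ 1 / (2 * R) * y ^ p := by gcongr
    have e3 : y ^ a ≤ ((a / p) / (1 / (2 * R))) ^ (a / p) * Real.exp (1 / (2 * R) * y ^ p) := by
      have := rpow_le_const_mul_exp (a := a / p) (b := 1 / (2 * R)) (z := y ^ p)
        (by positivity) (by positivity) (Real.rpow_nonneg hy p)
      have e : (y ^ p) ^ (a / p) = y ^ a := by
        rw [← Real.rpow_mul hy]; congr 1; field_simp
      rwa [e] at this
    have e4 : Real.exp (1 / R * y ^ p) ≤ 2 ^ (1 / R) * young p y ^ (1 / R) := by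
      have := Real.rpow_le_rpow (Real.exp_nonneg _) (exp_le_two_mul_young hp.le h)
        (show 0 ≤ 1 / R by positivity)
      rw [Real.mul_rpow (by norm_num) (young_nonneg hy), ← Real.exp_mul] at this
      rwa [mul_comm (1 / R)]
    calc (1 + y) ^ a * Real.exp (θ * (1 + y) ^ p)
        ≤ (2 * y) ^ a * Real.exp (1 / (2 * R) * y ^ p) := by gcongr
      _ = 2 ^ a * y ^ a * Real.exp (1 / (2 * R) * y ^ p) := by
        rw [Real.mul_rpow (by norm_num) hy]
      _ ≤ 2 ^ a * (((a / p) / (1 / (2 * R))) ^ (a / p) * Real.exp (1 / (2 * R) * y ^ p)) *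
          Real.exp (1 / (2 * R) * y ^ p) := by gcongr
      _ = 2 ^ a * ((a / p) / (1 / (2 * R))) ^ (a / p) * Real.exp (1 / R * y ^ p) := by
        have : Real.exp (1 / R * y ^ p) =
            Real.exp (1 / (2 * R) * y ^ p) * Real.exp (1 / (2 * R) * y ^ p) := by
          rw [← Real.exp_add]; congr 1; field_simp; ring
        rw [this]; ring
      _ ≤ 2 ^ a * ((a / p) / (1 / (2 * R))) ^ (a / p) *
          (2 ^ (1 / R) * young p y ^ (1 / R)) := by gcongr
      _ = c2 * young p y ^ (1 / R) := by ring
      _ ≤ (c1 + c2) * (1 + young p y ^ (1 / R)) := by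
        gcongr <;> linarith

end Elementary

/-! ### Two time integrals -/

section TimeIntegrals

lemma lintegral_one_add_rpow_le {γ : ℝ} (hγ : 0 < γ) {t : ℝ} (ht : 0 ≤ t) :
    ∫⁻ s in Set.Ioo 0 t, ENNReal.ofReal ((1 + s) ^ (γ - 1)) ≤
      ENNReal.ofReal ((1 + t) ^ γ / γ) := by
  have hint : IntervalIntegrable (fun s : ℝ => (1 + s) ^ (γ - 1)) volume 0 t := by
    refine ContinuousOn.intervalIntegrable fun s hs => ?_
    rw [Set.uIcc_of_le ht] at hs
    have : (1 : ℝ) + s ≠ 0 := by linarith [hs.1]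
    exact ((continuousAt_const.add continuousAt_id).rpow_const (Or.inl this)).continuousWithinAt
  have hI : IntegrableOn (fun s : ℝ => (1 + s) ^ (γ - 1)) (Set.Ioo 0 t) := by
    rw [intervalIntegrable_iff_integrableOn_Ioo_of_le ht] at hint
    exact hint
  rw [← ofReal_integral_eq_lintegral_ofReal hI]
  · refine ENNReal.ofReal_le_ofReal ?_
    rw [← integral_Ioc_eq_integral_Ioo, ← intervalIntegral.integral_of_le ht]
    rw [intervalIntegral.integral_comp_add_left (fun s : ℝ => s ^ (γ - 1)) 1,
      integral_rpow (Or.inl (by linarith))]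
    simp only [add_zero, sub_add_cancel, Real.one_rpow]
    gcongr
    linarith
  · refine (ae_restrict_iff' measurableSet_Ioo).2 (Eventually.of_forall fun s hs => ?_)
    have := hs.1
    positivity

lemma lintegral_one_add_inv_sqrt_le {a t : ℝ} (hat : a ≤ t) :
    ∫⁻ s in Set.Ioo a t, ENNReal.ofReal (1 + (t - s) ^ (-(1 / 2) : ℝ)) ≤
      ENNReal.ofReal ((t - a) + 2 * (t - a) ^ (1 / 2 : ℝ)) := by
  have hint0 : IntervalIntegrable (fun s : ℝ => s ^ (-(1 / 2) : ℝ)) volume 0 (t - a) :=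
    intervalIntegral.intervalIntegrable_rpow' (by norm_num)
  have hint1 : IntervalIntegrable (fun s : ℝ => (t - s) ^ (-(1 / 2) : ℝ)) volume a t := by
    have := (hint0.comp_sub_left t).symm
    simpa using this
  have hint : IntervalIntegrable (fun s : ℝ => 1 + (t - s) ^ (-(1 / 2) : ℝ)) volume a t :=
    intervalIntegrable_const.add hint1
  have hI : IntegrableOn (fun s : ℝ => 1 + (t - s) ^ (-(1 / 2) : ℝ)) (Set.Ioo a t) := by
    rwa [intervalIntegrable_iff_integrableOn_Ioo_of_le hat] at hint
  rw [← ofReal_integral_eq_lintegral_ofReal hI]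
  · refine ENNReal.ofReal_le_ofReal ?_
    rw [← integral_Ioc_eq_integral_Ioo, ← intervalIntegral.integral_of_le hat,
      intervalIntegral.integral_add intervalIntegrable_const hint1,
      intervalIntegral.integral_comp_sub_left (fun s : ℝ => s ^ (-(1 / 2) : ℝ)) t,
      integral_rpow (Or.inl (by norm_num))]
    simp only [intervalIntegral.integral_const, sub_self, smul_eq_mul, mul_one]
    rw [Real.zero_rpow (by norm_num)]
    refine le_of_eq ?_
    norm_num
    ring
  · refine (ae_restrict_iff' measurableSet_Ioo).2 (Eventually.of_forall fun s hs => ?_)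
    have : 0 < t - s := sub_pos.2 hs.2
    positivity

end TimeIntegrals

/-! ### From bounds on the source to bounds on the Duhamel term -/

section Duhamel

variable {n : ℕ} {β : ℝ}

/-- Bounds on a source term: its mass at time `s`, and the effect of the semigroup on it. -/
structure SourceBound (β κ γ : ℝ) (η : ℝ≥0∞) (H : ℝ → EuclideanSpace ℝ (Fin n) → ℝ≥0∞) :
    Prop where
  meas : Measurable (Function.uncurry H)
  mass : ∀ s : ℝ, 0 < s → ∫⁻ y, H s y ≤ η * ENNReal.ofReal ((1 + s) ^ (γ - 1))
  heat : ∀ s τ : ℝ, 0 < s → 0 < τ → ∀ x, heatL β τ (H s) x ≤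
    η * ENNReal.ofReal ((1 + s) ^ (-κ - 1) * (1 + τ ^ (-(1 / 2) : ℝ)))

lemma measurable_heatL_time {H : ℝ → EuclideanSpace ℝ (Fin n) → ℝ≥0∞}
    (hH : Measurable (Function.uncurry H)) (t : ℝ) :
    Measurable (fun z : ℝ × EuclideanSpace ℝ (Fin n) => heatL β (t - z.1) (H z.1) z.2) := by
  have h : Measurable (fun w : (ℝ × EuclideanSpace ℝ (Fin n)) × EuclideanSpace ℝ (Fin n) =>
      ENNReal.ofReal (kernel β (t - w.1.1) (w.1.2 - w.2)) * H w.1.1 w.2) := by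
    have h2 : Measurable (fun w : (ℝ × EuclideanSpace ℝ (Fin n)) × EuclideanSpace ℝ (Fin n) =>
      H w.1.1 w.2) := hH.comp (f := fun w : (ℝ × EuclideanSpace ℝ (Fin n)) ×
        EuclideanSpace ℝ (Fin n) => (w.1.1, w.2)) (by fun_prop)
    fun_prop
  exact h.lintegral_prod_right'

namespace SourceBound

variable {κ γ : ℝ} {η : ℝ≥0∞} {H : ℝ → EuclideanSpace ℝ (Fin n) → ℝ≥0∞}

lemma measurable_slice (h : SourceBound β κ γ η H) (s : ℝ) : Measurable (H s) :=
  h.meas.comp measurable_prodMk_left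

/-- The singularity `τ^{-1/2}` is integrable, and the bound vanishes as `t → a`. It serves for short
times, for the initial trace and for continuity in time. -/
lemma lintegral_heatL_le_sqrt (h : SourceBound β κ γ η H) (hκ : 0 ≤ κ) {a t : ℝ} (ha : 0 ≤ a)
    (hat : a ≤ t) (x : EuclideanSpace ℝ (Fin n)) :
    ∫⁻ s in Set.Ioo a t, heatL β (t - s) (H s) x ≤
      η * ENNReal.ofReal ((1 + a) ^ (-κ - 1) * ((t - a) + 2 * (t - a) ^ (1 / 2 : ℝ))) := by
  calc ∫⁻ s in Set.Ioo a t, heatL β (t - s) (H s) x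
      ≤ ∫⁻ s in Set.Ioo a t, (η * ENNReal.ofReal ((1 + a) ^ (-κ - 1))) *
          ENNReal.ofReal (1 + (t - s) ^ (-(1 / 2) : ℝ)) := by
        refine setLIntegral_mono (by fun_prop) fun s hs => ?_
        have hs0 : 0 < s := ha.trans_lt hs.1
        refine (h.heat s (t - s) hs0 (sub_pos.2 hs.2) x).trans ?_
        rw [mul_assoc, ← ENNReal.ofReal_mul (by positivity)]
        have h2 : 0 < t - s := sub_pos.2 hs.2
        have : (1 + s) ^ (-κ - 1) ≤ (1 + a) ^ (-κ - 1) :=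
          Real.rpow_le_rpow_of_nonpos (by linarith) (by linarith [hs.1]) (by linarith)
        gcongr
    _ = (η * ENNReal.ofReal ((1 + a) ^ (-κ - 1))) *
        ∫⁻ s in Set.Ioo a t, ENNReal.ofReal (1 + (t - s) ^ (-(1 / 2) : ℝ)) :=
        lintegral_const_mul _ (by fun_prop)
    _ ≤ (η * ENNReal.ofReal ((1 + a) ^ (-κ - 1))) *
        ENNReal.ofReal ((t - a) + 2 * (t - a) ^ (1 / 2 : ℝ)) := by
        gcongr
        exact lintegral_one_add_inv_sqrt_le hat
    _ = _ := by rw [mul_assoc, ← ENNReal.ofReal_mul (by positivity)]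

lemma lintegral_mass_le (h : SourceBound β κ γ η H) (hγ : 0 < γ) {t : ℝ} (ht : 0 ≤ t) :
    ∫⁻ s in Set.Ioo 0 t, ∫⁻ y, H s y ≤ η * ENNReal.ofReal ((1 + t) ^ γ / γ) := by
  calc ∫⁻ s in Set.Ioo 0 t, ∫⁻ y, H s y
      ≤ ∫⁻ s in Set.Ioo 0 t, η * ENNReal.ofReal ((1 + s) ^ (γ - 1)) :=
        setLIntegral_mono (by fun_prop) fun s hs => h.mass s hs.1
    _ = η * ∫⁻ s in Set.Ioo 0 t, ENNReal.ofReal ((1 + s) ^ (γ - 1)) :=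
        lintegral_const_mul _ (by fun_prop)
    _ ≤ _ := by
        gcongr
        exact lintegral_one_add_rpow_le hγ ht

lemma lintegral_mass_Ioo_le (h : SourceBound β κ γ η H) (hγ1 : γ ≤ 1) {a t : ℝ} (ha : 0 ≤ a) :
    ∫⁻ s in Set.Ioo a t, ∫⁻ y, H s y ≤ η * ENNReal.ofReal (t - a) := by
  calc ∫⁻ s in Set.Ioo a t, ∫⁻ y, H s y
      ≤ ∫⁻ s in Set.Ioo a t, η := by
        refine setLIntegral_mono measurable_const fun s hs => ?_
        have hs0 : 0 < s := ha.trans_lt hs.1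
        refine (h.mass s hs0).trans (mul_le_of_le_one_right' ?_)
        rw [← ENNReal.ofReal_one]
        exact ENNReal.ofReal_le_ofReal (Real.rpow_le_one_of_one_le_of_nonpos (by linarith)
          (by linarith))
    _ = _ := by rw [setLIntegral_const, Real.volume_Ioo]

variable [NeZero n]

lemma lintegral_lintegral_heatL (h : SourceBound β κ γ η H) (hβ : 0 < β) (hβ2 : β < 2)
    {a t b : ℝ} (htb : t ≤ b) :
    ∫⁻ x, ∫⁻ s in Set.Ioo a t, heatL β (b - s) (H s) x = ∫⁻ s in Set.Ioo a t, ∫⁻ y, H s y := by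
  have hm : Measurable (Function.uncurry fun (x : EuclideanSpace ℝ (Fin n)) (s : ℝ) =>
      heatL β (b - s) (H s) x) := by
    have h1 := (measurable_heatL_time (β := β) h.meas b).comp measurable_swap
    exact h1
  rw [lintegral_lintegral_swap hm.aemeasurable]
  exact setLIntegral_congr_fun measurableSet_Ioo fun s hs =>
    lintegral_heatL hβ hβ2 (by linarith [hs.2]) (h.measurable_slice s)

/-- For `t ≥ 1` split at `t/2`. The source before `t/2` has total mass of order `(1+t)^γ`, and
smoothing from `L^1` to `L^∞` gains `t^{-n/β}`; this suffices because `γ + κ ≤ n/β`. After `t/2` the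
source is already of order `(1+t)^{-κ-1}`, and the time integral returns at most a factor `1 + t`.
-/
lemma lintegral_heatL_decay (h : SourceBound β κ γ η H) (hβ : 0 < β) (hκ : 0 ≤ κ)
    (hγ : 0 < γ) (hκγ : γ + κ ≤ n / β) {t : ℝ} (ht : 0 < t) (x : EuclideanSpace ℝ (Fin n)) :
    ∫⁻ s in Set.Ioo 0 t, heatL β (t - s) (H s) x ≤
      η * ENNReal.ofReal ((3 * 2 ^ κ + (kernelMax n β * 4 ^ (n / β : ℝ) / γ + 4 * 2 ^ (κ + 1))) *
        (1 + t) ^ (-κ)) := by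
  have hK := kernelMax_nonneg (n := n) hβ
  rcases le_total t 1 with ht1 | ht1
  · refine (h.lintegral_heatL_le_sqrt hκ le_rfl ht.le x).trans ?_
    gcongr η * ENNReal.ofReal ?_
    rw [add_zero, Real.one_rpow, one_mul, sub_zero]
    have h1 : t ^ (1 / 2 : ℝ) ≤ 1 := Real.rpow_le_one ht.le ht1 (by norm_num)
    have h2 : 1 ≤ 2 ^ κ * (1 + t) ^ (-κ) := by
      rw [Real.rpow_neg (by positivity), ← div_eq_mul_inv, ← Real.div_rpow (by norm_num)
        (by positivity)]
      exact Real.one_le_rpow ((one_le_div (by positivity)).2 (by linarith)) hκ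
    have h3 : 0 ≤ (kernelMax n β * 4 ^ (n / β : ℝ) / γ + 4 * 2 ^ (κ + 1)) * (1 + t) ^ (-κ) := by
      positivity
    nlinarith
  · have hsub : Set.Ioo 0 t ⊆ Set.Ioo 0 (t / 2) ∪ Set.Icc (t / 2) (t / 2) ∪ Set.Ioo (t / 2) t := by
      intro s hs
      rcases lt_trichotomy s (t / 2) with h1 | h1 | h1
      · exact Or.inl (Or.inl ⟨hs.1, h1⟩)
      · exact Or.inl (Or.inr ⟨h1.ge, h1.le⟩)
      · exact Or.inr ⟨h1, hs.2⟩
    have hlate : ∫⁻ s in Set.Ioo (t / 2) t, heatL β (t - s) (H s) x ≤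
        η * ENNReal.ofReal (4 * 2 ^ (κ + 1) * (1 + t) ^ (-κ)) := by
      refine (h.lintegral_heatL_le_sqrt hκ (by positivity) (by linarith) x).trans ?_
      gcongr η * ENNReal.ofReal ?_
      have h1 : (t - t / 2) + 2 * (t - t / 2) ^ (1 / 2 : ℝ) ≤ 4 * (1 + t) := by
        have : (t - t / 2) ^ (1 / 2 : ℝ) ≤ t ^ (1 / 2 : ℝ) :=
          Real.rpow_le_rpow (by linarith) (by linarith) (by norm_num)
        have : t ^ (1 / 2 : ℝ) ≤ t ^ (1 : ℝ) :=
          Real.rpow_le_rpow_of_exponent_le ht1 (by norm_num)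
        rw [Real.rpow_one] at this
        linarith
      have h2 : (1 + t / 2) ^ (-κ - 1) ≤ 2 ^ (κ + 1) * (1 + t) ^ (-κ - 1) := by
        have : (1 + t / 2) ^ (-κ - 1) ≤ ((1 + t) / 2) ^ (-κ - 1) :=
          Real.rpow_le_rpow_of_nonpos (by positivity) (by linarith) (by linarith)
        rw [Real.div_rpow (by positivity) (by norm_num)] at this
        have e : (2 : ℝ) ^ (κ + 1) = ((2 : ℝ) ^ (-κ - 1))⁻¹ := by
          rw [← Real.rpow_neg (by norm_num)]; congr 1; ring
        rw [e, mul_comm, ← div_eq_mul_inv]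
        exact this
      have h3 : 0 ≤ (t - t / 2) + 2 * (t - t / 2) ^ (1 / 2 : ℝ) := by
        have : 0 ≤ t - t / 2 := by linarith
        positivity
      calc _ ≤ (2 ^ (κ + 1) * (1 + t) ^ (-κ - 1)) * (4 * (1 + t)) := by gcongr
        _ = 4 * 2 ^ (κ + 1) * ((1 + t) ^ (-κ - 1) * (1 + t)) := by ring
        _ = 4 * 2 ^ (κ + 1) * (1 + t) ^ (-κ) := by
          rw [← Real.rpow_add_one (by positivity)]; congr 2; ring
    have hearly : ∫⁻ s in Set.Ioo 0 (t / 2), heatL β (t - s) (H s) x ≤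
        η * ENNReal.ofReal (kernelMax n β * 4 ^ (n / β : ℝ) / γ * (1 + t) ^ (-κ)) := by
      have hd : (0 : ℝ) ≤ n / β := by positivity
      calc ∫⁻ s in Set.Ioo 0 (t / 2), heatL β (t - s) (H s) x
          ≤ ∫⁻ s in Set.Ioo 0 (t / 2),
              ENNReal.ofReal (kernelMax n β * (t / 2) ^ (-(n / β : ℝ))) * ∫⁻ y, H s y := by
            refine setLIntegral_mono (h.meas.lintegral_prod_right'.const_mul _) fun s hs => ?_
            refine (heatL_le_lintegral hβ (by linarith [hs.2]) (H s) x).trans ?_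
            gcongr ENNReal.ofReal (_ * ?_) * _
            exact Real.rpow_le_rpow_of_nonpos (by positivity) (by linarith [hs.2]) (by linarith)
        _ = ENNReal.ofReal (kernelMax n β * (t / 2) ^ (-(n / β : ℝ))) *
              ∫⁻ s in Set.Ioo 0 (t / 2), ∫⁻ y, H s y :=
            lintegral_const_mul' _ _ ENNReal.ofReal_ne_top
        _ ≤ ENNReal.ofReal (kernelMax n β * (t / 2) ^ (-(n / β : ℝ))) *
              (η * ENNReal.ofReal ((1 + t / 2) ^ γ / γ)) := by
            gcongr
            exact h.lintegral_mass_le hγ (by positivity)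
        _ = η * ENNReal.ofReal (kernelMax n β * (t / 2) ^ (-(n / β : ℝ)) *
              ((1 + t / 2) ^ γ / γ)) := by
            rw [mul_left_comm, ← ENNReal.ofReal_mul (by positivity)]
        _ ≤ _ := by
            gcongr η * ENNReal.ofReal ?_
            have h1 : (t / 2) ^ (-(n / β : ℝ)) ≤ 4 ^ (n / β : ℝ) * (1 + t) ^ (-(n / β : ℝ)) := by
              have : (t / 2) ^ (-(n / β : ℝ)) ≤ ((1 + t) / 4) ^ (-(n / β : ℝ)) :=
                Real.rpow_le_rpow_of_nonpos (by positivity) (by linarith) (by linarith)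
              rw [Real.div_rpow (x := 1 + t) (by positivity) (by norm_num),
                Real.rpow_neg (by norm_num : (0 : ℝ) ≤ 4), div_inv_eq_mul, mul_comm] at this
              exact this
            have h2 : (1 + t / 2) ^ γ ≤ (1 + t) ^ γ := by
              gcongr
              linarith
            have h3 : (1 + t) ^ (-(n / β : ℝ)) * (1 + t) ^ γ ≤ (1 + t) ^ (-κ) := by
              rw [← Real.rpow_add (by positivity)]
              exact Real.rpow_le_rpow_of_exponent_le (by linarith) (by linarith)
            calc kernelMax n β * (t / 2) ^ (-(n / β : ℝ)) * ((1 + t / 2) ^ γ / γ)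
                ≤ kernelMax n β * (4 ^ (n / β : ℝ) * (1 + t) ^ (-(n / β : ℝ))) *
                  ((1 + t) ^ γ / γ) := by gcongr
              _ = kernelMax n β * 4 ^ (n / β : ℝ) / γ *
                  ((1 + t) ^ (-(n / β : ℝ)) * (1 + t) ^ γ) := by ring
              _ ≤ _ := by gcongr
    calc ∫⁻ s in Set.Ioo 0 t, heatL β (t - s) (H s) x
        ≤ (∫⁻ s in Set.Ioo 0 (t / 2), heatL β (t - s) (H s) x) +
          (∫⁻ s in Set.Icc (t / 2) (t / 2), heatL β (t - s) (H s) x) +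
          ∫⁻ s in Set.Ioo (t / 2) t, heatL β (t - s) (H s) x := by
          refine (lintegral_mono_set hsub).trans ((lintegral_union_le _ _ _).trans ?_)
          gcongr
          exact lintegral_union_le _ _ _
      _ ≤ η * ENNReal.ofReal (kernelMax n β * 4 ^ (n / β : ℝ) / γ * (1 + t) ^ (-κ)) + 0 +
          η * ENNReal.ofReal (4 * 2 ^ (κ + 1) * (1 + t) ^ (-κ)) := by
          gcongr
          simp
      _ ≤ _ := by
          rw [add_zero, ← mul_add, ← ENNReal.ofReal_add (by positivity) (by positivity)]
          gcongr η * ENNReal.ofReal ?_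
          have : 0 ≤ 3 * 2 ^ κ * (1 + t) ^ (-κ) := by positivity
          linarith

end SourceBound

end Duhamel

/-! ### The linear evolution of Orlicz data -/

section LinearPart

variable {n : ℕ} {β p : ℝ}

/-- The embedding of `exp L^p` into `L^r` for finite `r ≥ p`: the pointwise inequality with `θ = 0`.
-/
lemma exists_lintegral_rpow_le_expModular (n : ℕ) (hp : 0 < p) {r : ℝ} (hr : p ≤ r) :
    ∃ c : ℝ, 0 < c ∧ ∀ (u : EuclideanSpace ℝ (Fin n) → ℝ) (k : ℝ), 0 < k →
      ∫⁻ x, ENNReal.ofReal (|u x| ^ r) ≤ ENNReal.ofReal (c * k ^ r) * expModular p u k := by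
  obtain ⟨c, hc, h⟩ := exists_rpow_mul_exp_le_young hp hr
  refine ⟨c, hc, fun u k hk => ?_⟩
  rw [expModular_eq, ← lintegral_const_mul' _ _ ENNReal.ofReal_ne_top]
  refine lintegral_mono fun x => ?_
  rw [← ENNReal.ofReal_mul (by positivity)]
  refine ENNReal.ofReal_le_ofReal ?_
  have h1 := h 0 (|u x| / k) (by norm_num) (by positivity)
  rw [zero_mul, Real.exp_zero, mul_one, Real.div_rpow (abs_nonneg _) hk.le,
    div_le_iff₀ (by positivity)] at h1
  linarith

/-- The properties of the linear evolution of `|u₀|` used in the fixed point argument. -/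
structure LinBound (p κ k B : ℝ) (V : ℝ → EuclideanSpace ℝ (Fin n) → ℝ) : Prop where
  meas : Measurable (Function.uncurry V)
  nonneg : ∀ s : ℝ, 0 < s → ∀ x, 0 ≤ V s x
  modular : ∀ s : ℝ, 0 < s → expModular p (V s) k ≤ 1
  sup : ∀ s : ℝ, 0 < s → ∀ x, V s x ≤ B * k * s ^ (-κ)

namespace LinBound

variable {κ k B : ℝ} {V : ℝ → EuclideanSpace ℝ (Fin n) → ℝ}

lemma late (hV : LinBound p κ k B V) (hκ : 0 ≤ κ) (hk : 0 < k) (hB : 0 ≤ B) {s : ℝ} (hs : 1 ≤ s)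
    (x : EuclideanSpace ℝ (Fin n)) : V s x / k ≤ B * 2 ^ κ * (1 + s) ^ (-κ) := by
  have h1 := hV.sup s (by linarith) x
  rw [div_le_iff₀ hk]
  have h2 : s ^ (-κ) ≤ 2 ^ κ * (1 + s) ^ (-κ) := by
    have : s ^ (-κ) ≤ ((1 + s) / 2) ^ (-κ) :=
      Real.rpow_le_rpow_of_nonpos (by linarith) (by linarith) (by linarith)
    rw [Real.div_rpow (by linarith) (by norm_num), Real.rpow_neg (by norm_num : (0 : ℝ) ≤ 2),
      div_inv_eq_mul, mul_comm] at this
    exact this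
  calc V s x ≤ B * k * s ^ (-κ) := h1
    _ ≤ B * k * (2 ^ κ * (1 + s) ^ (-κ)) := by gcongr
    _ = _ := by ring

end LinBound

lemma measurable_semigroup {u : EuclideanSpace ℝ (Fin n) → ℝ} (hu : Measurable u) :
    Measurable (Function.uncurry fun s => semigroup β s u) := by
  have h : StronglyMeasurable
      (fun w : (ℝ × EuclideanSpace ℝ (Fin n)) × EuclideanSpace ℝ (Fin n) =>
        kernel β w.1.1 (w.1.2 - w.2) * u w.2) :=
    Measurable.stronglyMeasurable (by fun_prop)
  exact h.integral_prod_right'.measurable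

variable [NeZero n]

lemma abs_semigroup_le (hβ : 0 < β) (hβ2 : β < 2) {s : ℝ} (hs : 0 < s)
    (u : EuclideanSpace ℝ (Fin n) → ℝ) (x : EuclideanSpace ℝ (Fin n)) :
    |semigroup β s u x| ≤ semigroup β s (fun y => |u y|) x := by
  refine (norm_integral_le_integral_norm (fun y => kernel β s (x - y) * u y)).trans
    (le_of_eq (integral_congr_ae (Eventually.of_forall fun y => ?_)))
  simp only [norm_mul, Real.norm_eq_abs, abs_of_nonneg (kernel_nonneg hβ hβ2 hs (x - y))]

lemma expModular_semigroup_le (hβ : 0 < β) (hβ2 : β < 2) (hp : 1 ≤ p) {s : ℝ} (hs : 0 < s)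
    {u : EuclideanSpace ℝ (Fin n) → ℝ} (hu : Measurable u) {k : ℝ} (hk : 0 < k) :
    expModular p (semigroup β s u) k ≤ expModular p u k := by
  have h1 : ∫ x : EuclideanSpace ℝ (Fin n), |kernel β s x| = 1 := by
    rw [← integral_kernel (n := n) hβ hβ2 hs]
    exact integral_congr_ae (Eventually.of_forall fun x => abs_of_nonneg
      (kernel_nonneg hβ hβ2 hs x))
  have := expModular_conv_le hp (g := kernel β s) (by fun_prop) (integrable_kernel hβ hβ2 hs)
    one_pos h1.le hu hk
  rwa [one_mul] at this

lemma enorm_semigroup_le (hβ : 0 < β) (hβ2 : β < 2) {s : ℝ} (hs : 0 < s)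
    (u : EuclideanSpace ℝ (Fin n) → ℝ) (x : EuclideanSpace ℝ (Fin n)) :
    ‖semigroup β s u x‖ₑ ≤ heatL β s (fun y => ‖u y‖ₑ) x := by
  refine (enorm_integral_le_lintegral_enorm _).trans (lintegral_mono fun y => ?_)
  rw [enorm_mul, Real.enorm_of_nonneg (kernel_nonneg hβ hβ2 hs (x - y))]

/-- The exponent `r = n(m-1)/β` is the one for which smoothing from `L^r` to `L^∞` costs exactly
`s^{-n/(βr)} = s^{-κ}`, and `exp L^p` embeds in `L^r` because `p ≤ r`. -/
lemma exists_semigroup_sup_bound (n : ℕ) [NeZero n] (hβ : 0 < β) (hβ2 : β < 2) (hp : 1 < p)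
    {m κ : ℝ} (hκ : κ * (m - 1) = 1) (hpm : p ≤ n / β * (m - 1)) :
    ∃ B : ℝ, 0 < B ∧ ∀ (u : EuclideanSpace ℝ (Fin n) → ℝ) (k : ℝ), Measurable u → 0 < k →
      expModular p u k ≤ 1 → ∀ s : ℝ, 0 < s → ∀ x, |semigroup β s u x| ≤ B * k * s ^ (-κ) := by
  set r := n / β * (m - 1) with hrd
  have hr1 : 1 < r := hp.trans_le hpm
  have hr0 : 0 < r := by linarith
  obtain ⟨c, hc, h⟩ := exists_lintegral_rpow_le_expModular n (by linarith : 0 < p) hpm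
  have hK := kernelMax_nonneg (n := n) hβ
  -- The added one makes the constant positive, as `kernelMax` is only known to be nonnegative.
  refine ⟨(kernelMax n β * c) ^ (1 / r) + 1, by positivity, fun u k hu hk hmod s hs x => ?_⟩
  have h1 : ‖semigroup β s u x‖ₑ ≤
      ENNReal.ofReal ((kernelMax n β * c) ^ (1 / r) * k * s ^ (-κ)) := by
    calc ‖semigroup β s u x‖ₑ ≤ heatL β s (fun y => ‖u y‖ₑ) x := enorm_semigroup_le hβ hβ2 hs u x
      _ ≤ (heatL β s (fun y => ‖u y‖ₑ ^ r) x) ^ (1 / r) :=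
        heatL_le_rpow hβ hβ2 hs hr1 (by fun_prop) x
      _ ≤ (ENNReal.ofReal (kernelMax n β * s ^ (-(n / β))) * ∫⁻ y, ‖u y‖ₑ ^ r) ^ (1 / r) := by
        gcongr
        exact heatL_le_lintegral hβ hs _ x
      _ ≤ (ENNReal.ofReal (kernelMax n β * s ^ (-(n / β))) *
          ENNReal.ofReal (c * k ^ r)) ^ (1 / r) := by
        gcongr
        have h2 := (h u k hk).trans (mul_le_of_le_one_right' hmod)
        refine le_trans (lintegral_mono fun y => ?_) h2
        rw [Real.enorm_eq_ofReal_abs, ENNReal.ofReal_rpow_of_nonneg (abs_nonneg _) hr0.le]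
      _ = ENNReal.ofReal ((kernelMax n β * c) ^ (1 / r) * k * s ^ (-κ)) := by
        rw [← ENNReal.ofReal_mul (by positivity),
          ENNReal.ofReal_rpow_of_nonneg (by positivity) (by positivity)]
        congr 1
        have e1 : kernelMax n β * s ^ (-(n / β)) * (c * k ^ r) =
            (kernelMax n β * c) * (k ^ r * s ^ (-(n / β))) := by ring
        rw [e1, Real.mul_rpow (by positivity) (by positivity),
          Real.mul_rpow (x := k ^ r) (by positivity) (by positivity), ← Real.rpow_mul hk.le,
          ← Real.rpow_mul hs.le, mul_one_div_cancel hr0.ne', Real.rpow_one, ← mul_assoc]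
        congr 2
        have hm : m - 1 ≠ 0 := by rintro h0; rw [h0] at hκ; simp at hκ
        have hd : (n / β : ℝ) ≠ 0 := by rintro h0; rw [hrd, h0] at hr0; simp at hr0
        have hn0 : (n : ℝ) ≠ 0 := by exact_mod_cast NeZero.ne n
        have : κ = 1 / (m - 1) := by field_simp; linarith
        rw [hrd, this]
        field_simp
  rw [Real.enorm_eq_ofReal_abs, ENNReal.ofReal_le_ofReal_iff (by positivity)] at h1
  refine h1.trans ?_
  have : 0 ≤ k * s ^ (-κ) := by positivity
  nlinarith

lemma linBound_semigroup (hβ : 0 < β) (hβ2 : β < 2) (hp : 1 ≤ p) {κ k B : ℝ}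
    {u : EuclideanSpace ℝ (Fin n) → ℝ} (hu : Measurable u) (hk : 0 < k)
    (hmod : expModular p u k ≤ 1)
    (hB : ∀ s : ℝ, 0 < s → ∀ x, |semigroup β s (fun y => |u y|) x| ≤ B * k * s ^ (-κ)) :
    LinBound p κ k B (fun s => semigroup β s (fun y => |u y|)) where
  meas := measurable_semigroup (by fun_prop)
  nonneg s hs x := (abs_nonneg _).trans (abs_semigroup_le hβ hβ2 hs u x)
  modular s hs := by
    refine (expModular_semigroup_le hβ hβ2 hp hs (by fun_prop) hk).trans ?_
    simpa [expModular] using hmod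
  sup s hs x := (le_abs_self _).trans (hB s hs x)

end LinearPart

/-! ### Source bounds for the nonlinearity -/

section Sources

variable {n : ℕ} [NeZero n] {β p m κ γ : ℝ}

/-- The exponent `R = 2n/β` is chosen so that smoothing from `L^R` to `L^∞` costs `τ^{-n/(βR)} =
τ^{-1/2}`; Jensen is available because `n ≥ 1` and `β < 2` give `R > 1`. The modular bound is what
places the power `1/R` of the Young function in `L^R`. -/
lemma heatL_young_rpow_le (hβ : 0 < β) (hβ2 : β < 2) {v : EuclideanSpace ℝ (Fin n) → ℝ}
    (hv : Measurable v) (hv0 : ∀ y, 0 ≤ v y) {k : ℝ} (hk : 0 < k) (hmod : expModular p v k ≤ 1)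
    {A : ℝ} (hA : 0 ≤ A) {H : EuclideanSpace ℝ (Fin n) → ℝ≥0∞}
    (hH : ∀ y, H y ≤ ENNReal.ofReal (A * (1 + young p (v y / k) ^ (1 / (2 * (n / β) : ℝ)))))
    {τ : ℝ} (hτ : 0 < τ) (x : EuclideanSpace ℝ (Fin n)) :
    heatL β τ H x ≤ ENNReal.ofReal (A * (1 + kernelMax n β ^ (1 / (2 * (n / β) : ℝ))) *
      (1 + τ ^ (-(1 / 2) : ℝ))) := by
  have hK := kernelMax_nonneg (n := n) hβ
  have hn : (1 : ℝ) ≤ n := by exact_mod_cast (NeZero.one_le : 1 ≤ n)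
  set R : ℝ := 2 * (n / β) with hR
  have hR1 : 1 < R := by
    have : 1 / 2 < n / β := by rw [div_lt_div_iff₀ (by norm_num) hβ]; linarith
    linarith
  have hR0 : 0 < R := by linarith
  have hq0 : ∀ y, 0 ≤ young p (v y / k) := fun y => young_nonneg (div_nonneg (hv0 y) hk.le)
  have h1 : heatL β τ (fun y => ENNReal.ofReal (young p (v y / k) ^ (1 / R))) x ≤
      ENNReal.ofReal (kernelMax n β ^ (1 / R) * τ ^ (-(1 / 2) : ℝ)) := by
    calc heatL β τ (fun y => ENNReal.ofReal (young p (v y / k) ^ (1 / R))) x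
        ≤ (heatL β τ (fun y => ENNReal.ofReal (young p (v y / k) ^ (1 / R)) ^ R) x) ^ (1 / R) :=
          heatL_le_rpow hβ hβ2 hτ hR1 (by fun_prop) x
      _ = (heatL β τ (fun y => ENNReal.ofReal (young p (v y / k))) x) ^ (1 / R) := by
          congr 2
          funext y
          rw [ENNReal.ofReal_rpow_of_nonneg (Real.rpow_nonneg (hq0 y) _) hR0.le,
            ← Real.rpow_mul (hq0 y), one_div_mul_cancel hR0.ne', Real.rpow_one]
      _ ≤ (ENNReal.ofReal (kernelMax n β * τ ^ (-(n / β))) * 1) ^ (1 / R) := by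
          gcongr
          refine (heatL_le_lintegral hβ hτ _ x).trans ?_
          gcongr
          refine le_trans (le_of_eq ?_) hmod
          rw [expModular_eq]
          exact lintegral_congr fun y => by rw [abs_of_nonneg (hv0 y)]
      _ = ENNReal.ofReal (kernelMax n β ^ (1 / R) * τ ^ (-(1 / 2) : ℝ)) := by
          rw [mul_one, ENNReal.ofReal_rpow_of_nonneg (by positivity) (by positivity),
            Real.mul_rpow hK (by positivity), ← Real.rpow_mul hτ.le]
          congr 3
          rw [hR]
          field_simp
  calc heatL β τ H x
      ≤ heatL β τ (fun y => ENNReal.ofReal A *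
          (1 + ENNReal.ofReal (young p (v y / k) ^ (1 / R)))) x := by
        refine heatL_mono (fun y => (hH y).trans (le_of_eq ?_)) x
        rw [ENNReal.ofReal_mul hA, ENNReal.ofReal_add zero_le_one (Real.rpow_nonneg (hq0 y) _),
          ENNReal.ofReal_one]
    _ = ENNReal.ofReal A * (heatL β τ (fun _ => 1) x +
          heatL β τ (fun y => ENNReal.ofReal (young p (v y / k) ^ (1 / R))) x) := by
        rw [heatL_const_mul ENNReal.ofReal_ne_top, heatL_add measurable_const]
    _ ≤ ENNReal.ofReal A *
          (1 + ENNReal.ofReal (kernelMax n β ^ (1 / R) * τ ^ (-(1 / 2) : ℝ))) := by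
        gcongr
        exact heatL_le_const hβ hβ2 hτ (fun _ => le_rfl) x
    _ = ENNReal.ofReal (A * (1 + kernelMax n β ^ (1 / R) * τ ^ (-(1 / 2) : ℝ))) := by
        rw [ENNReal.ofReal_mul hA, ENNReal.ofReal_add zero_le_one (by positivity),
          ENNReal.ofReal_one]
    _ ≤ _ := by
        refine ENNReal.ofReal_le_ofReal ?_
        rw [mul_assoc]
        refine mul_le_mul_of_nonneg_left ?_ hA
        have a1 : 0 ≤ kernelMax n β ^ (1 / R) := by positivity
        have a2 : 0 ≤ τ ^ (-(1 / 2) : ℝ) := by positivity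
        nlinarith

/-- For `s ≤ 1` the weights are comparable to one, so early and late estimates can share one form.
-/
lemma two_rpow_mul_le {q s : ℝ} (hq : q ≤ 0) (hs : 0 < s) (hs1 : s ≤ 1) :
    1 ≤ 2 ^ (-q) * (1 + s) ^ q := by
  have h : (2 : ℝ) ^ q ≤ (1 + s) ^ q :=
    Real.rpow_le_rpow_of_nonpos (by linarith) (by linarith) hq
  calc (1 : ℝ) = 2 ^ (-q) * 2 ^ q := by rw [← Real.rpow_add (by norm_num)]; simp
    _ ≤ _ := by gcongr

/-- This controls `f(U)`. In the variable `V/k` the exponential has the small coefficient `θ =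
λk^p`. For `s ≤ 1` the mass is bounded by the Young function and the smoothed source by its power
`1/R`. For `s ≥ 1` the bound `V/k ≤ B'(1+s)^{-κ}` takes over: `m - p` of the powers give the mass
weight, as `κ(m-p) = 1 - γ`, and all `m` powers give the uniform weight, as `κm = κ + 1`. -/
lemma exists_sourceBound_free (hβ : 0 < β) (hβ2 : β < 2) (hp : 1 < p) (hpm : p ≤ m)
    (hκ : κ * (m - 1) = 1) (hγ : γ = κ * (p - 1)) {lam B : ℝ} (hlam : 0 < lam) (hB : 0 < B) :
    ∃ c : ℝ, 0 < c ∧ ∀ k : ℝ, 0 < k → lam * k ^ p * 2 ^ p ≤ 1 / (2 * (2 * (n / β))) →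
      ∀ V : ℝ → EuclideanSpace ℝ (Fin n) → ℝ, LinBound p κ k B V →
        SourceBound β κ γ (ENNReal.ofReal (c * k ^ m))
          (fun s y => ENNReal.ofReal (V s y ^ m * Real.exp (lam * V s y ^ p))) := by
  have hn : (1 : ℝ) ≤ n := by exact_mod_cast (NeZero.one_le : 1 ≤ n)
  set R : ℝ := 2 * (n / β) with hR
  have hR1 : 1 < R := by
    have : 1 / 2 < n / β := by rw [div_lt_div_iff₀ (by norm_num) hβ]; linarith
    linarith
  have hm1 : 0 < m - 1 := by linarith
  have hm0 : 0 ≤ m := by linarith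
  have hκ0 : 0 < κ := by
    by_contra h
    have := mul_nonpos_of_nonpos_of_nonneg (not_lt.1 h) hm1.le
    linarith
  obtain ⟨c1, hc1, h1⟩ := exists_rpow_mul_exp_le_young (p := p) (by linarith) hpm
  obtain ⟨c2, hc2, h2⟩ := exists_rpow_mul_exp_le_young (p := p) (by linarith) (le_refl p)
  obtain ⟨c3, hc3, h3⟩ := exists_shift_rpow_mul_exp_le (p := p) (R := R) (a := m) (by linarith)
    (by linarith) (by linarith)
  have hK := kernelMax_nonneg (n := n) hβ
  set B' := B * 2 ^ κ with hB'
  set d1 := c1 * 2 ^ (-(γ - 1)) with hd1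
  set d2 := B' ^ (m - p) * c2 with hd2
  set d3 := c3 * (1 + kernelMax n β ^ (1 / R)) * 2 ^ (-(-κ - 1)) with hd3
  set d4 := B' ^ m * Real.exp (1 / 2 * B' ^ p) with hd4
  have hd1p : 0 < d1 := by positivity
  have hd2p : 0 < d2 := by positivity
  have hd3p : 0 < d3 := by positivity
  have hd4p : 0 < d4 := by positivity
  refine ⟨d1 + d2 + d3 + d4, by positivity, fun k hk hsmall V hV => ?_⟩
  set θ := lam * k ^ p with hθ
  have hθ0 : 0 ≤ θ := by positivity
  have hθ2 : θ ≤ 1 / 2 := by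
    have e1 : (1 : ℝ) ≤ 2 ^ p := Real.one_le_rpow (by norm_num) (by linarith)
    have e2 : 1 / (2 * R) ≤ 1 / 2 := one_div_le_one_div_of_le (by norm_num) (by linarith)
    nlinarith
  have hform : ∀ s, 0 < s → ∀ y, V s y ^ m * Real.exp (lam * V s y ^ p) =
      k ^ m * ((V s y / k) ^ m * Real.exp (θ * (V s y / k) ^ p)) := by
    intro s hs y
    have hv := hV.nonneg s hs y
    rw [Real.div_rpow hv hk.le, Real.div_rpow hv hk.le, hθ]
    have e1 : k ^ m ≠ 0 := (Real.rpow_pos_of_pos hk _).ne'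
    have e2 : k ^ p ≠ 0 := (Real.rpow_pos_of_pos hk _).ne'
    field_simp
  have hy0 : ∀ s, 0 < s → ∀ y, 0 ≤ V s y / k := fun s hs y => div_nonneg (hV.nonneg s hs y) hk.le
  have hslice : ∀ s, Measurable (V s) := fun s => hV.meas.comp measurable_prodMk_left
  have hmodint : ∀ s, 0 < s → ∫⁻ y, ENNReal.ofReal (young p (V s y / k)) ≤ 1 := by
    intro s hs
    refine le_trans (le_of_eq ?_) (hV.modular s hs)
    rw [expModular_eq]
    exact lintegral_congr fun y => by rw [abs_of_nonneg (hV.nonneg s hs y)]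
  have hmass : ∀ (s A : ℝ), 0 < s → 0 ≤ A →
      (∀ y, V s y ^ m * Real.exp (lam * V s y ^ p) ≤ A * young p (V s y / k)) →
      ∫⁻ y, ENNReal.ofReal (V s y ^ m * Real.exp (lam * V s y ^ p)) ≤ ENNReal.ofReal A := by
    intro s A hs hA h
    calc ∫⁻ y, ENNReal.ofReal (V s y ^ m * Real.exp (lam * V s y ^ p))
        ≤ ∫⁻ y, ENNReal.ofReal A * ENNReal.ofReal (young p (V s y / k)) :=
          lintegral_mono fun y => by
            rw [← ENNReal.ofReal_mul hA]
            exact ENNReal.ofReal_le_ofReal (h y)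
      _ = ENNReal.ofReal A * ∫⁻ y, ENNReal.ofReal (young p (V s y / k)) :=
          lintegral_const_mul' _ _ ENNReal.ofReal_ne_top
      _ ≤ ENNReal.ofReal A := mul_le_of_le_one_right' (hmodint s hs)
  -- There is one constant per norm and per time regime; their sum serves all four estimates.
  have hcp : ∀ q : ℝ, 0 ≤ q → ∀ d ∈ ({d1, d2, d3, d4} : Set ℝ),
      k ^ m * (d * q) ≤ (d1 + d2 + d3 + d4) * k ^ m * q := by
    intro q hq d hd
    have hkm : 0 ≤ k ^ m * q := by positivity
    have hdle : d ≤ d1 + d2 + d3 + d4 := by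
      rcases hd with rfl | rfl | rfl | rfl <;> linarith
    nlinarith
  constructor
  · have := hV.meas
    change Measurable (fun z : ℝ × EuclideanSpace ℝ (Fin n) =>
      ENNReal.ofReal (V z.1 z.2 ^ m * Real.exp (lam * V z.1 z.2 ^ p)))
    have h4 : Measurable (fun z : ℝ × EuclideanSpace ℝ (Fin n) => V z.1 z.2) := hV.meas
    fun_prop
  · intro s hs
    rw [← ENNReal.ofReal_mul (by positivity)]
    rcases le_total s 1 with hs1 | hs1
    · refine (hmass s (k ^ m * c1) hs (by positivity) fun y => ?_).trans
        (ENNReal.ofReal_le_ofReal ?_)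
      · rw [hform s hs, mul_assoc (k ^ m)]
        exact mul_le_mul_of_nonneg_left (h1 θ _ hθ2 (hy0 s hs y)) (by positivity)
      · refine le_trans ?_ (hcp _ (by positivity) d1 (by simp))
        have h5 : γ - 1 ≤ 0 := by rw [hγ]; nlinarith
        have := two_rpow_mul_le h5 hs hs1
        rw [hd1, mul_assoc]
        refine mul_le_mul_of_nonneg_left (le_mul_of_one_le_right hc1.le this) (by positivity)
    · refine (hmass s (k ^ m * (d2 * (1 + s) ^ (γ - 1))) hs (by positivity) fun y => ?_).trans
        (ENNReal.ofReal_le_ofReal (hcp _ (by positivity) d2 (by simp)))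
      rw [hform s hs, mul_assoc (k ^ m)]
      refine mul_le_mul_of_nonneg_left ?_ (by positivity)
      have hy := hy0 s hs y
      have hl := hV.late hκ0.le hk hB.le hs1 y
      have e1 : (V s y / k) ^ m = (V s y / k) ^ (m - p) * (V s y / k) ^ p := by
        rw [← Real.rpow_add' hy (by linarith)]; congr 1; ring
      have e2 : (V s y / k) ^ (m - p) ≤ B' ^ (m - p) * (1 + s) ^ (γ - 1) := by
        calc (V s y / k) ^ (m - p) ≤ (B' * (1 + s) ^ (-κ)) ^ (m - p) :=
              Real.rpow_le_rpow hy hl (by linarith)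
          _ = B' ^ (m - p) * (1 + s) ^ (γ - 1) := by
              rw [Real.mul_rpow (by positivity) (by positivity), ← Real.rpow_mul (by positivity)]
              congr 2
              rw [hγ]; linear_combination -hκ
      calc (V s y / k) ^ m * Real.exp (θ * (V s y / k) ^ p)
          = (V s y / k) ^ (m - p) * ((V s y / k) ^ p * Real.exp (θ * (V s y / k) ^ p)) := by
            rw [e1]; ring
        _ ≤ (B' ^ (m - p) * (1 + s) ^ (γ - 1)) * (c2 * young p (V s y / k)) := by
            exact mul_le_mul e2 (h2 θ _ hθ2 hy) (by positivity) (by positivity)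
        _ = d2 * (1 + s) ^ (γ - 1) * young p (V s y / k) := by rw [hd2]; ring
  · intro s τ hs hτ x
    rw [← ENNReal.ofReal_mul (by positivity)]
    rcases le_total s 1 with hs1 | hs1
    · refine (heatL_young_rpow_le (p := p) hβ hβ2 (hslice s) (hV.nonneg s hs) hk (hV.modular s hs)
        (A := k ^ m * c3) (by positivity) (fun y => ENNReal.ofReal_le_ofReal ?_) hτ x).trans
        (ENNReal.ofReal_le_ofReal ?_)
      · rw [hform s hs, mul_assoc (k ^ m)]
        refine mul_le_mul_of_nonneg_left (le_trans ?_ (h3 θ _ hθ0 hsmall (hy0 s hs y)))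
          (by positivity)
        have hy := hy0 s hs y
        have : V s y / k ≤ 1 + V s y / k := by linarith
        gcongr
      · refine le_trans ?_ (hcp _ (by positivity) d3 (by simp))
        have h5 : -κ - 1 ≤ 0 := by linarith
        have := two_rpow_mul_le h5 hs hs1
        rw [hd3]
        calc k ^ m * c3 * (1 + kernelMax n β ^ (1 / R)) * (1 + τ ^ (-(1 / 2) : ℝ))
            = k ^ m * (c3 * (1 + kernelMax n β ^ (1 / R)) * (1 + τ ^ (-(1 / 2) : ℝ))) * 1 := by
              ring
          _ ≤ k ^ m * (c3 * (1 + kernelMax n β ^ (1 / R)) * (1 + τ ^ (-(1 / 2) : ℝ))) *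
              (2 ^ (-(-κ - 1)) * (1 + s) ^ (-κ - 1)) := by gcongr
          _ = _ := by ring
    · refine (heatL_le_const hβ hβ2 hτ (M := ENNReal.ofReal (k ^ m * (d4 * (1 + s) ^ (-κ - 1))))
        (fun y => ENNReal.ofReal_le_ofReal ?_) x).trans (ENNReal.ofReal_le_ofReal ?_)
      · rw [hform s hs]
        refine mul_le_mul_of_nonneg_left ?_ (by positivity)
        have hy := hy0 s hs y
        have hl := hV.late hκ0.le hk hB.le hs1 y
        have hb1 : (1 + s) ^ (-κ) ≤ 1 :=
          Real.rpow_le_one_of_one_le_of_nonpos (by linarith) (by linarith)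
        have hl2 : V s y / k ≤ B' := hl.trans (mul_le_of_le_one_right (by positivity) hb1)
        calc (V s y / k) ^ m * Real.exp (θ * (V s y / k) ^ p)
            ≤ (B' * (1 + s) ^ (-κ)) ^ m * Real.exp (1 / 2 * B' ^ p) := by gcongr
          _ = d4 * (1 + s) ^ (-κ - 1) := by
            rw [Real.mul_rpow (by positivity) (by positivity), ← Real.rpow_mul (by positivity),
              show -κ * m = -κ - 1 by linear_combination -hκ, hd4]
            ring
      · refine le_trans (hcp _ (by positivity) d4 (by simp)) ?_
        have : 0 ≤ τ ^ (-(1 / 2) : ℝ) := by positivity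
        refine mul_le_mul_of_nonneg_left ?_ (by positivity)
        exact le_mul_of_one_le_right (by positivity) (by linarith)

/-- This controls differences: `h` stands for `|w - w'|` and its factor for the Lipschitz constant
of `f` at height `V + k(1+s)^{-κ}`. For `s ≥ 1` that factor is of order `(1+s)^{-1}`, because
`κ(m-1) = 1`, so both weights of `h` drop by one power. For `s ≤ 1` it may be unbounded: its
constant part is paired with `h` in `L^1`, its Young part with `h` in `L^∞`. -/
lemma exists_sourceBound_mul (hβ : 0 < β) (hβ2 : β < 2) (hp : 1 < p) (hpm : p ≤ m)
    (hκ : κ * (m - 1) = 1) (hγ : γ = κ * (p - 1)) {lam B : ℝ} (hlam : 0 < lam) (hB : 0 < B) :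
    ∃ c : ℝ, 0 < c ∧ ∀ k : ℝ, 0 < k → lam * k ^ p * 2 ^ p ≤ 1 / (2 * (2 * (n / β))) →
      ∀ V : ℝ → EuclideanSpace ℝ (Fin n) → ℝ, LinBound p κ k B V → ∀ δ : ℝ, 0 ≤ δ →
      ∀ h : ℝ → EuclideanSpace ℝ (Fin n) → ℝ≥0∞, Measurable (Function.uncurry h) →
        (∀ s, 0 < s → ∀ y, h s y ≤ ENNReal.ofReal (δ * (1 + s) ^ (-κ))) →
        (∀ s, 0 < s → ∫⁻ y, h s y ≤ ENNReal.ofReal (δ * (1 + s) ^ γ)) →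
        SourceBound β κ γ (ENNReal.ofReal (c * k ^ (m - 1) * δ))
          (fun s y => h s y * ENNReal.ofReal ((V s y + k * (1 + s) ^ (-κ)) ^ (m - 1) *
            Real.exp (lam * (V s y + k * (1 + s) ^ (-κ)) ^ p))) := by
  have hn : (1 : ℝ) ≤ n := by exact_mod_cast (NeZero.one_le : 1 ≤ n)
  set R : ℝ := 2 * (n / β) with hR
  have hR1 : 1 < R := by
    have : 1 / 2 < n / β := by rw [div_lt_div_iff₀ (by norm_num) hβ]; linarith
    linarith
  have hm1 : 0 < m - 1 := by linarith
  have hκ0 : 0 < κ := by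
    by_contra h
    have := mul_nonpos_of_nonpos_of_nonneg (not_lt.1 h) hm1.le
    linarith
  have hγ0 : 0 ≤ γ := by rw [hγ]; exact mul_nonneg hκ0.le (by linarith)
  have hγ1 : γ - 1 ≤ 0 := by rw [hγ]; nlinarith
  obtain ⟨c3, hc3, h3⟩ := exists_shift_rpow_mul_exp_le (p := p) (R := R) (a := m - 1)
    (by linarith) (by linarith) hm1.le
  have hK := kernelMax_nonneg (n := n) hβ
  set B' := B * 2 ^ κ with hB'
  set d1 := c3 * (2 * 2 ^ γ + 1) * 2 ^ (-(γ - 1)) with hd1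
  set d2 := (1 + B') ^ (m - 1) * Real.exp (1 / 2 * (1 + B') ^ p) with hd2
  set d3 := c3 * (1 + kernelMax n β ^ (1 / R)) * 2 ^ (-(-κ - 1)) with hd3
  have hd1p : 0 < d1 := by positivity
  have hd2p : 0 < d2 := by positivity
  have hd3p : 0 < d3 := by positivity
  refine ⟨d1 + d2 + d3, by positivity, fun k hk hsmall V hV δ hδ h hmeas hsup hint => ?_⟩
  set θ := lam * k ^ p with hθ
  have hθ0 : 0 ≤ θ := by positivity
  have hθ2 : θ ≤ 1 / 2 := by
    have e1 : (1 : ℝ) ≤ 2 ^ p := Real.one_le_rpow (by norm_num) (by linarith)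
    have e2 : 1 / (2 * R) ≤ 1 / 2 := one_div_le_one_div_of_le (by norm_num) (by linarith)
    nlinarith
  have hy0 : ∀ s, 0 < s → ∀ y, 0 ≤ V s y / k := fun s hs y => div_nonneg (hV.nonneg s hs y) hk.le
  have hslice : ∀ s, Measurable (V s) := fun s => hV.meas.comp measurable_prodMk_left
  have hhslice : ∀ s, Measurable (h s) := fun s => hmeas.comp measurable_prodMk_left
  have hmodint : ∀ s, 0 < s → ∫⁻ y, ENNReal.ofReal (young p (V s y / k)) ≤ 1 := by
    intro s hs
    refine le_trans (le_of_eq ?_) (hV.modular s hs)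
    rw [expModular_eq]
    exact lintegral_congr fun y => by rw [abs_of_nonneg (hV.nonneg s hs y)]
  have hb1 : ∀ s : ℝ, 0 < s → (1 + s) ^ (-κ) ≤ 1 := fun s hs =>
    Real.rpow_le_one_of_one_le_of_nonpos (by linarith) (by linarith)
  have hform : ∀ s, 0 < s → ∀ y, (V s y + k * (1 + s) ^ (-κ)) ^ (m - 1) *
      Real.exp (lam * (V s y + k * (1 + s) ^ (-κ)) ^ p) =
      k ^ (m - 1) * ((V s y / k + (1 + s) ^ (-κ)) ^ (m - 1) *
        Real.exp (θ * (V s y / k + (1 + s) ^ (-κ)) ^ p)) := by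
    intro s hs y
    have e0 : V s y + k * (1 + s) ^ (-κ) = k * (V s y / k + (1 + s) ^ (-κ)) := by field_simp
    have hnn : 0 ≤ V s y / k + (1 + s) ^ (-κ) := add_nonneg (hy0 s hs y) (by positivity)
    rw [e0, Real.mul_rpow hk.le hnn, Real.mul_rpow hk.le hnn, hθ]
    ring_nf
  have hearly : ∀ s, 0 < s → ∀ y, (V s y + k * (1 + s) ^ (-κ)) ^ (m - 1) *
      Real.exp (lam * (V s y + k * (1 + s) ^ (-κ)) ^ p) ≤
      k ^ (m - 1) * c3 * (1 + young p (V s y / k) ^ (1 / R)) := by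
    intro s hs y
    rw [hform s hs, mul_assoc (k ^ (m - 1))]
    refine mul_le_mul_of_nonneg_left (le_trans ?_ (h3 θ _ hθ0 hsmall (hy0 s hs y))) (by positivity)
    have hy := hy0 s hs y
    have := hb1 s hs
    have e : V s y / k + (1 + s) ^ (-κ) ≤ 1 + V s y / k := by linarith
    have hs0 : 0 ≤ (1 + s) ^ (-κ) := by positivity
    gcongr
  have hlate : ∀ s, 1 ≤ s → ∀ y, (V s y + k * (1 + s) ^ (-κ)) ^ (m - 1) *
      Real.exp (lam * (V s y + k * (1 + s) ^ (-κ)) ^ p) ≤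
      k ^ (m - 1) * d2 * (1 + s) ^ (-1 : ℝ) := by
    intro s hs1 y
    have hs : 0 < s := by linarith
    rw [hform s hs, mul_assoc (k ^ (m - 1))]
    refine mul_le_mul_of_nonneg_left ?_ (by positivity)
    have hy := hy0 s hs y
    have hs0 : 0 ≤ (1 + s) ^ (-κ) := by positivity
    have hl := hV.late hκ0.le hk hB.le hs1 y
    have e1 : V s y / k + (1 + s) ^ (-κ) ≤ (1 + B') * (1 + s) ^ (-κ) := by linarith
    have e2 : V s y / k + (1 + s) ^ (-κ) ≤ 1 + B' :=
      e1.trans (mul_le_of_le_one_right (by positivity) (hb1 s hs))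
    calc (V s y / k + (1 + s) ^ (-κ)) ^ (m - 1) *
        Real.exp (θ * (V s y / k + (1 + s) ^ (-κ)) ^ p)
        ≤ ((1 + B') * (1 + s) ^ (-κ)) ^ (m - 1) * Real.exp (1 / 2 * (1 + B') ^ p) := by gcongr
      _ = d2 * (1 + s) ^ (-1 : ℝ) := by
        rw [Real.mul_rpow (by positivity) (by positivity), ← Real.rpow_mul (by positivity),
          show -κ * (m - 1) = -1 by linear_combination -hκ, hd2]
        ring
  have hcp : ∀ q : ℝ, 0 ≤ q → ∀ d ∈ ({d1, d2, d3} : Set ℝ),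
      k ^ (m - 1) * δ * (d * q) ≤ (d1 + d2 + d3) * k ^ (m - 1) * δ * q := by
    intro q hq d hd
    have hkm : 0 ≤ k ^ (m - 1) * δ * q := by positivity
    have hdle : d ≤ d1 + d2 + d3 := by
      rcases hd with rfl | rfl | rfl <;> linarith
    nlinarith
  constructor
  · change Measurable (fun z : ℝ × EuclideanSpace ℝ (Fin n) => h z.1 z.2 *
      ENNReal.ofReal ((V z.1 z.2 + k * (1 + z.1) ^ (-κ)) ^ (m - 1) *
            Real.exp (lam * (V z.1 z.2 + k * (1 + z.1) ^ (-κ)) ^ p)))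
    have h4 : Measurable (fun z : ℝ × EuclideanSpace ℝ (Fin n) => V z.1 z.2) := hV.meas
    have h5 : Measurable (fun z : ℝ × EuclideanSpace ℝ (Fin n) => h z.1 z.2) := hmeas
    fun_prop
  · intro s hs
    rw [← ENNReal.ofReal_mul (by positivity)]
    rcases le_total s 1 with hs1 | hs1
    · have hpt : ∀ y, h s y * ENNReal.ofReal ((V s y + k * (1 + s) ^ (-κ)) ^ (m - 1) *
            Real.exp (lam * (V s y + k * (1 + s) ^ (-κ)) ^ p)) ≤
          ENNReal.ofReal (k ^ (m - 1) * c3) *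
            (2 * h s y + ENNReal.ofReal δ * ENNReal.ofReal (young p (V s y / k))) := by
        intro y
        have hq := young_nonneg (p := p) (hy0 s hs y)
        have hle : young p (V s y / k) ^ (1 / R) ≤ 1 + young p (V s y / k) := by
          rcases le_total (young p (V s y / k)) 1 with hle | hle
          · have := Real.rpow_le_one hq hle (show 0 ≤ 1 / R by positivity)
            linarith
          · have := Real.rpow_le_rpow_of_exponent_le hle
              (show 1 / R ≤ 1 from (div_le_one (by positivity)).2 hR1.le)
            rw [Real.rpow_one] at this
            linarith
        have hhδ : h s y ≤ ENNReal.ofReal δ :=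
          (hsup s hs y).trans (ENNReal.ofReal_le_ofReal (mul_le_of_le_one_right hδ (hb1 s hs)))
        calc h s y * ENNReal.ofReal ((V s y + k * (1 + s) ^ (-κ)) ^ (m - 1) *
              Real.exp (lam * (V s y + k * (1 + s) ^ (-κ)) ^ p))
            ≤ h s y * ENNReal.ofReal (k ^ (m - 1) * c3 * (2 + young p (V s y / k))) := by
              refine mul_le_mul' le_rfl (ENNReal.ofReal_le_ofReal ((hearly s hs y).trans ?_))
              gcongr k ^ (m - 1) * c3 * ?_
              linarith
          _ = ENNReal.ofReal (k ^ (m - 1) * c3) *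
              (2 * h s y + h s y * ENNReal.ofReal (young p (V s y / k))) := by
              rw [ENNReal.ofReal_mul (by positivity), ENNReal.ofReal_add (by norm_num) hq,
                ENNReal.ofReal_ofNat]
              ring
          _ ≤ _ := by gcongr
      calc ∫⁻ y, h s y * ENNReal.ofReal ((V s y + k * (1 + s) ^ (-κ)) ^ (m - 1) *
            Real.exp (lam * (V s y + k * (1 + s) ^ (-κ)) ^ p))
          ≤ ∫⁻ y, ENNReal.ofReal (k ^ (m - 1) * c3) *
            (2 * h s y + ENNReal.ofReal δ * ENNReal.ofReal (young p (V s y / k))) :=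
            lintegral_mono hpt
        _ = ENNReal.ofReal (k ^ (m - 1) * c3) * ((2 * ∫⁻ y, h s y) +
            ENNReal.ofReal δ * ∫⁻ y, ENNReal.ofReal (young p (V s y / k))) := by
            have := hhslice s
            rw [lintegral_const_mul' _ _ ENNReal.ofReal_ne_top, lintegral_add_left (by fun_prop),
              lintegral_const_mul' _ _ (by norm_num),
              lintegral_const_mul' _ _ ENNReal.ofReal_ne_top]
        _ ≤ ENNReal.ofReal (k ^ (m - 1) * c3) * (ENNReal.ofReal 2 * ENNReal.ofReal (δ * 2 ^ γ) +
            ENNReal.ofReal δ * 1) := by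
            rw [ENNReal.ofReal_ofNat]
            gcongr
            · refine (hint s hs).trans (ENNReal.ofReal_le_ofReal ?_)
              gcongr
              linarith
            · exact hmodint s hs
        _ = ENNReal.ofReal (k ^ (m - 1) * c3 * (2 * (δ * 2 ^ γ) + δ)) := by
            rw [mul_one, ← ENNReal.ofReal_mul (by norm_num), ← ENNReal.ofReal_add (by positivity) hδ,
              ← ENNReal.ofReal_mul (by positivity)]
        _ ≤ _ := by
            refine ENNReal.ofReal_le_ofReal (le_trans ?_ (hcp _ (by positivity) d1 (by simp)))
            have := two_rpow_mul_le hγ1 hs hs1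
            calc k ^ (m - 1) * c3 * (2 * (δ * 2 ^ γ) + δ)
                = k ^ (m - 1) * δ * (c3 * (2 * 2 ^ γ + 1) * 1) := by ring
              _ ≤ k ^ (m - 1) * δ * (c3 * (2 * 2 ^ γ + 1) *
                  (2 ^ (-(γ - 1)) * (1 + s) ^ (γ - 1))) := by gcongr
              _ = _ := by rw [hd1]; ring
    · calc ∫⁻ y, h s y * ENNReal.ofReal ((V s y + k * (1 + s) ^ (-κ)) ^ (m - 1) *
            Real.exp (lam * (V s y + k * (1 + s) ^ (-κ)) ^ p))
          ≤ ∫⁻ y, h s y * ENNReal.ofReal (k ^ (m - 1) * d2 * (1 + s) ^ (-1 : ℝ)) :=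
            lintegral_mono fun y => by
              exact mul_le_mul' le_rfl (ENNReal.ofReal_le_ofReal (hlate s hs1 y))
        _ = (∫⁻ y, h s y) * ENNReal.ofReal (k ^ (m - 1) * d2 * (1 + s) ^ (-1 : ℝ)) :=
            lintegral_mul_const' _ _ ENNReal.ofReal_ne_top
        _ ≤ ENNReal.ofReal (δ * (1 + s) ^ γ) *
            ENNReal.ofReal (k ^ (m - 1) * d2 * (1 + s) ^ (-1 : ℝ)) := by
            gcongr
            exact hint s hs
        _ = ENNReal.ofReal (k ^ (m - 1) * δ * (d2 * (1 + s) ^ (γ - 1))) := by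
            rw [← ENNReal.ofReal_mul (by positivity)]
            congr 1
            rw [show γ - 1 = γ + (-1) by ring, Real.rpow_add (by positivity)]
            ring
        _ ≤ _ := ENNReal.ofReal_le_ofReal (hcp _ (by positivity) d2 (by simp))
  · intro s τ hs hτ x
    rw [← ENNReal.ofReal_mul (by positivity)]
    rcases le_total s 1 with hs1 | hs1
    · refine (heatL_young_rpow_le (p := p) hβ hβ2 (hslice s) (hV.nonneg s hs) hk (hV.modular s hs)
        (A := δ * (k ^ (m - 1) * c3)) (by positivity) (fun y => ?_) hτ x).trans
        (ENNReal.ofReal_le_ofReal ?_)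
      · have hhδ : h s y ≤ ENNReal.ofReal δ :=
          (hsup s hs y).trans (ENNReal.ofReal_le_ofReal (mul_le_of_le_one_right hδ (hb1 s hs)))
        rw [mul_assoc δ, ENNReal.ofReal_mul hδ]
        exact mul_le_mul' hhδ (ENNReal.ofReal_le_ofReal (hearly s hs y))
      · refine le_trans ?_ (hcp _ (by positivity) d3 (by simp))
        have h5 : -κ - 1 ≤ 0 := by linarith
        have := two_rpow_mul_le h5 hs hs1
        rw [hd3]
        calc δ * (k ^ (m - 1) * c3) * (1 + kernelMax n β ^ (1 / R)) * (1 + τ ^ (-(1 / 2) : ℝ))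
            = k ^ (m - 1) * δ * (c3 * (1 + kernelMax n β ^ (1 / R)) *
              (1 + τ ^ (-(1 / 2) : ℝ))) * 1 := by ring
          _ ≤ k ^ (m - 1) * δ * (c3 * (1 + kernelMax n β ^ (1 / R)) * (1 + τ ^ (-(1 / 2) : ℝ))) *
              (2 ^ (-(-κ - 1)) * (1 + s) ^ (-κ - 1)) := by gcongr
          _ = _ := by ring
    · refine (heatL_le_const hβ hβ2 hτ (M := ENNReal.ofReal (k ^ (m - 1) * δ *
        (d2 * (1 + s) ^ (-κ - 1)))) (fun y => ?_) x).trans (ENNReal.ofReal_le_ofReal ?_)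
      · calc h s y * ENNReal.ofReal ((V s y + k * (1 + s) ^ (-κ)) ^ (m - 1) *
              Real.exp (lam * (V s y + k * (1 + s) ^ (-κ)) ^ p))
            ≤ ENNReal.ofReal (δ * (1 + s) ^ (-κ)) *
              ENNReal.ofReal (k ^ (m - 1) * d2 * (1 + s) ^ (-1 : ℝ)) := by
              exact mul_le_mul' (hsup s hs y) (ENNReal.ofReal_le_ofReal (hlate s hs1 y))
          _ = _ := by
              rw [← ENNReal.ofReal_mul (by positivity)]
              congr 1
              rw [show -κ - 1 = -κ + (-1) by ring, Real.rpow_add (by positivity)]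
              ring
      · refine le_trans (hcp _ (by positivity) d2 (by simp)) ?_
        have : 0 ≤ τ ^ (-(1 / 2) : ℝ) := by positivity
        refine mul_le_mul_of_nonneg_left ?_ (by positivity)
        exact le_mul_of_one_le_right (by positivity) (by linarith)

end Sources

/-! ### The Duhamel term as a space-time integral -/

section DuhamelIntegral

variable {n : ℕ} {β : ℝ}

/-- The integral of the heat kernel against a source, over space-time. -/
def duhamelInt (β : ℝ) (F : ℝ → EuclideanSpace ℝ (Fin n) → ℝ) (t : ℝ)
    (x : EuclideanSpace ℝ (Fin n)) : ℝ :=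
  ∫ z, kernel β (t - z.1) (x - z.2) * F z.1 z.2
    ∂((volume.restrict (Set.Ioo 0 t)).prod (volume : Measure (EuclideanSpace ℝ (Fin n))))

lemma duhamelInt_of_nonpos (F : ℝ → EuclideanSpace ℝ (Fin n) → ℝ) {t : ℝ} (ht : t ≤ 0)
    (x : EuclideanSpace ℝ (Fin n)) : duhamelInt β F t x = 0 := by
  rw [duhamelInt, Set.Ioo_eq_empty (by linarith)]
  simp

/-- The domain of integration depends on `t`. Writing it as an indicator on a fixed product space
reduces the claim to measurability of a parametric integral. -/
lemma measurable_duhamelInt {F : ℝ → EuclideanSpace ℝ (Fin n) → ℝ}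
    (hF : Measurable (Function.uncurry F)) :
    Measurable (Function.uncurry (duhamelInt β F)) := by
  set S : Set ((ℝ × EuclideanSpace ℝ (Fin n)) × (ℝ × EuclideanSpace ℝ (Fin n))) :=
    {w | 0 < w.2.1 ∧ w.2.1 < w.1.1} with hS
  have hSm : MeasurableSet S := by
    have h1 : Measurable fun w : (ℝ × EuclideanSpace ℝ (Fin n)) ×
        (ℝ × EuclideanSpace ℝ (Fin n)) => w.2.1 := by fun_prop
    have h2 : Measurable fun w : (ℝ × EuclideanSpace ℝ (Fin n)) ×
        (ℝ × EuclideanSpace ℝ (Fin n)) => w.1.1 := by fun_prop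
    exact (measurableSet_lt measurable_const h1).inter (measurableSet_lt h1 h2)
  set g : (ℝ × EuclideanSpace ℝ (Fin n)) × (ℝ × EuclideanSpace ℝ (Fin n)) → ℝ := fun w =>
    kernel β (w.1.1 - w.2.1) (w.1.2 - w.2.2) * F w.2.1 w.2.2 with hg
  have hgm : Measurable g := by
    have h1 : Measurable (fun w : (ℝ × EuclideanSpace ℝ (Fin n)) ×
        (ℝ × EuclideanSpace ℝ (Fin n)) => F w.2.1 w.2.2) := hF.comp measurable_snd
    rw [hg]
    fun_prop
  have h := ((hgm.indicator hSm).stronglyMeasurable.integral_prod_right'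
    (ν := (volume : Measure ℝ).prod (volume : Measure (EuclideanSpace ℝ (Fin n))))).measurable
  convert h using 1
  funext w
  obtain ⟨t, x⟩ := w
  have e1 : (volume.restrict (Set.Ioo 0 t)).prod (volume : Measure (EuclideanSpace ℝ (Fin n))) =
      ((volume : Measure ℝ).prod volume).restrict (Set.Ioo 0 t ×ˢ Set.univ) := by
    rw [← Measure.prod_restrict, Measure.restrict_univ]
  change duhamelInt β F t x = ∫ z, S.indicator g ((t, x), z) ∂_
  rw [duhamelInt, e1, ← integral_indicator (measurableSet_Ioo.prod MeasurableSet.univ)]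
  refine integral_congr_ae (Eventually.of_forall fun z => ?_)
  by_cases hz : z.1 ∈ Set.Ioo 0 t
  · have h1 : z ∈ Set.Ioo 0 t ×ˢ (Set.univ : Set (EuclideanSpace ℝ (Fin n))) :=
      ⟨hz, Set.mem_univ _⟩
    have h2 : ((t, x), z) ∈ S := hz
    simp only [Set.indicator_of_mem h1, Set.indicator_of_mem h2, hg]
  · have h1 : z ∉ Set.Ioo 0 t ×ˢ (Set.univ : Set (EuclideanSpace ℝ (Fin n))) := fun h => hz h.1
    have h2 : ((t, x), z) ∉ S := hz
    simp only [Set.indicator_of_notMem h1, Set.indicator_of_notMem h2]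

namespace SourceBound

variable {κ γ : ℝ} {η : ℝ≥0∞} {H : ℝ → EuclideanSpace ℝ (Fin n) → ℝ≥0∞}

lemma add {η' : ℝ≥0∞} {H' : ℝ → EuclideanSpace ℝ (Fin n) → ℝ≥0∞} (h : SourceBound β κ γ η H)
    (h' : SourceBound β κ γ η' H') :
    SourceBound β κ γ (η + η') (fun s y => H s y + H' s y) where
  meas := h.meas.add h'.meas
  mass s hs := by
    rw [lintegral_add_left (h.measurable_slice s), add_mul]
    exact add_le_add (h.mass s hs) (h'.mass s hs)
  heat s τ hs hτ x := by
    rw [heatL_add (h.measurable_slice s), add_mul]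
    exact add_le_add (h.heat s τ hs hτ x) (h'.heat s τ hs hτ x)

lemma const_mul {c : ℝ≥0∞} (hc : c ≠ ∞) (h : SourceBound β κ γ η H) :
    SourceBound β κ γ (c * η) (fun s y => c * H s y) where
  meas := h.meas.const_mul c
  mass s hs := by
    rw [lintegral_const_mul' _ _ hc, mul_assoc]
    gcongr
    exact h.mass s hs
  heat s τ hs hτ x := by
    rw [heatL_const_mul hc, mul_assoc]
    gcongr
    exact h.heat s τ hs hτ x

end SourceBound

variable [NeZero n]

lemma lintegral_enorm_duhamel_integrand_le (hβ : 0 < β) (hβ2 : β < 2)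
    {F : ℝ → EuclideanSpace ℝ (Fin n) → ℝ} (hF : Measurable (Function.uncurry F))
    {H : ℝ → EuclideanSpace ℝ (Fin n) → ℝ≥0∞} (hFH : ∀ s, 0 < s → ∀ y, ‖F s y‖ₑ ≤ H s y)
    (t : ℝ) (x : EuclideanSpace ℝ (Fin n)) :
    ∫⁻ z, ‖kernel β (t - z.1) (x - z.2) * F z.1 z.2‖ₑ
      ∂((volume.restrict (Set.Ioo 0 t)).prod (volume : Measure (EuclideanSpace ℝ (Fin n)))) ≤
      ∫⁻ s in Set.Ioo 0 t, heatL β (t - s) (H s) x := by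
  have h1 : Measurable (fun z : ℝ × EuclideanSpace ℝ (Fin n) => F z.1 z.2) := hF
  rw [lintegral_prod _ (Measurable.aemeasurable (by fun_prop))]
  refine setLIntegral_mono' measurableSet_Ioo fun s hs => lintegral_mono fun y => ?_
  rw [enorm_mul, Real.enorm_of_nonneg (kernel_nonneg hβ hβ2 (sub_pos.2 hs.2) _)]
  gcongr
  exact hFH s hs.1 y

namespace SourceBound

variable {κ γ : ℝ} {η : ℝ≥0∞} {H : ℝ → EuclideanSpace ℝ (Fin n) → ℝ≥0∞}

lemma integrable_duhamel (h : SourceBound β κ γ η H) (hη : η ≠ ∞) (hβ : 0 < β) (hβ2 : β < 2)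
    (hκ : 0 ≤ κ) {F : ℝ → EuclideanSpace ℝ (Fin n) → ℝ} (hF : Measurable (Function.uncurry F))
    (hFH : ∀ s, 0 < s → ∀ y, ‖F s y‖ₑ ≤ H s y) {t : ℝ} (ht : 0 < t)
    (x : EuclideanSpace ℝ (Fin n)) :
    Integrable (fun z : ℝ × EuclideanSpace ℝ (Fin n) =>
      kernel β (t - z.1) (x - z.2) * F z.1 z.2)
      ((volume.restrict (Set.Ioo 0 t)).prod volume) := by
  have h1 : Measurable (fun z : ℝ × EuclideanSpace ℝ (Fin n) => F z.1 z.2) := hF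
  refine ⟨Measurable.aestronglyMeasurable (by fun_prop), ?_⟩
  refine (lintegral_enorm_duhamel_integrand_le hβ hβ2 hF hFH t x).trans_lt ?_
  refine (h.lintegral_heatL_le_sqrt hκ le_rfl ht.le x).trans_lt ?_
  exact ENNReal.mul_lt_top (lt_top_iff_ne_top.2 hη) ENNReal.ofReal_lt_top

lemma duhamel_eq (h : SourceBound β κ γ η H) (hη : η ≠ ∞) (hβ : 0 < β) (hβ2 : β < 2)
    (hκ : 0 ≤ κ) {f : ℝ → ℝ} {u : ℝ → EuclideanSpace ℝ (Fin n) → ℝ}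
    (hF : Measurable (Function.uncurry fun s y => f (u s y)))
    (hFH : ∀ s, 0 < s → ∀ y, ‖f (u s y)‖ₑ ≤ H s y) {t : ℝ} (ht : 0 < t)
    (x : EuclideanSpace ℝ (Fin n)) :
    duhamel β f u t x = duhamelInt β (fun s y => f (u s y)) t x := by
  rw [duhamelInt, integral_prod _ (h.integrable_duhamel hη hβ hβ2 hκ hF hFH ht x), duhamel,
    intervalIntegral.integral_of_le ht.le, integral_Ioc_eq_integral_Ioo]
  rfl

lemma enorm_duhamelInt_sub_le (h : SourceBound β κ γ η H) (hη : η ≠ ∞) (hβ : 0 < β)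
    (hβ2 : β < 2) (hκ : 0 ≤ κ) {F F' : ℝ → EuclideanSpace ℝ (Fin n) → ℝ}
    (hF : Measurable (Function.uncurry F)) (hF' : Measurable (Function.uncurry F'))
    (hFH : ∀ s, 0 < s → ∀ y, ‖F s y‖ₑ ≤ H s y) (hFH' : ∀ s, 0 < s → ∀ y, ‖F' s y‖ₑ ≤ H s y)
    {D : ℝ → EuclideanSpace ℝ (Fin n) → ℝ≥0∞} (hD : ∀ s, 0 < s → ∀ y, ‖F s y - F' s y‖ₑ ≤ D s y)
    {t : ℝ} (ht : 0 < t) (x : EuclideanSpace ℝ (Fin n)) :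
    ‖duhamelInt β F t x - duhamelInt β F' t x‖ₑ ≤
      ∫⁻ s in Set.Ioo 0 t, heatL β (t - s) (D s) x := by
  rw [duhamelInt, duhamelInt, ← integral_sub (h.integrable_duhamel hη hβ hβ2 hκ hF hFH ht x)
    (h.integrable_duhamel hη hβ hβ2 hκ hF' hFH' ht x)]
  simp_rw [← mul_sub]
  refine (enorm_integral_le_lintegral_enorm _).trans ?_
  exact lintegral_enorm_duhamel_integrand_le hβ hβ2 (F := fun s y => F s y - F' s y)
    (hF.sub hF') hD t x

end SourceBound

end DuhamelIntegral

/-! ### The weighted distance -/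

section Close

variable {n : ℕ}

/-- Two functions of space-time are `δ`-close in the weighted `L^∞` and `L¹` norms. -/
structure Close (κ γ δ : ℝ) (w w' : ℝ → EuclideanSpace ℝ (Fin n) → ℝ) : Prop where
  sup : ∀ t : ℝ, 0 < t → ∀ x, ‖w t x - w' t x‖ₑ ≤ ENNReal.ofReal (δ * (1 + t) ^ (-κ))
  mass : ∀ t : ℝ, 0 < t → ∫⁻ x, ‖w t x - w' t x‖ₑ ≤ ENNReal.ofReal (δ * (1 + t) ^ γ)

variable {κ γ : ℝ} {w w' w'' : ℝ → EuclideanSpace ℝ (Fin n) → ℝ}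

lemma Close.symm {δ : ℝ} (h : Close κ γ δ w w') : Close κ γ δ w' w where
  sup t ht x := by rw [enorm_sub_rev]; exact h.sup t ht x
  mass t ht := by simp_rw [enorm_sub_rev (w' t _)]; exact h.mass t ht

lemma Close.trans {δ δ' : ℝ} (hδ : 0 ≤ δ) (hδ' : 0 ≤ δ') (h : Close κ γ δ w w')
    (h' : Close κ γ δ' w' w'') (hw : Measurable (Function.uncurry w))
    (hw' : Measurable (Function.uncurry w')) : Close κ γ (δ + δ') w w'' := by
  have htri : ∀ t x, ‖w t x - w'' t x‖ₑ ≤ ‖w t x - w' t x‖ₑ + ‖w' t x - w'' t x‖ₑ := by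
    intro t x
    rw [← sub_add_sub_cancel (w t x) (w' t x)]
    exact enorm_add_le _ _
  constructor
  · intro t ht x
    refine (htri t x).trans ?_
    rw [add_mul, ENNReal.ofReal_add (by positivity) (by positivity)]
    exact add_le_add (h.sup t ht x) (h'.sup t ht x)
  · intro t ht
    refine (lintegral_mono (htri t)).trans ?_
    have h1 : Measurable (w t) := hw.comp measurable_prodMk_left
    have h2 : Measurable (w' t) := hw'.comp measurable_prodMk_left
    rw [lintegral_add_left (by fun_prop), add_mul,
      ENNReal.ofReal_add (by positivity) (by positivity)]
    exact add_le_add (h.mass t ht) (h'.mass t ht)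

/-- Pointwise convergence is enough: the uniform bound passes to the limit directly, the mass bound
by Fatou. -/
lemma Close.of_tendsto {δ : ℝ} {v : ℕ → ℝ → EuclideanSpace ℝ (Fin n) → ℝ}
    (h : ∀ i, Close κ γ δ w (v i)) (hw : Measurable (Function.uncurry w))
    (hv : ∀ i, Measurable (Function.uncurry (v i)))
    (hlim : ∀ t x, Tendsto (fun i => v i t x) atTop (𝓝 (w' t x))) : Close κ γ δ w w' := by
  have hl : ∀ t x, Tendsto (fun i => ‖w t x - v i t x‖ₑ) atTop (𝓝 ‖w t x - w' t x‖ₑ) :=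
    fun t x => ((hlim t x).const_sub _).enorm
  constructor
  · exact fun t ht x => le_of_tendsto' (hl t x) fun i => (h i).sup t ht x
  · intro t ht
    have h1 : Measurable (w t) := hw.comp measurable_prodMk_left
    have h2 : ∀ i, Measurable (v i t) := fun i => (hv i).comp measurable_prodMk_left
    calc ∫⁻ x, ‖w t x - w' t x‖ₑ = ∫⁻ x, liminf (fun i => ‖w t x - v i t x‖ₑ) atTop :=
          lintegral_congr fun x => (hl t x).liminf_eq.symm
      _ ≤ liminf (fun i => ∫⁻ x, ‖w t x - v i t x‖ₑ) atTop :=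
          lintegral_liminf_le fun i => by have := h2 i; fun_prop
      _ ≤ ENNReal.ofReal (δ * (1 + t) ^ γ) :=
          liminf_le_of_le (by isBoundedDefault) fun b hb =>
            (hb.exists).elim fun i hi => hi.trans ((h i).mass t ht)

lemma enorm_le_to_abs {a b : ℝ} (hb : 0 ≤ b) : ‖a‖ₑ ≤ ENNReal.ofReal b ↔ |a| ≤ b := by
  rw [Real.enorm_eq_ofReal_abs, ENNReal.ofReal_le_ofReal_iff hb]

variable [NeZero n] {β : ℝ}

/-- The uniform weight comes from the decay estimate. The mass weight comes from conservation of
mass and the time integral of `(1+s)^{γ-1}`, which produces `1/γ`. Only the bound `D` on the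
difference enters the size; `H` just makes both integrals finite. -/
lemma SourceBound.close_duhamelInt {η η' : ℝ≥0∞} {H D : ℝ → EuclideanSpace ℝ (Fin n) → ℝ≥0∞}
    (h : SourceBound β κ γ η H) (hη : η ≠ ∞) (hd : SourceBound β κ γ η' D) (hβ : 0 < β)
    (hβ2 : β < 2) (hκ : 0 ≤ κ) (hγ : 0 < γ) (hκγ : γ + κ ≤ n / β)
    {F F' : ℝ → EuclideanSpace ℝ (Fin n) → ℝ}
    (hF : Measurable (Function.uncurry F)) (hF' : Measurable (Function.uncurry F'))
    (hFH : ∀ s, 0 < s → ∀ y, ‖F s y‖ₑ ≤ H s y) (hFH' : ∀ s, 0 < s → ∀ y, ‖F' s y‖ₑ ≤ H s y)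
    (hD : ∀ s, 0 < s → ∀ y, ‖F s y - F' s y‖ₑ ≤ D s y) {δ : ℝ}
    (hδ : η' * ENNReal.ofReal ((3 * 2 ^ κ + (kernelMax n β * 4 ^ (n / β : ℝ) / γ +
      4 * 2 ^ (κ + 1))) + 1 / γ) ≤ ENNReal.ofReal δ) :
    Close κ γ δ (duhamelInt β F) (duhamelInt β F') := by
  have hK := kernelMax_nonneg (n := n) hβ
  have hle : ∀ q c : ℝ, 0 ≤ q → c ≤ (3 * 2 ^ κ + (kernelMax n β * 4 ^ (n / β : ℝ) / γ +
      4 * 2 ^ (κ + 1))) + 1 / γ → η' * ENNReal.ofReal (c * q) ≤ ENNReal.ofReal (δ * q) := by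
    intro q c hq hc
    calc η' * ENNReal.ofReal (c * q) ≤ η' * ENNReal.ofReal (((3 * 2 ^ κ +
          (kernelMax n β * 4 ^ (n / β : ℝ) / γ + 4 * 2 ^ (κ + 1))) + 1 / γ) * q) := by gcongr
      _ ≤ ENNReal.ofReal δ * ENNReal.ofReal q := by
          rw [ENNReal.ofReal_mul' hq, ← mul_assoc]
          gcongr
      _ = _ := (ENNReal.ofReal_mul' hq).symm
  have h0 : 0 ≤ 3 * 2 ^ κ + (kernelMax n β * 4 ^ (n / β : ℝ) / γ + 4 * 2 ^ (κ + 1)) := by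
    positivity
  have h1 : 0 ≤ 1 / γ := by positivity
  constructor
  · intro t ht x
    refine (h.enorm_duhamelInt_sub_le hη hβ hβ2 hκ hF hF' hFH hFH' hD ht x).trans ?_
    refine (hd.lintegral_heatL_decay hβ hκ hγ hκγ ht x).trans ?_
    exact hle _ _ (by positivity) (by linarith)
  · intro t ht
    refine (lintegral_mono fun x =>
      h.enorm_duhamelInt_sub_le hη hβ hβ2 hκ hF hF' hFH hFH' hD ht x).trans ?_
    rw [hd.lintegral_lintegral_heatL hβ hβ2 le_rfl]
    refine (hd.lintegral_mass_le hγ ht.le).trans ?_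
    have : (1 + t) ^ γ / γ = 1 / γ * (1 + t) ^ γ := by ring
    rw [this]
    exact hle _ _ (by positivity) (by linarith)

end Close

/-! ### The contraction argument -/

section FixedPoint

variable {n : ℕ} {β p m κ γ : ℝ}

/-- The local Lipschitz condition on the nonlinearity. -/
def LipExp (C lam m p : ℝ) (f : ℝ → ℝ) : Prop :=
  ∀ a b : ℝ, |f a - f b| ≤ C * |a - b| * (|a| ^ (m - 1) * Real.exp (lam * |a| ^ p) +
    |b| ^ (m - 1) * Real.exp (lam * |b| ^ p))

lemma LipExp.continuous {C lam : ℝ} {f : ℝ → ℝ} (hf : LipExp C lam m p f) (hm : 1 < m)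
    (hp : 0 < p) : Continuous f := by
  refine continuous_iff_continuousAt.2 fun b => ?_
  rw [ContinuousAt, tendsto_iff_dist_tendsto_zero]
  have hcont : Continuous fun a : ℝ => C * |a - b| * (|a| ^ (m - 1) * Real.exp (lam * |a| ^ p) +
      |b| ^ (m - 1) * Real.exp (lam * |b| ^ p)) := by
    have h1 : Continuous fun a : ℝ => |a| ^ (m - 1) :=
      continuous_abs.rpow_const fun _ => Or.inr (by linarith)
    have h2 : Continuous fun a : ℝ => |a| ^ p := continuous_abs.rpow_const fun _ => Or.inr hp.le
    fun_prop
  refine squeeze_zero (fun _ => dist_nonneg) (fun a => hf a b) ?_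
  simpa using hcont.tendsto b

lemma LipExp.abs_le {C lam : ℝ} {f : ℝ → ℝ} (hf : LipExp C lam m p f) (hf0 : f 0 = 0)
    (hC : 0 < C) (hlam : 0 < lam) (hm : 1 < m) (hp : 0 < p) {a v : ℝ} (hav : |a| ≤ v) :
    |f a| ≤ C * (v ^ m * Real.exp (lam * v ^ p)) := by
  have h := hf a 0
  rw [hf0, sub_zero, sub_zero, abs_zero, Real.zero_rpow (by linarith), zero_mul, add_zero] at h
  refine h.trans ?_
  have e : |a| * |a| ^ (m - 1) = |a| ^ m := by
    rw [← Real.rpow_one_add' (abs_nonneg _) (by linarith)]; congr 1; ring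
  rw [mul_assoc, ← mul_assoc |a|, e]
  have hv : 0 ≤ v := (abs_nonneg a).trans hav
  gcongr

lemma LipExp.abs_sub_le {C lam : ℝ} {f : ℝ → ℝ} (hf : LipExp C lam m p f)
    (hC : 0 < C) (hlam : 0 < lam) (hm : 1 < m) (hp : 0 < p) {a b v : ℝ} (ha : |a| ≤ v)
    (hb : |b| ≤ v) : |f a - f b| ≤ 2 * C * |a - b| * (v ^ (m - 1) * Real.exp (lam * v ^ p)) := by
  have hm1 : 0 ≤ m - 1 := by linarith
  have hv : 0 ≤ v := (abs_nonneg a).trans ha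
  refine (hf a b).trans ?_
  calc C * |a - b| * (|a| ^ (m - 1) * Real.exp (lam * |a| ^ p) +
        |b| ^ (m - 1) * Real.exp (lam * |b| ^ p))
      ≤ C * |a - b| * (v ^ (m - 1) * Real.exp (lam * v ^ p) +
        v ^ (m - 1) * Real.exp (lam * v ^ p)) := by gcongr
    _ = _ := by ring

variable [NeZero n]

/-- The data carried by the fixed point: the Duhamel part `w` of the solution. -/
structure DuhamelPart (β p κ γ k B : ℝ) (f : ℝ → ℝ) (u₀ : EuclideanSpace ℝ (Fin n) → ℝ)
    (w : ℝ → EuclideanSpace ℝ (Fin n) → ℝ) : Prop where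
  meas : Measurable (Function.uncurry w)
  close : Close κ γ k w 0
  lin : LinBound p κ k B (fun s => semigroup β s (fun y => |u₀ y|))
  eq : ∀ t : ℝ, 0 < t → ∀ x,
    w t x = duhamelInt β (fun s y => f (semigroup β s u₀ y + w s y)) t x
  source : ∃ (η : ℝ≥0∞) (H : ℝ → EuclideanSpace ℝ (Fin n) → ℝ≥0∞), η ≠ ∞ ∧
    SourceBound β κ γ η H ∧ ∀ s, 0 < s → ∀ y, ‖f (semigroup β s u₀ y + w s y)‖ₑ ≤ H s y

lemma exists_pos_mul_rpow_le {a c e : ℝ} (ha : 0 < a) (he : 0 < e) (hc : 0 < c) :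
    ∃ k₀ : ℝ, 0 < k₀ ∧ ∀ k, 0 < k → k ≤ k₀ → c * k ^ a ≤ e := by
  refine ⟨(e / c) ^ (1 / a), by positivity, fun k hk hle => ?_⟩
  have h : k ^ a ≤ e / c := by
    calc k ^ a ≤ ((e / c) ^ (1 / a)) ^ a := Real.rpow_le_rpow hk.le hle ha.le
      _ = e / c := by rw [← Real.rpow_mul (by positivity), one_div_mul_cancel ha.ne', Real.rpow_one]
  rw [le_div_iff₀ hc] at h
  linarith

/-- Picard iteration from zero in the ball of radius `k`. The map halves distances and sends zero
into the ball of radius `k/2`, so the ball is preserved. Both constants are multiples of `k^{m-1}`,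
small because `m > 1`. -/
theorem exists_duhamelPart (n : ℕ) [NeZero n] (hβ : 0 < β) (hβ2 : β < 2) (hp : 1 < p)
    (hpm : p ≤ m) (hκ : κ * (m - 1) = 1) (hγ : γ = κ * (p - 1)) (hpc : p ≤ n / β * (m - 1))
    {f : ℝ → ℝ} {C lam : ℝ} (hC : 0 < C) (hlam : 0 < lam) (hf0 : f 0 = 0)
    (hf : LipExp C lam m p f) :
    ∃ k B : ℝ, 0 < k ∧ 0 < B ∧ ∀ u₀ : EuclideanSpace ℝ (Fin n) → ℝ, Measurable u₀ →
      expModular p u₀ k ≤ 1 →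
      ∃ w : ℝ → EuclideanSpace ℝ (Fin n) → ℝ, DuhamelPart β p κ γ k B f u₀ w := by
  have hm1 : 0 < m - 1 := by linarith
  have hκ0 : 0 < κ := by
    by_contra h
    have := mul_nonpos_of_nonpos_of_nonneg (not_lt.1 h) hm1.le
    linarith
  have hγ0 : 0 < γ := by rw [hγ]; exact mul_pos hκ0 (by linarith)
  have hκγ : γ + κ ≤ n / β := by
    have h1 : κ * p ≤ κ * (n / β * (m - 1)) := mul_le_mul_of_nonneg_left hpc hκ0.le
    have h2 : κ * (n / β * (m - 1)) = n / β := by linear_combination (n / β : ℝ) * hκ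
    rw [hγ]; linarith
  have hK := kernelMax_nonneg (n := n) hβ
  have hn : (1 : ℝ) ≤ n := by exact_mod_cast (NeZero.one_le : 1 ≤ n)
  obtain ⟨B, hB, hsemi⟩ := exists_semigroup_sup_bound n hβ hβ2 hp hκ hpc
  obtain ⟨c₀, hc₀, hfree⟩ := exists_sourceBound_free (n := n) hβ hβ2 hp hpm hκ hγ hlam hB
  obtain ⟨c₁, hc₁, hmul⟩ := exists_sourceBound_mul (n := n) hβ hβ2 hp hpm hκ hγ hlam hB
  set T := (3 * 2 ^ κ + (kernelMax n β * 4 ^ (n / β : ℝ) / γ + 4 * 2 ^ (κ + 1))) + 1 / γ with hT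
  have hT0 : 0 < T := by positivity
  -- Three demands on `k`: the Young function absorbs the exponential, the image of zero lies in the
  -- half ball, and the map halves distances.
  obtain ⟨k₁, hk₁, hs₁⟩ := exists_pos_mul_rpow_le (a := p) (c := lam * 2 ^ p)
    (e := 1 / (2 * (2 * (n / β)))) (by linarith) (by positivity) (by positivity)
  obtain ⟨k₂, hk₂, hs₂⟩ := exists_pos_mul_rpow_le (a := m - 1) (c := C * c₀ * T) (e := 1 / 2) hm1
    (by norm_num) (by positivity)
  obtain ⟨k₃, hk₃, hs₃⟩ := exists_pos_mul_rpow_le (a := m - 1) (c := 2 * C * c₁ * T) (e := 1 / 2)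
    hm1 (by norm_num) (by positivity)
  set k := min k₁ (min k₂ k₃) with hkd
  have hk : 0 < k := lt_min hk₁ (lt_min hk₂ hk₃)
  have hsm₁ := hs₁ k hk (min_le_left _ _)
  have hsm₂ := hs₂ k hk ((min_le_right _ _).trans (min_le_left _ _))
  have hsm₃ := hs₃ k hk ((min_le_right _ _).trans (min_le_right _ _))
  have hsm₁' : lam * k ^ p * 2 ^ p ≤ 1 / (2 * (2 * (n / β))) := by linarith
  refine ⟨k, B, hk, hB, fun u₀ hu₀ hmod => ?_⟩
  set U := fun s => semigroup β s u₀ with hU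
  set V := fun s => semigroup β s (fun y => |u₀ y|) with hVd
  have hUm : Measurable (Function.uncurry U) := measurable_semigroup hu₀
  have hV : LinBound p κ k B V := by
    refine linBound_semigroup hβ hβ2 hp.le hu₀ hk hmod fun s hs x => ?_
    refine hsemi (fun y => |u₀ y|) k (by fun_prop) hk ?_ s hs x
    simpa [expModular] using hmod
  have hUV : ∀ s, 0 < s → ∀ y, |U s y| ≤ V s y := fun s hs y => abs_semigroup_le hβ hβ2 hs u₀ y
  have hfc : Continuous f := hf.continuous (by linarith) (by linarith)
  set F := fun (w : ℝ → EuclideanSpace ℝ (Fin n) → ℝ) (s : ℝ) y => f (U s y + w s y) with hF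
  have hFm : ∀ w, Measurable (Function.uncurry w) → Measurable (Function.uncurry (F w)) :=
    fun w hw => hfc.measurable.comp (hUm.add hw)
  set H0 : ℝ → EuclideanSpace ℝ (Fin n) → ℝ≥0∞ := fun s y =>
    ENNReal.ofReal C * ENNReal.ofReal (V s y ^ m * Real.exp (lam * V s y ^ p)) with hH0
  have hH0b : SourceBound β κ γ (ENNReal.ofReal C * ENNReal.ofReal (c₀ * k ^ m)) H0 :=
    (hfree k hk hsm₁' V hV).const_mul ENNReal.ofReal_ne_top
  set D := fun (w w' : ℝ → EuclideanSpace ℝ (Fin n) → ℝ) (s : ℝ) (y : EuclideanSpace ℝ (Fin n)) =>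
    ENNReal.ofReal (2 * C) * (‖w s y - w' s y‖ₑ *
      ENNReal.ofReal ((V s y + k * (1 + s) ^ (-κ)) ^ (m - 1) *
        Real.exp (lam * (V s y + k * (1 + s) ^ (-κ)) ^ p))) with hD
  have hDb : ∀ w w' : ℝ → EuclideanSpace ℝ (Fin n) → ℝ, Measurable (Function.uncurry w) →
      Measurable (Function.uncurry w') → ∀ δ : ℝ, 0 ≤ δ → Close κ γ δ w w' →
      SourceBound β κ γ (ENNReal.ofReal (2 * C) * ENNReal.ofReal (c₁ * k ^ (m - 1) * δ))
        (D w w') := by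
    intro w w' hw hw' δ hδ hc
    exact (hmul k hk hsm₁' V hV δ hδ (fun s y => ‖w s y - w' s y‖ₑ) (hw.sub hw').enorm
      hc.sup hc.mass).const_mul ENNReal.ofReal_ne_top
  have habs : ∀ w : ℝ → EuclideanSpace ℝ (Fin n) → ℝ, Close κ γ k w 0 → ∀ s, 0 < s → ∀ y,
      |U s y + w s y| ≤ V s y + k * (1 + s) ^ (-κ) := by
    intro w hw s hs y
    have h1 := hw.sup s hs y
    rw [enorm_le_to_abs (by positivity)] at h1
    simp only [Pi.zero_apply, sub_zero] at h1
    exact (abs_add_le _ _).trans (add_le_add (hUV s hs y) h1)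
  have hFD : ∀ w w' : ℝ → EuclideanSpace ℝ (Fin n) → ℝ, Close κ γ k w 0 → Close κ γ k w' 0 →
      ∀ s, 0 < s → ∀ y, ‖F w s y - F w' s y‖ₑ ≤ D w w' s y := by
    intro w w' hw hw' s hs y
    have h1 := hf.abs_sub_le hC hlam (by linarith) (by linarith) (habs w hw s hs y)
      (habs w' hw' s hs y)
    rw [add_sub_add_left_eq_sub] at h1
    have hV0 := hV.nonneg s hs y
    simp only [hD, hF]
    rw [Real.enorm_eq_ofReal_abs, Real.enorm_eq_ofReal_abs, ← ENNReal.ofReal_mul (abs_nonneg _),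
      ← ENNReal.ofReal_mul (by positivity), ← mul_assoc]
    exact ENNReal.ofReal_le_ofReal h1
  have hzero : Close κ γ k (0 : ℝ → EuclideanSpace ℝ (Fin n) → ℝ) 0 :=
    ⟨fun t ht x => by simp, fun t ht => by simp⟩
  have hzm : Measurable (Function.uncurry (0 : ℝ → EuclideanSpace ℝ (Fin n) → ℝ)) :=
    measurable_const
  have hF0 : ∀ s, 0 < s → ∀ y, ‖F 0 s y‖ₑ ≤ H0 s y := by
    intro s hs y
    have h1 := hf.abs_le hf0 hC hlam (by linarith) (by linarith) (hUV s hs y)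
    simp only [hH0, hF, Pi.zero_apply, add_zero]
    rw [Real.enorm_eq_ofReal_abs, ← ENNReal.ofReal_mul hC.le]
    exact ENNReal.ofReal_le_ofReal h1
  have hsrc : ∀ w : ℝ → EuclideanSpace ℝ (Fin n) → ℝ, Measurable (Function.uncurry w) →
      Close κ γ k w 0 → ∃ (η : ℝ≥0∞), η ≠ ∞ ∧
        SourceBound β κ γ η (fun s y => H0 s y + D w 0 s y) ∧
        ∀ s, 0 < s → ∀ y, ‖F w s y‖ₑ ≤ H0 s y + D w 0 s y := by
    intro w hw hc
    refine ⟨_, ?_, hH0b.add (hDb w 0 hw hzm k hk.le hc), fun s hs y => ?_⟩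
    · exact ENNReal.add_ne_top.2 ⟨ENNReal.mul_ne_top ENNReal.ofReal_ne_top ENNReal.ofReal_ne_top,
        ENNReal.mul_ne_top ENNReal.ofReal_ne_top ENNReal.ofReal_ne_top⟩
    · have e : F w s y = F 0 s y + (F w s y - F 0 s y) := by ring
      rw [e]
      exact (enorm_add_le _ _).trans (add_le_add (hF0 s hs y) (hFD w 0 hc hzero s hs y))
  have hcontr : ∀ w w' : ℝ → EuclideanSpace ℝ (Fin n) → ℝ, Measurable (Function.uncurry w) →
      Measurable (Function.uncurry w') → Close κ γ k w 0 → Close κ γ k w' 0 → ∀ δ : ℝ, 0 ≤ δ →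
      Close κ γ δ w w' → Close κ γ (δ / 2) (duhamelInt β (F w)) (duhamelInt β (F w')) := by
    intro w w' hw hw' hc hc' δ hδ hd
    obtain ⟨η, hη, hb, hFw⟩ := hsrc w hw hc
    obtain ⟨η', hη', hb', hFw'⟩ := hsrc w' hw' hc'
    -- A common majorant of both sources is needed for finiteness; its size does not enter the
    -- estimate.
    refine (hb.add hb').close_duhamelInt (ENNReal.add_ne_top.2 ⟨hη, hη'⟩)
      (hDb w w' hw hw' δ hδ hd) hβ hβ2 hκ0.le hγ0 hκγ (hFm w hw) (hFm w' hw')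
      (fun s hs y => (hFw s hs y).trans le_self_add)
      (fun s hs y => (hFw' s hs y).trans le_add_self) (hFD w w' hc hc') ?_
    rw [← ENNReal.ofReal_mul (by positivity), ← ENNReal.ofReal_mul (by positivity)]
    refine ENNReal.ofReal_le_ofReal ?_
    calc 2 * C * (c₁ * k ^ (m - 1) * δ) * T = (2 * C * c₁ * T * k ^ (m - 1)) * δ := by ring
      _ ≤ 1 / 2 * δ := by gcongr
      _ = δ / 2 := by ring
  have hbase : Close κ γ (k / 2) (duhamelInt β (F 0)) 0 := by
    have hd0 : duhamelInt β (fun _ _ => 0) = (0 : ℝ → EuclideanSpace ℝ (Fin n) → ℝ) := by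
      funext t x
      simp [duhamelInt]
    have hc0 : Close κ γ (k / 2) (duhamelInt β (F 0)) (duhamelInt β fun _ _ => 0) := by
      refine hH0b.close_duhamelInt (F' := fun _ _ => 0)
        (ENNReal.mul_ne_top ENNReal.ofReal_ne_top ENNReal.ofReal_ne_top) hH0b hβ hβ2 hκ0.le hγ0 hκγ
        (hFm 0 hzm) measurable_const hF0 (fun s hs y => by simp)
        (fun s hs y => by simpa using hF0 s hs y) ?_
      rw [← ENNReal.ofReal_mul (by positivity), ← ENNReal.ofReal_mul (by positivity)]
      refine ENNReal.ofReal_le_ofReal ?_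
      have e : k ^ m = k ^ (m - 1) * k := by
        rw [← Real.rpow_add_one hk.ne']; congr 1; ring
      calc C * (c₀ * k ^ m) * T = (C * c₀ * T * k ^ (m - 1)) * k := by rw [e]; ring
        _ ≤ 1 / 2 * k := by gcongr
        _ = k / 2 := by ring
    rwa [hd0] at hc0
  set W : ℕ → ℝ → EuclideanSpace ℝ (Fin n) → ℝ := fun j =>
    Nat.rec 0 (fun _ w => duhamelInt β (F w)) j with hW
  have hWs : ∀ j, W (j + 1) = duhamelInt β (F (W j)) := fun j => rfl
  have hWm : ∀ j, Measurable (Function.uncurry (W j)) := by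
    intro j
    induction j with
    | zero => exact hzm
    | succ j ih => rw [hWs]; exact measurable_duhamelInt (hFm _ ih)
  have hWc : ∀ j, Close κ γ k (W j) 0 := by
    intro j
    induction j with
    | zero => exact hzero
    | succ j ih =>
      have h1 := hcontr (W j) 0 (hWm j) hzm ih hzero k hk.le ih
      have h2 := h1.trans (by positivity) (by positivity) hbase (hWm (j + 1))
        (measurable_duhamelInt (hFm _ hzm))
      rwa [add_halves] at h2
  -- Each iterate is compared with all later ones at once. The starting case is the ball bound, and
  -- the estimate passes to the limit with the same rate.
  have hWd : ∀ j i, Close κ γ (k / 2 ^ j) (W j) (W (j + i)) := by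
    intro j
    induction j with
    | zero =>
      intro i
      rw [pow_zero, div_one]
      exact (hWc (0 + i)).symm
    | succ j ih =>
      intro i
      have h1 := hcontr _ _ (hWm j) (hWm (j + i)) (hWc j) (hWc (j + i)) _ (by positivity) (ih i)
      rw [← hWs, ← hWs, div_div, ← pow_succ] at h1
      rwa [show j + 1 + i = j + i + 1 by ring]
  have hlim : ∀ t x, ∃ a, Tendsto (fun j => W j t x) atTop (𝓝 a) := by
    intro t x
    -- For `t ≤ 0` all iterates vanish, so the limit exists everywhere and is measurable on all of
    -- space-time.
    rcases le_or_gt t 0 with ht | ht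
    · refine ⟨0, tendsto_const_nhds.congr fun j => ?_⟩
      cases j with
      | zero => rfl
      | succ j => rw [hWs, duhamelInt_of_nonpos _ ht]
    · refine cauchySeq_tendsto_of_complete (cauchySeq_of_le_geometric (1 / 2)
        (k * (1 + t) ^ (-κ)) (by norm_num) fun j => ?_)
      have h1 := (hWd j 1).sup t ht x
      rw [enorm_le_to_abs (by positivity)] at h1
      rw [Real.dist_eq]
      refine h1.trans (le_of_eq ?_)
      rw [one_div, inv_pow]
      ring
  choose w hw using hlim
  have hwm : Measurable (Function.uncurry w) :=
    measurable_of_tendsto_metrizable hWm (tendsto_pi_nhds.2 fun z => hw z.1 z.2)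
  have hwd : ∀ j, Close κ γ (k / 2 ^ j) (W j) w := fun j =>
    Close.of_tendsto (hWd j) (hWm j) (fun i => hWm (j + i)) fun t x =>
      (hw t x).comp (tendsto_atTop_mono (fun i => Nat.le_add_left i j) tendsto_id)
  have hwc : Close κ γ k w 0 := by
    have h1 := (hwd 0).symm
    rwa [pow_zero, div_one] at h1
  refine ⟨w, hwm, hwc, hV, fun t ht x => ?_, ?_⟩
  · have hlim1 : Tendsto (fun j => W (j + 1) t x) atTop (𝓝 (w t x)) :=
      (hw t x).comp (tendsto_add_atTop_nat 1)
    refine tendsto_nhds_unique hlim1 ?_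
    rw [tendsto_iff_dist_tendsto_zero]
    have hg : Tendsto (fun j : ℕ => (k * (1 + t) ^ (-κ)) * (1 / 2 : ℝ) ^ j) atTop (𝓝 0) := by
      simpa using (tendsto_pow_atTop_nhds_zero_of_lt_one (by norm_num : (0 : ℝ) ≤ 1 / 2)
        (by norm_num)).const_mul (k * (1 + t) ^ (-κ))
    refine squeeze_zero (fun _ => dist_nonneg) (fun j => ?_) hg
    have h1 := (hcontr _ _ (hWm j) hwm (hWc j) hwc _ (by positivity) (hwd j)).sup t ht x
    rw [enorm_le_to_abs (by positivity)] at h1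
    rw [Real.dist_eq]
    refine h1.trans ?_
    rw [one_div, inv_pow]
    have : 0 ≤ k * (1 + t) ^ (-κ) * (2 ^ j)⁻¹ := by positivity
    calc k / 2 ^ j / 2 * (1 + t) ^ (-κ) = k * (1 + t) ^ (-κ) * (2 ^ j)⁻¹ / 2 := by ring
      _ ≤ _ := by linarith
  · obtain ⟨η, hη, hb, hFw⟩ := hsrc w hwm hwc
    exact ⟨η, _, hη, hb, hFw⟩

end FixedPoint

/-! ### The Luxemburg norm and its modular -/

section Norm

variable {n : ℕ} {p : ℝ}

lemma expLNorm_le {u : EuclideanSpace ℝ (Fin n) → ℝ} {k : ℝ} (hk : 0 < k)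
    (h : expModular p u k ≤ 1) : expLNorm p u ≤ ENNReal.ofReal k :=
  iInf_le_of_le k (iInf_le_of_le hk (iInf_le_of_le h le_rfl))

lemma expModular_anti (hp : 0 ≤ p) (u : EuclideanSpace ℝ (Fin n) → ℝ) {k k' : ℝ} (hk : 0 < k)
    (hkk : k ≤ k') : expModular p u k' ≤ expModular p u k :=
  lintegral_mono fun _ => ENNReal.ofReal_le_ofReal
    (young_mono hp (div_nonneg (abs_nonneg _) (hk.le.trans hkk))
      (div_le_div_of_nonneg_left (abs_nonneg _) hk hkk))

/-- Strictness supplies an admissible radius below `k`, so the infimum need not be attained. -/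
lemma expModular_le_one_of_expLNorm_lt (hp : 0 ≤ p) {u : EuclideanSpace ℝ (Fin n) → ℝ} {k : ℝ}
    (h : expLNorm p u < ENNReal.ofReal k) : expModular p u k ≤ 1 := by
  simp only [expLNorm, iInf_lt_iff] at h
  obtain ⟨k', hk', hmod, hlt⟩ := h
  refine (expModular_anti hp u hk' ?_).trans hmod
  exact ((ENNReal.ofReal_lt_ofReal_iff_of_nonneg hk'.le).1 hlt).le

/-- The triangle inequality of the Luxemburg norm: `(|u| + |v|)/(k + l)` is the convex combination
of `|u|/k` and `|v|/l` with weights `k/(k+l)` and `l/(k+l)`. -/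
lemma expModular_add_le (hp : 1 ≤ p) {u v : EuclideanSpace ℝ (Fin n) → ℝ} (hu : Measurable u)
    {k l : ℝ} (hk : 0 < k) (hl : 0 < l) (h : expModular p u k ≤ 1) (h' : expModular p v l ≤ 1) :
    expModular p (fun x => u x + v x) (k + l) ≤ 1 := by
  have hkl : 0 < k + l := by positivity
  have key : ∀ x, ENNReal.ofReal (young p (|u x + v x| / (k + l))) ≤
      ENNReal.ofReal (k / (k + l)) * ENNReal.ofReal (young p (|u x| / k)) +
      ENNReal.ofReal (l / (k + l)) * ENNReal.ofReal (young p (|v x| / l)) := by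
    intro x
    have hyu := young_nonneg (p := p) (show 0 ≤ |u x| / k by positivity)
    have hyv := young_nonneg (p := p) (show 0 ≤ |v x| / l by positivity)
    rw [← ENNReal.ofReal_mul (by positivity), ← ENNReal.ofReal_mul (by positivity),
      ← ENNReal.ofReal_add (by positivity) (by positivity)]
    refine ENNReal.ofReal_le_ofReal ?_
    have h1 := (convexOn_young hp).2 (show |u x| / k ∈ Set.Ici 0 from by
        simp only [Set.mem_Ici]; positivity)
      (show |v x| / l ∈ Set.Ici 0 from by simp only [Set.mem_Ici]; positivity)
      (show 0 ≤ k / (k + l) by positivity) (show 0 ≤ l / (k + l) by positivity)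
      (by field_simp)
    refine le_trans (young_mono (by linarith) (by positivity) ?_) h1
    have : (k / (k + l)) • (|u x| / k) + (l / (k + l)) • (|v x| / l) =
        (|u x| + |v x|) / (k + l) := by
      simp only [smul_eq_mul]
      field_simp
    rw [this]
    gcongr
    exact abs_add_le _ _
  rw [expModular_eq]
  refine (lintegral_mono key).trans ?_
  rw [lintegral_add_left (by fun_prop), lintegral_const_mul' _ _ ENNReal.ofReal_ne_top,
    lintegral_const_mul' _ _ ENNReal.ofReal_ne_top]
  calc _ ≤ ENNReal.ofReal (k / (k + l)) * 1 + ENNReal.ofReal (l / (k + l)) * 1 := by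
        gcongr
        · exact h
        · exact h'
    _ = 1 := by
        rw [mul_one, mul_one, ← ENNReal.ofReal_add (by positivity) (by positivity), ← add_div,
          div_self hkl.ne', ENNReal.ofReal_one]

lemma lintegral_rpow_le_of_sup (hp : 1 ≤ p) {w : EuclideanSpace ℝ (Fin n) → ℝ} {a b : ℝ}
    (ha : 0 ≤ a) (hsup : ∀ x, |w x| ≤ a) (hmass : ∫⁻ x, ‖w x‖ₑ ≤ ENNReal.ofReal b) :
    ∫⁻ x, ENNReal.ofReal (|w x| ^ p) ≤ ENNReal.ofReal (a ^ (p - 1) * b) := by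
  calc ∫⁻ x, ENNReal.ofReal (|w x| ^ p)
      ≤ ∫⁻ x, ENNReal.ofReal (a ^ (p - 1)) * ‖w x‖ₑ := by
        refine lintegral_mono fun x => ?_
        rw [Real.enorm_eq_ofReal_abs, ← ENNReal.ofReal_mul (by positivity)]
        refine ENNReal.ofReal_le_ofReal ?_
        have : |w x| ^ p = |w x| ^ (p - 1) * |w x| := by
          rw [← Real.rpow_add_one' (abs_nonneg _) (by linarith)]; congr 1; ring
        rw [this]
        have hp1 : 0 ≤ p - 1 := by linarith
        gcongr
        exact hsup x
    _ = ENNReal.ofReal (a ^ (p - 1)) * ∫⁻ x, ‖w x‖ₑ :=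
        lintegral_const_mul' _ _ ENNReal.ofReal_ne_top
    _ ≤ _ := by
        rw [ENNReal.ofReal_mul (by positivity)]
        gcongr

/-- The argument of the exponential is at most one, where `e^z - 1 ≤ 2z`. The doubled radius absorbs
this factor, since `2 ≤ 2^p`. -/
lemma expModular_two_mul_le_one (hp : 1 ≤ p) {w : EuclideanSpace ℝ (Fin n) → ℝ} {δ : ℝ}
    (hδ : 0 < δ) (hsup : ∀ x, |w x| ≤ δ)
    (hint : ∫⁻ x, ENNReal.ofReal (|w x| ^ p) ≤ ENNReal.ofReal (δ ^ p)) :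
    expModular p w (2 * δ) ≤ 1 := by
  have key : ∀ x, ENNReal.ofReal (young p (|w x| / (2 * δ))) ≤
      ENNReal.ofReal (2 * ((2 * δ) ^ p)⁻¹) * ENNReal.ofReal (|w x| ^ p) := by
    intro x
    rw [← ENNReal.ofReal_mul (by positivity)]
    refine ENNReal.ofReal_le_ofReal ?_
    have h0 : 0 ≤ |w x| / (2 * δ) := by positivity
    have h1 : (|w x| / (2 * δ)) ^ p ≤ 1 := by
      refine Real.rpow_le_one h0 ?_ (by linarith)
      rw [div_le_one (by positivity)]
      linarith [hsup x]
    have h2 : young p (|w x| / (2 * δ)) ≤ 2 * (|w x| / (2 * δ)) ^ p := by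
      have h3 := Real.rpow_nonneg h0 p
      have := Real.abs_exp_sub_one_le (x := (|w x| / (2 * δ)) ^ p) (by rwa [abs_of_nonneg h3])
      rw [abs_of_nonneg h3] at this
      exact (le_abs_self _).trans this
    rw [Real.div_rpow (abs_nonneg _) (by positivity)] at h2
    refine h2.trans (le_of_eq ?_)
    ring
  rw [expModular_eq]
  refine (lintegral_mono key).trans ?_
  rw [lintegral_const_mul' _ _ ENNReal.ofReal_ne_top]
  calc _ ≤ ENNReal.ofReal (2 * ((2 * δ) ^ p)⁻¹) * ENNReal.ofReal (δ ^ p) := by gcongr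
    _ ≤ 1 := by
      rw [← ENNReal.ofReal_mul (by positivity), ← ENNReal.ofReal_one]
      refine ENNReal.ofReal_le_ofReal ?_
      rw [Real.mul_rpow (by norm_num) hδ.le]
      have h2 : (2 : ℝ) ≤ 2 ^ p := by
        simpa using Real.rpow_le_rpow_of_exponent_le (by norm_num : (1 : ℝ) ≤ 2) hp
      have h3 : 0 < δ ^ p := Real.rpow_pos_of_pos hδ p
      rw [mul_assoc, inv_mul_eq_div, ← mul_div_assoc, div_le_one (by positivity)]
      nlinarith

lemma expModular_le_one_of_small (hp : 1 ≤ p) {w : EuclideanSpace ℝ (Fin n) → ℝ} {δ : ℝ}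
    (hδ : 0 < δ) (hsup : ∀ x, |w x| ≤ δ) (hmass : ∫⁻ x, ‖w x‖ₑ ≤ ENNReal.ofReal δ) :
    expModular p w (2 * δ) ≤ 1 := by
  refine expModular_two_mul_le_one hp hδ hsup ?_
  refine (lintegral_rpow_le_of_sup hp hδ.le hsup hmass).trans (le_of_eq ?_)
  rw [← Real.rpow_add_one hδ.ne', sub_add_cancel]

lemma locallyIntegrable_of_expModular (hp : 1 ≤ p) {u : EuclideanSpace ℝ (Fin n) → ℝ}
    (hu : Measurable u) {k : ℝ} (hk : 0 < k) (h : expModular p u k < ∞) :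
    LocallyIntegrable u volume := by
  have hy : Integrable (fun x => young p (|u x| / k)) := by
    refine ⟨Measurable.aestronglyMeasurable (by fun_prop), ?_⟩
    rw [hasFiniteIntegral_iff_ofReal
      (Eventually.of_forall fun x => young_nonneg (by positivity))]
    exact h
  have h1 : LocallyIntegrable (fun x => k * (1 + young p (|u x| / k))) volume := by
    have h2 : LocallyIntegrable (fun _ : EuclideanSpace ℝ (Fin n) => k) volume :=
      locallyIntegrable_const k
    have h3 : LocallyIntegrable (fun x => k * young p (|u x| / k)) volume :=
      (hy.const_mul k).locallyIntegrable
    have h4 := h2.add h3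
    refine (funext fun x => ?_ : (fun x => k * (1 + young p (|u x| / k))) = _) ▸ h4
    simp only [Pi.add_apply]
    ring
  refine h1.mono hu.aestronglyMeasurable (Eventually.of_forall fun x => ?_)
  have h5 := le_one_add_young (p := p) hp (show 0 ≤ |u x| / k by positivity)
  rw [div_le_iff₀ hk] at h5
  rw [Real.norm_eq_abs]
  refine le_trans ?_ (le_abs_self _)
  linarith

lemma memExpL_of_modular_le (hp : 1 ≤ p) {u : EuclideanSpace ℝ (Fin n) → ℝ}
    (hu : Measurable u) {k : ℝ} (hk : 0 < k) (h : expModular p u k ≤ 1) : MemExpL p u :=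
  ⟨locallyIntegrable_of_expModular hp hu hk (h.trans_lt ENNReal.one_lt_top), k, hk,
    h.trans_lt ENNReal.one_lt_top⟩

lemma tendsto_expLNorm_zero {ι : Type*} {l : Filter ι}
    {g : ι → EuclideanSpace ℝ (Fin n) → ℝ}
    (h : ∀ e : ℝ, 0 < e → ∀ᶠ i in l, expModular p (g i) e ≤ 1) :
    Tendsto (fun i => expLNorm p (g i)) l (𝓝 0) := by
  rw [ENNReal.tendsto_nhds_zero]
  intro ε hε
  obtain ⟨e, he, hle⟩ : ∃ e : ℝ, 0 < e ∧ ENNReal.ofReal e ≤ ε := by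
    rcases eq_or_ne ε ∞ with rfl | htop
    · exact ⟨1, one_pos, le_top⟩
    · exact ⟨ε.toReal, ENNReal.toReal_pos hε.ne' htop, (ENNReal.ofReal_toReal htop).le⟩
  filter_upwards [h e he] with i hi
  exact (expLNorm_le he hi).trans hle

end Norm

/-! ### Norm continuity of the linear part at positive times -/

section LinearContinuity

variable {n : ℕ} [NeZero n] {β p : ℝ}

/-- In `|u| ≤ k(1 + young)` the constant is paired with the integrable kernel, and the integrable
Young part with the bounded kernel. -/
lemma integrable_kernel_mul (hβ : 0 < β) (hβ2 : β < 2) (hp : 1 ≤ p)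
    {u : EuclideanSpace ℝ (Fin n) → ℝ} (hu : Measurable u) {k : ℝ} (hk : 0 < k)
    (hmod : expModular p u k < ∞) {t : ℝ} (ht : 0 < t) (x : EuclideanSpace ℝ (Fin n)) :
    Integrable (fun y => kernel β t (x - y) * u y) := by
  have hy : Integrable (fun x => young p (|u x| / k)) := by
    refine ⟨Measurable.aestronglyMeasurable (by fun_prop), ?_⟩
    rw [hasFiniteIntegral_iff_ofReal
      (Eventually.of_forall fun x => young_nonneg (by positivity))]
    exact hmod
  have h1 : Integrable (fun y => kernel β t (x - y)) := (integrable_kernel hβ hβ2 ht).comp_sub_left x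
  have h2 := (h1.add (hy.const_mul (kernelMax n β * t ^ (-(n / β))))).const_mul k
  refine h2.mono' (Measurable.aestronglyMeasurable (by fun_prop)) (Eventually.of_forall fun y => ?_)
  have hK0 := kernel_nonneg hβ hβ2 ht (x - y)
  have hK1 := kernel_le hβ ht (x - y)
  have hq := young_nonneg (p := p) (show 0 ≤ |u y| / k by positivity)
  have h5 := le_one_add_young (p := p) hp (show 0 ≤ |u y| / k by positivity)
  rw [div_le_iff₀ hk] at h5
  rw [norm_mul, Real.norm_of_nonneg hK0, Real.norm_eq_abs]
  calc kernel β t (x - y) * |u y| ≤ kernel β t (x - y) * ((1 + young p (|u y| / k)) * k) := by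
        gcongr
    _ = k * (kernel β t (x - y) + kernel β t (x - y) * young p (|u y| / k)) := by ring
    _ ≤ _ := by
        simp only [Pi.add_apply]
        gcongr

/-- The difference is a convolution with a function of `L^1` norm at most `e/k`, which scales the
Luxemburg radius from `k` to `e`. -/
lemma eventually_expModular_semigroup_sub (hβ : 0 < β) (hβ2 : β < 2) (hp : 1 ≤ p)
    {u : EuclideanSpace ℝ (Fin n) → ℝ} (hu : Measurable u) {k : ℝ} (hk : 0 < k)
    (hmod : expModular p u k ≤ 1) {t₀ : ℝ} (ht₀ : 0 < t₀) {e : ℝ} (he : 0 < e) :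
    ∀ᶠ t in 𝓝 t₀, expModular p (fun x => semigroup β t₀ u x - semigroup β t u x) e ≤ 1 := by
  obtain ⟨ρ, hρ, hmodulus⟩ := exists_kernel_time_modulus (n := n) hβ hβ2 (e := e / k) (by positivity)
  have h1 : Tendsto (fun t => t / t₀ - 1) (𝓝 t₀) (𝓝 (t₀ / t₀ - 1)) :=
    (tendsto_id.div_const t₀).sub_const 1
  rw [div_self ht₀.ne', sub_self] at h1
  have h2 : ∀ᶠ t in 𝓝 t₀, |t / t₀ - 1| < ρ := by
    have := h1.eventually (Metric.ball_mem_nhds 0 hρ)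
    simpa [Real.dist_eq] using this
  filter_upwards [h2, lt_mem_nhds ht₀] with t ht htpos
  have h3 := (hmodulus t₀ t ht₀ htpos ht).1
  have hi := (integrable_kernel (n := n) hβ hβ2 ht₀).sub (integrable_kernel hβ hβ2 htpos)
  have h4 := expModular_conv_le hp (g := fun z => kernel β t₀ z - kernel β t z) (by fun_prop) hi
    (A := e / k) (by positivity) h3 hu hk
  rw [div_mul_cancel₀ _ hk.ne'] at h4
  refine le_trans (le_of_eq ?_) (h4.trans hmod)
  congr 1
  funext x
  have hfin := hmod.trans_lt ENNReal.one_lt_top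
  rw [semigroup, semigroup, ← integral_sub (integrable_kernel_mul hβ hβ2 hp hu hk hfin ht₀ x)
    (integrable_kernel_mul hβ hβ2 hp hu hk hfin htpos x)]
  exact integral_congr_ae (Eventually.of_forall fun y => by ring)

end LinearContinuity

/-! ### Continuity in time of the Duhamel term -/

section DuhamelContinuity

variable {n : ℕ} [NeZero n] {β κ γ : ℝ} {η : ℝ≥0∞} {H : ℝ → EuclideanSpace ℝ (Fin n) → ℝ≥0∞}

/-- Up to a time `a` before both `t` and `t'` the two kernels are compared; the stretches after `a`
are short and are estimated separately. -/
lemma SourceBound.enorm_duhamelInt_time_sub_le (h : SourceBound β κ γ η H) (hη : η ≠ ∞)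
    (hβ : 0 < β) (hβ2 : β < 2) (hκ : 0 ≤ κ) {F : ℝ → EuclideanSpace ℝ (Fin n) → ℝ}
    (hF : Measurable (Function.uncurry F)) (hFH : ∀ s, 0 < s → ∀ y, ‖F s y‖ₑ ≤ H s y)
    {a t t' : ℝ} (ha : 0 < a) (hat : a < t) (hat' : a < t') (x : EuclideanSpace ℝ (Fin n)) :
    ‖duhamelInt β F t x - duhamelInt β F t' x‖ₑ ≤
      (∫⁻ s in Set.Ioo 0 a, ∫⁻ y, ENNReal.ofReal |kernel β (t - s) (x - y) -
        kernel β (t' - s) (x - y)| * H s y) +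
      ((∫⁻ s in Set.Ioo a t, heatL β (t - s) (H s) x) +
        ∫⁻ s in Set.Ioo a t', heatL β (t' - s) (H s) x) := by
  have hFm : Measurable (fun z : ℝ × EuclideanSpace ℝ (Fin n) => F z.1 z.2) := hF
  have split : ∀ b, a < b →
      Integrable (fun z : ℝ × EuclideanSpace ℝ (Fin n) => kernel β (b - z.1) (x - z.2) * F z.1 z.2)
        ((volume.restrict (Set.Ioo 0 a)).prod volume) ∧
      ∃ R : ℝ, duhamelInt β F b x =
        (∫ z, kernel β (b - z.1) (x - z.2) * F z.1 z.2
          ∂((volume.restrict (Set.Ioo 0 a)).prod volume)) + R ∧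
        ‖R‖ₑ ≤ ∫⁻ s in Set.Ioo a b, heatL β (b - s) (H s) x := by
    intro b hab
    have hi := h.integrable_duhamel hη hβ hβ2 hκ hF hFH (ha.trans hab) x
    have hset : Set.Ioo 0 b = Set.Ioo 0 a ∪ Set.Ico a b :=
      (Set.Ioo_union_Ico_eq_Ioo ha hab.le).symm
    have hdis : Disjoint (Set.Ioo 0 a) (Set.Ico a b) :=
      Set.disjoint_left.2 fun s hs hs' => absurd hs.2 (not_lt.2 hs'.1)
    have hme : (volume.restrict (Set.Ioo 0 b)).prod (volume : Measure (EuclideanSpace ℝ (Fin n))) =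
        (volume.restrict (Set.Ioo 0 a)).prod volume +
          (volume.restrict (Set.Ico a b)).prod volume := by
      rw [hset, Measure.restrict_union hdis measurableSet_Ico, Measure.add_prod]
    rw [hme] at hi
    have hi1 := hi.left_of_add_measure
    have hi2 := hi.right_of_add_measure
    refine ⟨hi1, ∫ z, kernel β (b - z.1) (x - z.2) * F z.1 z.2
      ∂((volume.restrict (Set.Ico a b)).prod volume), ?_, ?_⟩
    · rw [duhamelInt, hme, integral_add_measure hi1 hi2]
    · refine (enorm_integral_le_lintegral_enorm _).trans ?_
      rw [restrict_Ico_eq_restrict_Ioc, ← restrict_Ioo_eq_restrict_Ioc,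
        lintegral_prod _ (Measurable.aemeasurable (by fun_prop))]
      refine setLIntegral_mono' measurableSet_Ioo fun s hs => lintegral_mono fun y => ?_
      rw [enorm_mul, Real.enorm_of_nonneg (kernel_nonneg hβ hβ2 (sub_pos.2 hs.2) _)]
      gcongr
      exact hFH s (ha.trans hs.1) y
  obtain ⟨hi, R, hR, hRb⟩ := split t hat
  obtain ⟨hi', R', hR', hRb'⟩ := split t' hat'
  rw [hR, hR', add_sub_add_comm, ← integral_sub hi hi']
  refine (enorm_add_le _ _).trans (add_le_add ?_ ?_)
  · refine (enorm_integral_le_lintegral_enorm _).trans ?_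
    rw [lintegral_prod _ (Measurable.aemeasurable (by fun_prop))]
    refine setLIntegral_mono' measurableSet_Ioo fun s hs => lintegral_mono fun y => ?_
    rw [← sub_mul, enorm_mul, Real.enorm_eq_ofReal_abs]
    gcongr
    exact hFH s hs.1 y
  · exact enorm_sub_le.trans (add_le_add hRb hRb')

/-- First `r` is chosen so that each stretch after `a = t₀ - r` contributes at most `e/4` in both
norms. Before `a` the kernels have age at least `r`, so `|t - t₀| < ρr` keeps the ratio of ages
within `ρ` of one and the kernel modulus applies. -/
lemma SourceBound.eventually_duhamelInt_sub (h : SourceBound β κ γ η H) (hη : η ≠ ∞)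
    (hβ : 0 < β) (hβ2 : β < 2) (hκ : 0 ≤ κ) (hγ : 0 < γ) (hγ1 : γ ≤ 1)
    {F : ℝ → EuclideanSpace ℝ (Fin n) → ℝ}
    (hF : Measurable (Function.uncurry F)) (hFH : ∀ s, 0 < s → ∀ y, ‖F s y‖ₑ ≤ H s y)
    {t₀ : ℝ} (ht₀ : 0 < t₀) {e : ℝ} (he : 0 < e) :
    ∀ᶠ t in 𝓝 t₀, (∀ x, |duhamelInt β F t₀ x - duhamelInt β F t x| ≤ e) ∧
      ∫⁻ x, ‖duhamelInt β F t₀ x - duhamelInt β F t x‖ₑ ≤ ENNReal.ofReal e := by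
  set N := η.toReal with hN
  have hN0 : 0 ≤ N := ENNReal.toReal_nonneg
  have hηN : η = ENNReal.ofReal N := (ENNReal.ofReal_toReal hη).symm
  obtain ⟨r, hr, hrt, hrN⟩ : ∃ r : ℝ, 0 < r ∧ r < t₀ ∧
      N * (2 * r + 2 * (2 * r) ^ (1 / 2 : ℝ)) ≤ e / 4 := by
    have hc : Continuous fun r : ℝ => N * (2 * r + 2 * (2 * r) ^ (1 / 2 : ℝ)) := by
      have : Continuous fun r : ℝ => (2 * r) ^ (1 / 2 : ℝ) :=
        (continuous_const.mul continuous_id).rpow_const fun _ => Or.inr (by norm_num)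
      fun_prop
    have h0 : Tendsto (fun r : ℝ => N * (2 * r + 2 * (2 * r) ^ (1 / 2 : ℝ))) (𝓝[>] 0) (𝓝 0) := by
      have := (hc.tendsto 0).mono_left (nhdsWithin_le_nhds (s := Set.Ioi 0))
      simpa [Real.zero_rpow] using this
    obtain ⟨r, hr⟩ := ((h0.eventually (gt_mem_nhds (show 0 < e / 4 by positivity))).and
      (Ioo_mem_nhdsGT ht₀)).exists
    exact ⟨r, hr.2.1, hr.2.2, hr.1.le⟩
  set a := t₀ - r with hadef
  have ha : 0 < a := by linarith
  set Z := N * ((1 + a) ^ γ / γ) with hZ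
  have hZ0 : 0 ≤ Z := by positivity
  -- `q` dominates `(t₀ - s)^{-n/β}` for `s < a`, needed in the uniform estimate, and also `1`,
  -- needed in the mass estimate; thus one `e'` serves both.
  set q := 1 + r ^ (-(n / β) : ℝ) with hq
  have hq1 : 1 ≤ q := by
    have : 0 ≤ r ^ (-(n / β) : ℝ) := by positivity
    linarith
  set e' := e / (2 * (Z + 1) * q) with he'
  have he'0 : 0 < e' := by positivity
  obtain ⟨ρ, hρ, hmodulus⟩ := exists_kernel_time_modulus (n := n) hβ hβ2 he'0
  have hev : ∀ᶠ t in 𝓝 t₀, |t - t₀| < min (r / 2) (ρ * r) := by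
    have := Metric.ball_mem_nhds t₀ (show 0 < min (r / 2) (ρ * r) by positivity)
    filter_upwards [this] with t ht
    rwa [Metric.mem_ball, Real.dist_eq] at ht
  filter_upwards [hev] with t ht
  have ht1 : |t - t₀| < r / 2 := ht.trans_le (min_le_left _ _)
  have ht2 : |t - t₀| < ρ * r := ht.trans_le (min_le_right _ _)
  rw [abs_lt] at ht1
  have hat : a < t := by rw [hadef]; linarith
  have hat₀ : a < t₀ := by rw [hadef]; linarith
  have hker : ∀ s ∈ Set.Ioo 0 a,
      (∫ x : EuclideanSpace ℝ (Fin n), |kernel β (t₀ - s) x - kernel β (t - s) x|) ≤ e' ∧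
      ∀ x : EuclideanSpace ℝ (Fin n), |kernel β (t₀ - s) x - kernel β (t - s) x| ≤
        e' * (t₀ - s) ^ (-(n / β) : ℝ) := by
    intro s hs
    have h1 : r < t₀ - s := by have := hs.2; rw [hadef] at this; linarith
    refine hmodulus (t₀ - s) (t - s) (by linarith) (by linarith [hs.2]) ?_
    have h2 : (t - s) / (t₀ - s) - 1 = (t - t₀) / (t₀ - s) := by
      have : t₀ - s ≠ 0 := by linarith
      field_simp
      ring
    rw [h2, abs_div, abs_of_pos (by linarith : 0 < t₀ - s), div_lt_iff₀ (by linarith)]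
    nlinarith
  have hrest : ∀ b, a < b → b - a ≤ 2 * r → ∀ x,
      ∫⁻ s in Set.Ioo a b, heatL β (b - s) (H s) x ≤ ENNReal.ofReal (e / 4) := by
    intro b hab hbr x
    refine (h.lintegral_heatL_le_sqrt hκ ha.le hab.le x).trans ?_
    rw [hηN, ← ENNReal.ofReal_mul hN0]
    refine ENNReal.ofReal_le_ofReal (le_trans ?_ hrN)
    have h1 : (1 + a) ^ (-κ - 1) ≤ 1 :=
      Real.rpow_le_one_of_one_le_of_nonpos (by linarith) (by linarith)
    have h2 : 0 ≤ b - a := by linarith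
    have h3 : (b - a) + 2 * (b - a) ^ (1 / 2 : ℝ) ≤ 2 * r + 2 * (2 * r) ^ (1 / 2 : ℝ) := by
      gcongr
    have h4 : 0 ≤ (b - a) + 2 * (b - a) ^ (1 / 2 : ℝ) := by positivity
    refine mul_le_mul_of_nonneg_left ?_ hN0
    exact (mul_le_of_le_one_left h4 h1).trans h3
  have hrest1 : ∀ b, a < b → b - a ≤ 2 * r →
      ∫⁻ s in Set.Ioo a b, ∫⁻ y, H s y ≤ ENNReal.ofReal (e / 4) := by
    intro b hab hbr
    refine (h.lintegral_mass_Ioo_le hγ1 ha.le).trans ?_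
    rw [hηN, ← ENNReal.ofReal_mul hN0]
    refine ENNReal.ofReal_le_ofReal (le_trans ?_ hrN)
    refine mul_le_mul_of_nonneg_left ?_ hN0
    have : 0 ≤ 2 * (2 * r) ^ (1 / 2 : ℝ) := by positivity
    linarith
  have hmassa : ∫⁻ s in Set.Ioo 0 a, ∫⁻ y, H s y ≤ ENNReal.ofReal Z := by
    refine (h.lintegral_mass_le hγ ha.le).trans ?_
    rw [hηN, ← ENNReal.ofReal_mul hN0]
  have hsplit : ENNReal.ofReal e = ENNReal.ofReal (e / 2) +
      (ENNReal.ofReal (e / 4) + ENNReal.ofReal (e / 4)) := by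
    rw [← ENNReal.ofReal_add (by positivity) (by positivity),
      ← ENNReal.ofReal_add (by positivity) (by positivity)]
    congr 1
    ring
  have hbound := fun x => h.enorm_duhamelInt_time_sub_le hη hβ hβ2 hκ hF hFH ha hat₀ hat x
  have hZe : ∀ c, c ≤ q → e' * c * Z ≤ e / 2 := by
    intro c hc
    have h1 : e' * (2 * (Z + 1) * q) = e := div_mul_cancel₀ _ (by positivity)
    have h2 : e' * c * Z ≤ e' * q * (Z + 1) := by
      gcongr
      linarith
    linarith
  constructor
  · intro x
    rw [← enorm_le_to_abs he.le]
    refine (hbound x).trans ?_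
    rw [hsplit]
    refine add_le_add ?_ (add_le_add (hrest t₀ hat₀ (by rw [hadef]; linarith) x)
      (hrest t hat (by rw [hadef]; linarith) x))
    calc ∫⁻ s in Set.Ioo 0 a, ∫⁻ y, ENNReal.ofReal |kernel β (t₀ - s) (x - y) -
          kernel β (t - s) (x - y)| * H s y
        ≤ ∫⁻ s in Set.Ioo 0 a, ENNReal.ofReal (e' * q) * ∫⁻ y, H s y := by
          refine setLIntegral_mono' measurableSet_Ioo fun s hs => ?_
          rw [← lintegral_const_mul' _ _ ENNReal.ofReal_ne_top]
          refine lintegral_mono fun y => ?_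
          gcongr
          refine ((hker s hs).2 (x - y)).trans ?_
          gcongr
          have h1 : r ≤ t₀ - s := by have := hs.2; rw [hadef] at this; linarith
          have h2 : (t₀ - s) ^ (-(n / β) : ℝ) ≤ r ^ (-(n / β) : ℝ) :=
            Real.rpow_le_rpow_of_nonpos hr h1 (neg_nonpos.2 (by positivity))
          linarith
      _ = ENNReal.ofReal (e' * q) * ∫⁻ s in Set.Ioo 0 a, ∫⁻ y, H s y :=
          lintegral_const_mul' _ _ ENNReal.ofReal_ne_top
      _ ≤ ENNReal.ofReal (e' * q) * ENNReal.ofReal Z := by gcongr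
      _ ≤ ENNReal.ofReal (e / 2) := by
          rw [← ENNReal.ofReal_mul (by positivity)]
          exact ENNReal.ofReal_le_ofReal (hZe q le_rfl)
  · refine (lintegral_mono hbound).trans ?_
    have hm1 : ∀ b, Measurable fun x : EuclideanSpace ℝ (Fin n) =>
        ∫⁻ s in Set.Ioo a b, heatL β (b - s) (H s) x := by
      intro b
      have := ((measurable_heatL_time (β := β) h.meas b).comp measurable_swap)
      exact this.lintegral_prod_right'
    have hm3 : Measurable fun x : EuclideanSpace ℝ (Fin n) =>
        (∫⁻ s in Set.Ioo a t₀, heatL β (t₀ - s) (H s) x) +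
          ∫⁻ s in Set.Ioo a t, heatL β (t - s) (H s) x := (hm1 t₀).add (hm1 t)
    rw [lintegral_add_right _ hm3, lintegral_add_left (hm1 t₀), hsplit,
      h.lintegral_lintegral_heatL hβ hβ2 le_rfl, h.lintegral_lintegral_heatL hβ hβ2 le_rfl]
    refine add_le_add ?_ (add_le_add (hrest1 t₀ hat₀ (by rw [hadef]; linarith))
      (hrest1 t hat (by rw [hadef]; linarith)))
    have hHm : Measurable (fun z : ℝ × EuclideanSpace ℝ (Fin n) => H z.1 z.2) := h.meas
    have hm2 : Measurable (Function.uncurry fun (x : EuclideanSpace ℝ (Fin n)) (s : ℝ) =>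
        ∫⁻ y, ENNReal.ofReal |kernel β (t₀ - s) (x - y) - kernel β (t - s) (x - y)| * H s y) := by
      have h1 : Measurable (fun w : (EuclideanSpace ℝ (Fin n) × ℝ) × EuclideanSpace ℝ (Fin n) =>
          ENNReal.ofReal |kernel β (t₀ - w.1.2) (w.1.1 - w.2) - kernel β (t - w.1.2) (w.1.1 - w.2)| *
            H w.1.2 w.2) := by
        have h2 : Measurable (fun w : (EuclideanSpace ℝ (Fin n) × ℝ) ×
          EuclideanSpace ℝ (Fin n) => H w.1.2 w.2) := by
          have h3 : Measurable (fun w : (EuclideanSpace ℝ (Fin n) × ℝ) ×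
            EuclideanSpace ℝ (Fin n) => (w.1.2, w.2)) := by fun_prop
          exact hHm.comp h3
        have h3 : Measurable (fun w : (EuclideanSpace ℝ (Fin n) × ℝ) ×
          EuclideanSpace ℝ (Fin n) => |kernel β (t₀ - w.1.2) (w.1.1 - w.2) -
            kernel β (t - w.1.2) (w.1.1 - w.2)|) := by
          have h4 : Measurable (fun w : (EuclideanSpace ℝ (Fin n) × ℝ) ×
            EuclideanSpace ℝ (Fin n) => kernel β (t₀ - w.1.2) (w.1.1 - w.2)) := by fun_prop
          have h5 : Measurable (fun w : (EuclideanSpace ℝ (Fin n) × ℝ) ×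
            EuclideanSpace ℝ (Fin n) => kernel β (t - w.1.2) (w.1.1 - w.2)) := by fun_prop
          exact (h4.sub h5).abs
        exact h3.ennreal_ofReal.mul h2
      exact h1.lintegral_prod_right'
    rw [lintegral_lintegral_swap hm2.aemeasurable]
    calc ∫⁻ s in Set.Ioo 0 a, ∫⁻ x, ∫⁻ y, ENNReal.ofReal |kernel β (t₀ - s) (x - y) -
          kernel β (t - s) (x - y)| * H s y
        ≤ ∫⁻ s in Set.Ioo 0 a, ENNReal.ofReal e' * ∫⁻ y, H s y := by
          refine setLIntegral_mono' measurableSet_Ioo fun s hs => ?_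
          have hHs := h.measurable_slice s
          have hi : Integrable (fun z : EuclideanSpace ℝ (Fin n) =>
              |kernel β (t₀ - s) z - kernel β (t - s) z|) :=
            ((integrable_kernel hβ hβ2 (by linarith [hs.2])).sub
              (integrable_kernel hβ hβ2 (by linarith [hs.2]))).abs
          rw [lintegral_lintegral_swap (Measurable.aemeasurable (by fun_prop)),
            ← lintegral_const_mul' _ _ ENNReal.ofReal_ne_top]
          refine lintegral_mono fun y => ?_
          rw [lintegral_mul_const _ (by fun_prop), lintegral_sub_right_eq_self
            (fun z => ENNReal.ofReal |kernel β (t₀ - s) z - kernel β (t - s) z|) y,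
            ← ofReal_integral_eq_lintegral_ofReal hi (Eventually.of_forall fun z => abs_nonneg _)]
          gcongr
          exact (hker s hs).1
      _ = ENNReal.ofReal e' * ∫⁻ s in Set.Ioo 0 a, ∫⁻ y, H s y :=
          lintegral_const_mul' _ _ ENNReal.ofReal_ne_top
      _ ≤ ENNReal.ofReal e' * ENNReal.ofReal Z := by gcongr
      _ ≤ ENNReal.ofReal (e / 2) := by
          rw [← ENNReal.ofReal_mul he'0.le]
          refine ENNReal.ofReal_le_ofReal ?_
          have := hZe 1 hq1
          rwa [mul_one] at this

end DuhamelContinuity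

/-! ### Decay in `L^q` -/

section Decay

variable {n : ℕ} {p κ : ℝ}

/-- For `t ≥ 1` interpolate: `|g|^q ≤ (b t^{-κ})^{q-p} |g|^p` with `L^p` norm bounded, and `σq ≤
κ(q-p)` says that the resulting rate is sufficient. For `t ≤ 1` the embedding into `L^q` suffices,
as `t^{-σ} ≥ 1`. -/
lemma exists_eLpNorm_decay (n : ℕ) (hp : 0 < p) {q σ k b : ℝ} (hpq : p < q) (hσ : 0 ≤ σ)
    (hσq : σ * q ≤ κ * (q - p)) (hk : 0 < k) (hb : 0 < b) :
    ∃ K : ℝ, 0 < K ∧ ∀ g : ℝ → EuclideanSpace ℝ (Fin n) → ℝ,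
      (∀ t, 0 < t → expModular p (g t) k ≤ 1) → (∀ t, 0 < t → ∀ x, |g t x| ≤ b * t ^ (-κ)) →
      ∀ t, 0 < t → eLpNorm (g t) (ENNReal.ofReal q) volume ≤ ENNReal.ofReal (K * t ^ (-σ)) := by
  obtain ⟨c, hc, hcb⟩ := exists_lintegral_rpow_le_expModular n hp (le_refl p)
  obtain ⟨c', hc', hcb'⟩ := exists_lintegral_rpow_le_expModular n hp hpq.le
  have hq : 0 < q := hp.trans hpq
  set M := c' * k ^ q + b ^ (q - p) * (c * k ^ p) with hM
  have hM0 : 0 < M := by positivity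
  refine ⟨M ^ (1 / q), by positivity, fun g hmod hsup t ht => ?_⟩
  have key : ∫⁻ x, ENNReal.ofReal (|g t x| ^ q) ≤ ENNReal.ofReal (M * t ^ (-(σ * q))) := by
    rcases le_total t 1 with ht1 | ht1
    · refine (hcb' (g t) k hk).trans ((mul_le_of_le_one_right' (hmod t ht)).trans ?_)
      refine ENNReal.ofReal_le_ofReal ?_
      have h1 : 1 ≤ t ^ (-(σ * q)) :=
        Real.one_le_rpow_of_pos_of_le_one_of_nonpos ht ht1 (neg_nonpos.2 (by positivity))
      have h2 : c' * k ^ q ≤ M := by rw [hM]; exact le_add_of_nonneg_right (by positivity)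
      exact h2.trans (le_mul_of_one_le_right hM0.le h1)
    · calc ∫⁻ x, ENNReal.ofReal (|g t x| ^ q)
          ≤ ∫⁻ x, ENNReal.ofReal ((b * t ^ (-κ)) ^ (q - p)) * ENNReal.ofReal (|g t x| ^ p) := by
            refine lintegral_mono fun x => ?_
            rw [← ENNReal.ofReal_mul (by positivity)]
            refine ENNReal.ofReal_le_ofReal ?_
            have h1 : |g t x| ^ q = |g t x| ^ (q - p) * |g t x| ^ p := by
              rw [← Real.rpow_add_of_nonneg (abs_nonneg _) (by linarith) hp.le]
              congr 1
              ring
            rw [h1]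
            exact mul_le_mul_of_nonneg_right (Real.rpow_le_rpow (abs_nonneg _) (hsup t ht x)
              (by linarith)) (by positivity)
        _ = ENNReal.ofReal ((b * t ^ (-κ)) ^ (q - p)) * ∫⁻ x, ENNReal.ofReal (|g t x| ^ p) :=
            lintegral_const_mul' _ _ ENNReal.ofReal_ne_top
        _ ≤ ENNReal.ofReal ((b * t ^ (-κ)) ^ (q - p)) * ENNReal.ofReal (c * k ^ p) :=
            mul_le_mul_right ((hcb (g t) k hk).trans (mul_le_of_le_one_right' (hmod t ht))) _
        _ ≤ _ := by
            rw [← ENNReal.ofReal_mul (by positivity)]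
            refine ENNReal.ofReal_le_ofReal ?_
            rw [Real.mul_rpow hb.le (by positivity), ← Real.rpow_mul ht.le]
            have h1 : t ^ (-κ * (q - p)) ≤ t ^ (-(σ * q)) :=
              Real.rpow_le_rpow_of_exponent_le ht1 (by linarith)
            have h2 : b ^ (q - p) * (c * k ^ p) ≤ M := by
              rw [hM]; exact le_add_of_nonneg_left (by positivity)
            calc b ^ (q - p) * t ^ (-κ * (q - p)) * (c * k ^ p)
                = b ^ (q - p) * (c * k ^ p) * t ^ (-κ * (q - p)) := by ring
              _ ≤ M * t ^ (-(σ * q)) := mul_le_mul h2 h1 (by positivity) hM0.le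
  rw [eLpNorm_eq_lintegral_rpow_enorm_toReal (by simpa using hq) ENNReal.ofReal_ne_top,
    ENNReal.toReal_ofReal hq.le]
  have h1 : ∀ x, ‖g t x‖ₑ ^ q = ENNReal.ofReal (|g t x| ^ q) := fun x => by
    rw [Real.enorm_eq_ofReal_abs, ENNReal.ofReal_rpow_of_nonneg (abs_nonneg _) hq.le]
  simp_rw [h1]
  refine (ENNReal.rpow_le_rpow key (by positivity)).trans (le_of_eq ?_)
  rw [ENNReal.ofReal_rpow_of_nonneg (by positivity) (by positivity),
    Real.mul_rpow hM0.le (by positivity), ← Real.rpow_mul ht.le]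
  congr 3
  field_simp

/-- In the last case, `β > n(p-1)/p` is what puts `(m-1)p/(p-1)` above `n(m-1)/β`. -/
lemma DecayRange.lt {β m q : ℝ} (hβ : 0 < β) (hp : 1 < p) (hm : 1 < m)
    (h : DecayRange n β p m q) : n * (m - 1) / β < q := by
  rcases h with h | h | h
  · exact h.2.1
  · exact h.2.1
  · refine lt_of_le_of_lt ?_ h.2.1
    have h1 := h.1.1
    rw [div_lt_iff₀ (by linarith)] at h1
    rw [div_le_div_iff₀ hβ (by linarith)]
    nlinarith

lemma decayExponent_pos {β m q : ℝ} (hβ : 0 < β) (hm : 1 < m) (hq : 0 < q)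
    (h : n * (m - 1) / β < q) : 0 < decayExponent n β m q := by
  rw [decayExponent, sub_pos, div_lt_div_iff₀ (by positivity) (by linarith)]
  rw [div_lt_iff₀ hβ] at h
  linarith

end Decay

/-! ### Properties of the Duhamel part and of the sum `U + w` -/

namespace DuhamelPart

variable {n : ℕ} {β p κ γ k B : ℝ} {f : ℝ → ℝ} {u₀ : EuclideanSpace ℝ (Fin n) → ℝ}
  {w : ℝ → EuclideanSpace ℝ (Fin n) → ℝ}

lemma measurable_slice (h : DuhamelPart β p κ γ k B f u₀ w) (t : ℝ) : Measurable (w t) :=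
  h.meas.comp measurable_prodMk_left

lemma abs_le (h : DuhamelPart β p κ γ k B f u₀ w) (hk : 0 < k) {t : ℝ} (ht : 0 < t)
    (x : EuclideanSpace ℝ (Fin n)) : |w t x| ≤ k * (1 + t) ^ (-κ) := by
  rw [← enorm_le_to_abs (by positivity)]
  simpa using h.close.sup t ht x

lemma abs_le_const (h : DuhamelPart β p κ γ k B f u₀ w) (hk : 0 < k) (hκ : 0 ≤ κ) {t : ℝ}
    (ht : 0 < t) (x : EuclideanSpace ℝ (Fin n)) : |w t x| ≤ k :=
  (h.abs_le hk ht x).trans (mul_le_of_le_one_right hk.le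
    (Real.rpow_le_one_of_one_le_of_nonpos (by linarith) (by linarith)))

/-- Interpolating the uniform and mass bounds, the weights cancel because `κ(p-1) = γ`; hence the
bound is uniform in time. -/
lemma modular (h : DuhamelPart β p κ γ k B f u₀ w) (hk : 0 < k) (hκ : 0 ≤ κ) (hp : 1 ≤ p)
    (hγ : γ = κ * (p - 1)) {t : ℝ} (ht : 0 < t) : expModular p (w t) (2 * k) ≤ 1 := by
  refine expModular_two_mul_le_one hp hk (h.abs_le_const hk hκ ht) ?_
  have hmass : ∫⁻ x, ‖w t x‖ₑ ≤ ENNReal.ofReal (k * (1 + t) ^ γ) := by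
    simpa using h.close.mass t ht
  refine (lintegral_rpow_le_of_sup hp (by positivity) (h.abs_le hk ht) hmass).trans
    (le_of_eq ?_)
  congr 1
  have h1t : 0 < 1 + t := by linarith
  rw [Real.mul_rpow hk.le (by positivity), ← Real.rpow_mul h1t.le, hγ]
  have h1 : (1 + t) ^ (-κ * (p - 1)) * (1 + t) ^ (κ * (p - 1)) = 1 := by
    rw [← Real.rpow_add h1t, neg_mul, neg_add_cancel, Real.rpow_zero]
  have h2 : k ^ (p - 1) * k = k ^ p := by
    rw [← Real.rpow_add_one hk.ne', sub_add_cancel]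
  linear_combination (k ^ (p - 1) * k) * h1 + h2

lemma measurable_source (h : DuhamelPart β p κ γ k B f u₀ w) (hf : Measurable f)
    (hu : Measurable u₀) :
    Measurable (Function.uncurry fun s y => f (semigroup β s u₀ y + w s y)) := by
  have h1 := (measurable_semigroup (β := β) hu).add h.meas
  exact hf.comp h1

variable [NeZero n]

lemma modular_add (h : DuhamelPart β p κ γ k B f u₀ w) (hβ : 0 < β) (hβ2 : β < 2) (hk : 0 < k)
    (hκ : 0 ≤ κ) (hp : 1 ≤ p) (hγ : γ = κ * (p - 1)) (hu : Measurable u₀)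
    (hmod : expModular p u₀ k ≤ 1) {t : ℝ} (ht : 0 < t) :
    expModular p (fun x => semigroup β t u₀ x + w t x) (k + 2 * k) ≤ 1 :=
  expModular_add_le hp ((measurable_semigroup hu).comp measurable_prodMk_left) hk (by positivity)
    ((expModular_semigroup_le hβ hβ2 hp ht hu hk).trans hmod) (h.modular hk hκ hp hγ ht)

lemma abs_add_le (h : DuhamelPart β p κ γ k B f u₀ w) (hβ : 0 < β) (hβ2 : β < 2) (hk : 0 < k)
    (hκ : 0 ≤ κ) {t : ℝ} (ht : 0 < t) (x : EuclideanSpace ℝ (Fin n)) :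
    |semigroup β t u₀ x + w t x| ≤ (B + 1) * k * t ^ (-κ) := by
  have h1 := (abs_semigroup_le hβ hβ2 ht u₀ x).trans (h.lin.sup t ht x)
  have h2 : (1 + t) ^ (-κ) ≤ t ^ (-κ) :=
    Real.rpow_le_rpow_of_nonpos ht (by linarith) (by linarith)
  have h3 := h.abs_le hk ht x
  have h4 := mul_le_mul_of_nonneg_left h2 hk.le
  have h5 := _root_.abs_add_le (semigroup β t u₀ x) (w t x)
  linarith

/-- The time integrals of the source over `(0, t)` vanish with `t`: uniformly because `τ^{-1/2}` is
integrable, in mass because `γ ≤ 1` bounds `(1+s)^{γ-1}` by one. -/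
lemma eventually_small (h : DuhamelPart β p κ γ k B f u₀ w) (hβ : 0 < β) (hβ2 : β < 2)
    (hκ : 0 ≤ κ) (hγ1 : γ ≤ 1) (hf : Measurable f) (hu : Measurable u₀) {e : ℝ} (he : 0 < e) :
    ∀ᶠ t in 𝓝[>] 0, (∀ x, |w t x| ≤ e) ∧ ∫⁻ x, ‖w t x‖ₑ ≤ ENNReal.ofReal e := by
  obtain ⟨η, H, hη, hS, hFH⟩ := h.source
  set N := η.toReal with hN
  have hN0 : 0 ≤ N := ENNReal.toReal_nonneg
  have hηN : η = ENNReal.ofReal N := (ENNReal.ofReal_toReal hη).symm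
  have h0 : Tendsto (fun r : ℝ => N * (r + 2 * r ^ (1 / 2 : ℝ))) (𝓝[>] 0) (𝓝 0) := by
    have hc : Continuous fun r : ℝ => N * (r + 2 * r ^ (1 / 2 : ℝ)) := by
      have : Continuous fun r : ℝ => r ^ (1 / 2 : ℝ) :=
        continuous_id.rpow_const fun _ => Or.inr (by norm_num)
      fun_prop
    have := (hc.tendsto 0).mono_left (nhdsWithin_le_nhds (s := Set.Ioi 0))
    simpa [Real.zero_rpow] using this
  filter_upwards [h0.eventually (gt_mem_nhds he), self_mem_nhdsWithin] with t hte ht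
  have ht : 0 < t := ht
  have hw : ∀ x, ‖w t x‖ₑ ≤ ∫⁻ s in Set.Ioo 0 t, heatL β (t - s) (H s) x := fun x => by
    rw [h.eq t ht x]
    exact (enorm_integral_le_lintegral_enorm _).trans
      (lintegral_enorm_duhamel_integrand_le hβ hβ2 (h.measurable_source hf hu) hFH t x)
  constructor
  · intro x
    rw [← enorm_le_to_abs he.le]
    refine (hw x).trans ((hS.lintegral_heatL_le_sqrt hκ le_rfl ht.le x).trans ?_)
    rw [hηN, ← ENNReal.ofReal_mul hN0]
    refine ENNReal.ofReal_le_ofReal (le_trans (le_of_eq ?_) hte.le)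
    simp
  · refine (lintegral_mono hw).trans ?_
    rw [hS.lintegral_lintegral_heatL hβ hβ2 le_rfl]
    refine (hS.lintegral_mass_Ioo_le hγ1 le_rfl).trans ?_
    rw [hηN, ← ENNReal.ofReal_mul hN0]
    refine ENNReal.ofReal_le_ofReal (le_trans ?_ hte.le)
    have : 0 ≤ t ^ (1 / 2 : ℝ) := by positivity
    exact mul_le_mul_of_nonneg_left (by linarith) hN0

lemma eventually_modular_sub (h : DuhamelPart β p κ γ k B f u₀ w) (hβ : 0 < β) (hβ2 : β < 2)
    (hk : 0 < k) (hκ : 0 ≤ κ) (hp : 1 ≤ p) (hγ : 0 < γ) (hγ1 : γ ≤ 1) (hf : Measurable f)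
    (hu : Measurable u₀) (hmod : expModular p u₀ k ≤ 1) {t₀ : ℝ} (ht₀ : 0 < t₀) {e : ℝ}
    (he : 0 < e) :
    ∀ᶠ t in 𝓝 t₀, expModular p (fun x => (semigroup β t₀ u₀ x + w t₀ x) -
      (semigroup β t u₀ x + w t x)) e ≤ 1 := by
  obtain ⟨η, H, hη, hS, hFH⟩ := h.source
  have hs := fun t => (measurable_semigroup (β := β) hu).comp (measurable_prodMk_left (x := t))
  filter_upwards [lt_mem_nhds ht₀, eventually_expModular_semigroup_sub hβ hβ2 hp hu hk hmod ht₀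
    (show 0 < e / 2 by positivity), hS.eventually_duhamelInt_sub hη hβ hβ2 hκ hγ hγ1
      (h.measurable_source hf hu) hFH ht₀ (show 0 < e / 4 by positivity)] with t ht h1 h2
  simp_rw [← h.eq t₀ ht₀, ← h.eq t ht] at h2
  have h3 := expModular_le_one_of_small hp (show 0 < e / 4 by positivity) h2.1 h2.2
  have h4 := expModular_add_le hp ((hs t₀).sub (hs t)) (by positivity) (by positivity) h1 h3
  have h5 : e / 2 + 2 * (e / 4) = e := by ring
  rw [h5] at h4
  refine le_trans (le_of_eq ?_) h4
  congr 1
  funext x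
  simp only [Pi.sub_apply, Function.comp_apply, Function.uncurry_apply_pair]
  ring

/-- Strong measurability follows from norm continuity on `(0, ∞)`: evaluate the solution along
simple functions that approximate the identity and take positive values. -/
lemma memLInftyExpL (h : DuhamelPart β p κ γ k B f u₀ w) (hβ : 0 < β) (hβ2 : β < 2)
    (hk : 0 < k) (hκ : 0 ≤ κ) (hp : 1 ≤ p) (hγ : γ = κ * (p - 1)) (hγ0 : 0 < γ) (hγ1 : γ ≤ 1)
    (hf : Measurable f) (hu : Measurable u₀) (hmod : expModular p u₀ k ≤ 1) :
    MemLInftyExpL p (fun t x => semigroup β t u₀ x + w t x) := by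
  have hmem : ∀ t, 0 < t → MemExpL p (fun x => semigroup β t u₀ x + w t x) := fun t ht =>
    memExpL_of_modular_le hp (((measurable_semigroup hu).comp measurable_prodMk_left).add
      (h.measurable_slice t)) (by positivity) (h.modular_add hβ hβ2 hk hκ hp hγ hu hmod ht)
  have h1 : (1 : ℝ) ∈ Set.Ioi (0 : ℝ) := Set.mem_Ioi.2 one_pos
  refine ⟨hmem, ⟨fun i => (SimpleFunc.approxOn id measurable_id (Set.Ioi (0 : ℝ)) 1 h1 i).map
    fun t x => semigroup β t u₀ x + w t x, fun i t => ?_, ?_⟩, ?_⟩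
  · rw [SimpleFunc.map_apply]
    exact hmem _ (SimpleFunc.approxOn_mem measurable_id h1 i t)
  · refine (ae_restrict_iff' measurableSet_Ioi).2 (Eventually.of_forall fun t ht => ?_)
    have hlim : Tendsto (fun i => SimpleFunc.approxOn id measurable_id (Set.Ioi (0 : ℝ)) 1 h1 i t)
        atTop (𝓝 t) := SimpleFunc.tendsto_approxOn measurable_id h1 (subset_closure ht)
    refine tendsto_expLNorm_zero fun e he => ?_
    exact hlim.eventually (h.eventually_modular_sub hβ hβ2 hk hκ hp hγ0 hγ1 hf hu hmod ht he)
  · refine ⟨(k + 2 * k).toNNReal, (ae_restrict_iff' measurableSet_Ioi).2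
      (Eventually.of_forall fun t ht => ?_)⟩
    exact expLNorm_le (by positivity) (h.modular_add hβ hβ2 hk hκ hp hγ hu hmod ht)

end DuhamelPart

/-! ### Initial trace: a Young inequality with small constant -/

/-- Compare `a` with `(2 log(2+b))^{1/p}`. If `a` is larger, then `b ≤ e^{a^p/2}`, and in `a =
a^{-(p-1)} a^p` the first factor is at most `(2 log(2+N))^{-(p-1)/p}`. It vanishes as `N → ∞`, which
makes the Young term negligible although its integral is merely bounded. -/
lemma exists_mul_le_log_add_young {p : ℝ} (hp : 1 < p) :
    ∃ c : ℝ, 0 < c ∧ ∀ N a b : ℝ, 0 ≤ N → 0 ≤ a → N ≤ b →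
      a * b ≤ 2 ^ (1 / p) * (b * Real.log (2 + b) ^ (1 / p)) +
        c * (2 * Real.log (2 + N)) ^ (-((p - 1) / p)) * young p a := by
  obtain ⟨c, hc, hcb⟩ := exists_rpow_mul_exp_le_young (p := p) (by linarith) le_rfl
  refine ⟨c, hc, fun N a b hN ha hb => ?_⟩
  have hb0 : 0 ≤ b := hN.trans hb
  have hlogN : 0 < Real.log (2 + N) := Real.log_pos (by linarith)
  have hlog : 0 < Real.log (2 + b) := Real.log_pos (by linarith)
  have hy := young_nonneg (p := p) ha
  rcases le_or_gt a ((2 * Real.log (2 + b)) ^ (1 / p)) with h | h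
  · rw [Real.mul_rpow (by norm_num) hlog.le] at h
    have h1 : a * b ≤ 2 ^ (1 / p) * (b * Real.log (2 + b) ^ (1 / p)) :=
      (mul_le_mul_of_nonneg_right h hb0).trans (le_of_eq (by ring))
    have h2 : 0 ≤ c * (2 * Real.log (2 + N)) ^ (-((p - 1) / p)) * young p a := by positivity
    linarith
  · have hp0 : 0 < p := by linarith
    have ha0 : 0 < a := lt_of_le_of_lt (by positivity) h
    have h1 : 2 * Real.log (2 + b) ≤ a ^ p := by
      have := Real.rpow_le_rpow (by positivity) h.le hp0.le
      rwa [← Real.rpow_mul (by positivity), one_div_mul_cancel hp0.ne', Real.rpow_one] at this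
    have h2 : b ≤ Real.exp (1 / 2 * a ^ p) := by
      have : 2 + b ≤ Real.exp (1 / 2 * a ^ p) := by
        rw [← Real.log_le_iff_le_exp (by linarith)]
        linarith
      linarith
    have h3 : 2 * Real.log (2 + N) ≤ a ^ p := by
      refine le_trans ?_ h1
      have : Real.log (2 + N) ≤ Real.log (2 + b) := Real.log_le_log (by linarith) (by linarith)
      linarith
    have h4 : a ^ (-(p - 1)) ≤ (2 * Real.log (2 + N)) ^ (-((p - 1) / p)) := by
      have : a ^ (-(p - 1)) = (a ^ p) ^ (-((p - 1) / p)) := by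
        rw [← Real.rpow_mul ha]
        congr 1
        field_simp
      rw [this]
      refine Real.rpow_le_rpow_of_nonpos (by positivity) h3 (neg_nonpos.2 ?_)
      exact div_nonneg (by linarith) hp0.le
    have h5 : a = a ^ (-(p - 1)) * a ^ p := by
      rw [← Real.rpow_add ha0]
      conv_lhs => rw [← Real.rpow_one a]
      congr 1
      ring
    calc a * b = a ^ (-(p - 1)) * (a ^ p * b) := by rw [← mul_assoc, ← h5]
      _ ≤ (2 * Real.log (2 + N)) ^ (-((p - 1) / p)) * (a ^ p * Real.exp (1 / 2 * a ^ p)) := by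
          gcongr
      _ ≤ (2 * Real.log (2 + N)) ^ (-((p - 1) / p)) * (c * young p a) := by
          exact mul_le_mul_of_nonneg_left (hcb (1 / 2) a le_rfl ha) (by positivity)
      _ = c * (2 * Real.log (2 + N)) ^ (-((p - 1) / p)) * young p a := by ring
      _ ≤ _ := le_add_of_nonneg_left (by positivity)

lemma tendsto_log_tail {p : ℝ} (hp : 1 < p) :
    Tendsto (fun N : ℕ => (2 * Real.log (2 + (N : ℝ))) ^ (-((p - 1) / p))) atTop (𝓝 0) := by
  have h1 : Tendsto (fun N : ℕ => 2 * Real.log (2 + (N : ℝ))) atTop atTop :=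
    (Real.tendsto_log_atTop.comp
      (tendsto_atTop_add_const_left _ 2 tendsto_natCast_atTop_atTop)).const_mul_atTop two_pos
  have h2 : 0 < (p - 1) / p := div_pos (by linarith) (by linarith)
  exact (tendsto_rpow_neg_atTop h2).comp h1

lemma tendsto_lintegral_tail {X : Type*} [MeasurableSpace X] {μ : Measure X} {φ : X → ℝ}
    (hφ : Measurable φ) {G : X → ℝ≥0∞} (hG : Measurable G) (hfin : ∫⁻ x, G x ∂μ ≠ ∞) :
    Tendsto (fun N : ℕ => ∫⁻ x in {x | (N : ℝ) < |φ x|}, G x ∂μ) atTop (𝓝 0) := by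
  have hs : ∀ N : ℕ, MeasurableSet {x | (N : ℝ) < |φ x|} := fun N =>
    measurableSet_lt measurable_const hφ.abs
  have h1 : Tendsto (fun N : ℕ => ∫⁻ x, {x | (N : ℝ) < |φ x|}.indicator G x ∂μ) atTop
      (𝓝 (∫⁻ _, 0 ∂μ)) := by
    refine tendsto_lintegral_of_dominated_convergence G (fun N => hG.indicator (hs N))
      (fun N => Eventually.of_forall fun x => Set.indicator_le_self _ _ _) hfin
      (Eventually.of_forall fun x => ?_)
    obtain ⟨M, hM⟩ := exists_nat_ge |φ x|
    refine tendsto_const_nhds.congr' ?_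
    filter_upwards [eventually_ge_atTop M] with N hN
    rw [Set.indicator_of_notMem]
    have : (M : ℝ) ≤ N := by exact_mod_cast hN
    simp only [Set.mem_ofPred_eq, not_lt]
    linarith
  simpa [lintegral_indicator, hs] using h1

/-! ### Initial trace: bounded continuous data -/

section InitialTrace

variable {n : ℕ} [NeZero n] {β p : ℝ}

lemma lintegral_enorm_semigroup_rpow_le (hβ : 0 < β) (hβ2 : β < 2) (hp : 1 < p) {t : ℝ}
    (ht : 0 < t) {u : EuclideanSpace ℝ (Fin n) → ℝ} (hu : Measurable u) :
    ∫⁻ x, ‖semigroup β t u x‖ₑ ^ p ≤ ∫⁻ x, ‖u x‖ₑ ^ p := by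
  have hp0 : 0 < p := by linarith
  rw [← lintegral_heatL hβ hβ2 ht (hu.enorm.pow_const p)]
  refine lintegral_mono fun x => ?_
  refine (ENNReal.rpow_le_rpow ((enorm_semigroup_le hβ hβ2 ht u x).trans
    (heatL_le_rpow hβ hβ2 ht hp hu.enorm x)) hp0.le).trans (le_of_eq ?_)
  rw [← ENNReal.rpow_mul, one_div_mul_cancel hp0.ne', ENNReal.rpow_one]

lemma semigroup_eq_integral_kernel_one (hβ : 0 < β) {t : ℝ} (ht : 0 < t)
    (h : EuclideanSpace ℝ (Fin n) → ℝ) (x : EuclideanSpace ℝ (Fin n)) :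
    semigroup β t h x = ∫ z, kernel β 1 z * h (x - t ^ (1 / β) • z) := by
  rw [← integral_kernel_mul_comp hβ ht (fun z => h (x - z)), semigroup,
    ← integral_sub_left_eq_self _ volume x]
  simp

lemma abs_semigroup_le_of_bound (hβ : 0 < β) (hβ2 : β < 2) {t : ℝ} (ht : 0 < t)
    {h : EuclideanSpace ℝ (Fin n) → ℝ} {M : ℝ} (hM : ∀ x, |h x| ≤ M)
    (x : EuclideanSpace ℝ (Fin n)) : |semigroup β t h x| ≤ M := by
  rw [← enorm_le_to_abs ((abs_nonneg _).trans (hM 0))]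
  refine (enorm_semigroup_le hβ hβ2 ht h x).trans (heatL_le_const hβ hβ2 ht (fun y => ?_) x)
  rw [enorm_le_to_abs ((abs_nonneg _).trans (hM 0))]
  exact hM y

lemma tendsto_semigroup_apply (hβ : 0 < β) (hβ2 : β < 2) {h : EuclideanSpace ℝ (Fin n) → ℝ}
    (hc : Continuous h) {M : ℝ} (hM : ∀ x, |h x| ≤ M) (x : EuclideanSpace ℝ (Fin n)) :
    Tendsto (fun t => semigroup β t h x) (𝓝[>] 0) (𝓝 (h x)) := by
  have h1 : Tendsto (fun t : ℝ => ∫ z, kernel β 1 z * h (x - t ^ (1 / β) • z)) (𝓝[>] 0)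
      (𝓝 (∫ z : EuclideanSpace ℝ (Fin n), kernel β 1 z * h x)) := by
    refine tendsto_integral_filter_of_dominated_convergence (fun z => kernel β 1 z * M) ?_ ?_
      ((integrable_kernel hβ hβ2 one_pos).mul_const M) ?_
    · refine Eventually.of_forall fun t => Measurable.aestronglyMeasurable ?_
      have := hc.measurable
      fun_prop
    · refine Eventually.of_forall fun t => Eventually.of_forall fun z => ?_
      have := kernel_nonneg hβ hβ2 one_pos z
      rw [norm_mul, Real.norm_of_nonneg this]
      exact mul_le_mul_of_nonneg_left (hM _) this
    · refine Eventually.of_forall fun z => Tendsto.const_mul _ ?_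
      have h2 : Continuous fun t : ℝ => h (x - t ^ (1 / β) • z) := by
        have : Continuous fun t : ℝ => t ^ (1 / β) :=
          continuous_id.rpow_const fun _ => Or.inr (by positivity)
        fun_prop
      have h3 := (h2.tendsto 0).mono_left (nhdsWithin_le_nhds (s := Set.Ioi 0))
      rwa [Real.zero_rpow (by positivity), zero_smul, sub_zero] at h3
  rw [integral_mul_const, integral_kernel hβ hβ2 one_pos, one_mul] at h1
  refine h1.congr' ?_
  filter_upwards [self_mem_nhdsWithin] with t ht
  exact (semigroup_eq_integral_kernel_one hβ ht h x).symm

lemma tendsto_lintegral_semigroup_sub_mul_of_bound (hβ : 0 < β) (hβ2 : β < 2)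
    {h φ : EuclideanSpace ℝ (Fin n) → ℝ} (hc : Continuous h) {M : ℝ} (hM : ∀ x, |h x| ≤ M)
    (hφ : Measurable φ) (hφi : ∫⁻ x, ‖φ x‖ₑ ≠ ∞) :
    Tendsto (fun t => ∫⁻ x, ‖(semigroup β t h x - h x) * φ x‖ₑ) (𝓝[>] 0) (𝓝 0) := by
  have hM0 : 0 ≤ M := (abs_nonneg _).trans (hM 0)
  have hm := fun t => (measurable_semigroup (β := β) hc.measurable).comp
    (measurable_prodMk_left (x := t))
  have h1 : Tendsto (fun t => ∫⁻ x, ‖(semigroup β t h x - h x) * φ x‖ₑ) (𝓝[>] 0)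
      (𝓝 (∫⁻ _ : EuclideanSpace ℝ (Fin n), 0)) := by
    refine tendsto_lintegral_filter_of_dominated_convergence
      (fun x => ENNReal.ofReal (2 * M) * ‖φ x‖ₑ) ?_ ?_ ?_ ?_
    · refine Eventually.of_forall fun t => ?_
      exact (((hm t).sub hc.measurable).mul hφ).enorm
    · filter_upwards [self_mem_nhdsWithin] with t ht
      refine Eventually.of_forall fun x => ?_
      rw [enorm_mul]
      gcongr
      rw [enorm_le_to_abs (by positivity)]
      have h2 := abs_semigroup_le_of_bound hβ hβ2 ht hM x
      have h3 := abs_sub (semigroup β t h x) (h x)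
      linarith [hM x]
    · rw [lintegral_const_mul _ hφ.enorm]
      exact ENNReal.mul_ne_top ENNReal.ofReal_ne_top hφi
    · refine Eventually.of_forall fun x => ?_
      have h2 := ((tendsto_semigroup_apply hβ hβ2 hc hM x).sub_const (h x)).mul_const (φ x)
      rw [sub_self, zero_mul] at h2
      simpa using h2.enorm
  simpa using h1

end InitialTrace

/-- Either `a ≤ e`, or `a = a^{1-p} a^p ≤ e^{1-p} a^p`. This turns smallness in `L^p` into smallness
against a bounded integrable function. -/
lemma mul_le_add_rpow {p : ℝ} (hp : 1 ≤ p) {e N a b : ℝ} (he : 0 < e) (ha : 0 ≤ a) (hb : 0 ≤ b)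
    (hbN : b ≤ N) : a * b ≤ e * b + N * e ^ (1 - p) * a ^ p := by
  have hN : 0 ≤ N := hb.trans hbN
  rcases le_total a e with h | h
  · have h1 : a * b ≤ e * b := mul_le_mul_of_nonneg_right h hb
    have h2 : 0 ≤ N * e ^ (1 - p) * a ^ p := by positivity
    linarith
  · have ha0 : 0 < a := he.trans_le h
    have h1 : a = a ^ (1 - p) * a ^ p := by
      rw [← Real.rpow_add ha0, sub_add_cancel, Real.rpow_one]
    have h2 : a ≤ e ^ (1 - p) * a ^ p := by
      conv_lhs => rw [h1]
      exact mul_le_mul_of_nonneg_right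
        (Real.rpow_le_rpow_of_nonpos he h (by linarith)) (by positivity)
    have h3 : a * b ≤ e ^ (1 - p) * a ^ p * N := mul_le_mul h2 hbN hb (by positivity)
    have h4 : 0 ≤ e * b := by positivity
    linarith

/-! ### Initial trace: Orlicz data and weak-star convergence -/

section InitialTrace

variable {n : ℕ} {β p : ℝ}

lemma measurable_semigroup_slice {u : EuclideanSpace ℝ (Fin n) → ℝ} (hu : Measurable u) (t : ℝ) :
    Measurable (semigroup β t u) := by
  have h := (measurable_semigroup (β := β) hu).comp (measurable_prodMk_left (x := t))
  exact h

lemma lintegral_enorm_ne_top_of_memLLogL (hp : 0 < p) {φ : EuclideanSpace ℝ (Fin n) → ℝ}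
    (h : ∫⁻ x, ENNReal.ofReal (|φ x| * Real.log (2 + |φ x|) ^ (1 / p)) < ∞) :
    ∫⁻ x, ‖φ x‖ₑ ≠ ∞ := by
  have hl : 0 < Real.log 2 := Real.log_pos (by norm_num)
  set c := (Real.log 2) ^ (1 / p) with hc
  have hc0 : 0 < c := Real.rpow_pos_of_pos hl _
  have h1 : ∀ x, ‖φ x‖ₑ ≤ ENNReal.ofReal c⁻¹ *
      ENNReal.ofReal (|φ x| * Real.log (2 + |φ x|) ^ (1 / p)) := by
    intro x
    rw [Real.enorm_eq_ofReal_abs, ← ENNReal.ofReal_mul (by positivity)]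
    refine ENNReal.ofReal_le_ofReal ?_
    have h2 : c ≤ Real.log (2 + |φ x|) ^ (1 / p) :=
      Real.rpow_le_rpow hl.le (Real.log_le_log two_pos (by linarith [abs_nonneg (φ x)]))
        (by positivity)
    rw [inv_mul_eq_div, le_div_iff₀ hc0]
    exact mul_le_mul_of_nonneg_left h2 (abs_nonneg _)
  refine ((lintegral_mono h1).trans_lt ?_).ne
  rw [lintegral_const_mul' _ _ ENNReal.ofReal_ne_top]
  exact ENNReal.mul_lt_top ENNReal.ofReal_lt_top h

lemma lintegral_mul_le_of_young {c : ℝ}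
    (hc : ∀ N a b : ℝ, 0 ≤ N → 0 ≤ a → N ≤ b →
      a * b ≤ 2 ^ (1 / p) * (b * Real.log (2 + b) ^ (1 / p)) +
        c * (2 * Real.log (2 + N)) ^ (-((p - 1) / p)) * young p a) (hc0 : 0 < c)
    {d φ : EuclideanSpace ℝ (Fin n) → ℝ} (hφ : Measurable φ) {k : ℝ}
    (hk : 0 < k) (hmod : expModular p d k ≤ 1) (N : ℕ) :
    ∫⁻ x in {x | (N : ℝ) < |φ x|}, ‖d x * φ x‖ₑ ≤ ENNReal.ofReal (k * 2 ^ (1 / p)) *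
      (∫⁻ x in {x | (N : ℝ) < |φ x|},
        ENNReal.ofReal (|φ x| * Real.log (2 + |φ x|) ^ (1 / p))) +
      ENNReal.ofReal (k * (c * (2 * Real.log (2 + (N : ℝ))) ^ (-((p - 1) / p)))) := by
  have hs : MeasurableSet {x | (N : ℝ) < |φ x|} := measurableSet_lt measurable_const hφ.abs
  set θ := c * (2 * Real.log (2 + (N : ℝ))) ^ (-((p - 1) / p)) with hθ
  have hθ0 : 0 ≤ θ := by
    have : 0 < Real.log (2 + (N : ℝ)) := Real.log_pos (by
      have : (0 : ℝ) ≤ N := by positivity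
      linarith)
    positivity
  have hGm : Measurable fun x => ENNReal.ofReal (|φ x| * Real.log (2 + |φ x|) ^ (1 / p)) := by
    have := (Real.measurable_log.comp (hφ.abs.const_add 2)).pow_const (1 / p)
    exact (hφ.abs.mul this).ennreal_ofReal
  have hpt : ∀ x ∈ {x | (N : ℝ) < |φ x|}, ‖d x * φ x‖ₑ ≤ ENNReal.ofReal (k * 2 ^ (1 / p)) *
      ENNReal.ofReal (|φ x| * Real.log (2 + |φ x|) ^ (1 / p)) +
      ENNReal.ofReal (k * θ) * ENNReal.ofReal (young p (|d x| / k)) := by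
    intro x hx
    have hx : (N : ℝ) < |φ x| := hx
    have hy := young_nonneg (p := p) (show 0 ≤ |d x| / k by positivity)
    have hlog : 0 ≤ Real.log (2 + |φ x|) := Real.log_nonneg (by linarith [abs_nonneg (φ x)])
    rw [← ENNReal.ofReal_mul (by positivity), ← ENNReal.ofReal_mul (by positivity),
      ← ENNReal.ofReal_add (by positivity) (by positivity), Real.enorm_eq_ofReal_abs, abs_mul]
    refine ENNReal.ofReal_le_ofReal ?_
    have h1 := hc N (|d x| / k) |φ x| (by positivity) (by positivity) hx.le
    have h2 : |d x| * |φ x| = k * (|d x| / k * |φ x|) := by field_simp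
    rw [h2]
    refine (mul_le_mul_of_nonneg_left h1 hk.le).trans (le_of_eq ?_)
    rw [hθ]
    ring
  refine (setLIntegral_mono' hs hpt).trans ?_
  rw [lintegral_add_left (hGm.const_mul _), lintegral_const_mul' _ _ ENNReal.ofReal_ne_top,
    lintegral_const_mul' _ _ ENNReal.ofReal_ne_top]
  exact add_le_add le_rfl (mul_le_of_le_one_right' ((setLIntegral_le_lintegral _ _).trans hmod))

variable [NeZero n]

/-- Approximate `v` in `L^p` by a continuous, compactly supported `h`. The remainder stays small at
every time because the semigroup contracts `L^p`, and for `h` the convergence is pointwise and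
bounded. -/
lemma tendsto_lintegral_semigroup_sub_mul_of_le (hβ : 0 < β) (hβ2 : β < 2) (hp : 1 < p)
    {v φ : EuclideanSpace ℝ (Fin n) → ℝ} (hv : Measurable v)
    (hvi : ∀ t, 0 < t → ∀ x, Integrable fun y => kernel β t (x - y) * v y)
    (hvp : ∫⁻ x, ‖v x‖ₑ ^ p ≠ ∞) (hφ : Measurable φ) (hφi : ∫⁻ x, ‖φ x‖ₑ ≠ ∞) {N : ℝ}
    (hN : ∀ x, |φ x| ≤ N) :
    Tendsto (fun t => ∫⁻ x, ‖(semigroup β t v x - v x) * φ x‖ₑ) (𝓝[>] 0) (𝓝 0) := by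
  have hp0 : 0 < p := by linarith
  have hN0 : 0 ≤ N := (abs_nonneg _).trans (hN 0)
  rw [ENNReal.tendsto_nhds_zero]
  intro ε hε
  obtain ⟨e, he, hle⟩ : ∃ e : ℝ, 0 < e ∧ ENNReal.ofReal e ≤ ε := by
    rcases eq_or_ne ε ∞ with rfl | htop
    · exact ⟨1, one_pos, le_top⟩
    · exact ⟨ε.toReal, ENNReal.toReal_pos hε.ne' htop, (ENNReal.ofReal_toReal htop).le⟩
  set J := (∫⁻ x, ‖φ x‖ₑ).toReal with hJ
  have hJ0 : 0 ≤ J := ENNReal.toReal_nonneg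
  have hφJ : ∫⁻ x, ‖φ x‖ₑ = ENNReal.ofReal J := (ENNReal.ofReal_toReal hφi).symm
  -- `d` keeps `d ‖φ‖₁` below `e/6`, and `δ` keeps `Aδ` below `e/6`; `δ` is chosen second because
  -- `A` depends on `d`.
  set d := e / (6 * (J + 1)) with hd
  have hd0 : 0 < d := by positivity
  set A := N * d ^ (1 - p) with hA
  have hA0 : 0 ≤ A := by positivity
  set δ := e / (6 * (A + 1)) with hδ
  have hδ0 : 0 < δ := by positivity
  have hmem : MemLp v (ENNReal.ofReal p) volume := by
    refine ⟨hv.aestronglyMeasurable, ?_⟩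
    rw [eLpNorm_lt_top_iff_lintegral_rpow_enorm_lt_top (by simpa using hp0) ENNReal.ofReal_ne_top,
      ENNReal.toReal_ofReal hp0.le]
    exact hvp.lt_top
  obtain ⟨h, hsupp, hclose, hc, -⟩ := hmem.exists_hasCompactSupport_eLpNorm_sub_le
    ENNReal.ofReal_ne_top (ε := ENNReal.ofReal (δ ^ (1 / p)))
    (by simpa using Real.rpow_pos_of_pos hδ0 _)
  obtain ⟨M, hM⟩ := hsupp.exists_bound_of_continuous hc
  simp_rw [Real.norm_eq_abs] at hM
  set z : EuclideanSpace ℝ (Fin n) → ℝ := fun x => v x - h x with hz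
  have hzm : Measurable z := hv.sub hc.measurable
  have hzp : ∫⁻ x, ‖z x‖ₑ ^ p ≤ ENNReal.ofReal δ := by
    rw [eLpNorm_eq_lintegral_rpow_enorm_toReal (by simpa using hp0) ENNReal.ofReal_ne_top,
      ENNReal.toReal_ofReal hp0.le] at hclose
    have := ENNReal.rpow_le_rpow hclose hp0.le
    rw [← ENNReal.rpow_mul, one_div_mul_cancel hp0.ne', ENNReal.rpow_one,
      ENNReal.ofReal_rpow_of_nonneg (by positivity) hp0.le, ← Real.rpow_mul hδ0.le,
      one_div_mul_cancel hp0.ne', Real.rpow_one] at this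
    exact this
  have hpt : ∀ (a : ℝ) x, ‖a‖ₑ * ‖φ x‖ₑ ≤ ENNReal.ofReal d * ‖φ x‖ₑ + ENNReal.ofReal A * ‖a‖ₑ ^ p := by
    intro a x
    rw [Real.enorm_eq_ofReal_abs, Real.enorm_eq_ofReal_abs,
      ENNReal.ofReal_rpow_of_nonneg (abs_nonneg _) hp0.le, ← ENNReal.ofReal_mul (abs_nonneg _),
      ← ENNReal.ofReal_mul hd0.le, ← ENNReal.ofReal_mul hA0,
      ← ENNReal.ofReal_add (by positivity) (by positivity)]
    exact ENNReal.ofReal_le_ofReal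
      (mul_le_add_rpow hp.le hd0 (abs_nonneg _) (abs_nonneg _) (hN x))
  have hint : ∀ g : EuclideanSpace ℝ (Fin n) → ℝ,
      ∫⁻ x, ‖g x‖ₑ ^ p ≤ ENNReal.ofReal δ → ∫⁻ x, ‖g x‖ₑ * ‖φ x‖ₑ ≤ ENNReal.ofReal (e / 3) := by
    intro g hg
    refine (lintegral_mono fun x => hpt (g x) x).trans ?_
    rw [lintegral_add_left (hφ.enorm.const_mul _), lintegral_const_mul' _ _ ENNReal.ofReal_ne_top,
      lintegral_const_mul' _ _ ENNReal.ofReal_ne_top, hφJ]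
    refine (add_le_add le_rfl (mul_le_mul_right hg _)).trans ?_
    rw [← ENNReal.ofReal_mul hd0.le, ← ENNReal.ofReal_mul hA0,
      ← ENNReal.ofReal_add (by positivity) (by positivity)]
    refine ENNReal.ofReal_le_ofReal ?_
    have h1 : d * (6 * (J + 1)) = e := div_mul_cancel₀ _ (by positivity)
    have h2 : δ * (6 * (A + 1)) = e := div_mul_cancel₀ _ (by positivity)
    nlinarith
  filter_upwards [self_mem_nhdsWithin,
    ENNReal.tendsto_nhds_zero.1 (tendsto_lintegral_semigroup_sub_mul_of_bound hβ hβ2 hc hM hφ hφi)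
      (ENNReal.ofReal (e / 3)) (by simpa using he)] with t ht hth
  have ht : 0 < t := ht
  have hhi : ∀ x, Integrable fun y => kernel β t (x - y) * h y := fun x =>
    ((integrable_kernel hβ hβ2 ht).comp_sub_left x).mul_bdd (c := M) hc.aestronglyMeasurable
      (Eventually.of_forall hM)
  have hlin : ∀ x, semigroup β t v x - v x = semigroup β t z x - z x +
      (semigroup β t h x - h x) := by
    intro x
    have : semigroup β t z x = semigroup β t v x - semigroup β t h x := by
      rw [semigroup, semigroup, semigroup, ← integral_sub (hvi t ht x) (hhi x)]
      exact integral_congr_ae (Eventually.of_forall fun y => by simp only [hz]; ring)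
    rw [this, hz]
    ring
  have hsz : Measurable (semigroup β t z) :=
    measurable_semigroup_slice hzm t
  refine le_trans ?_ hle
  calc ∫⁻ x, ‖(semigroup β t v x - v x) * φ x‖ₑ
      ≤ ∫⁻ x, (‖semigroup β t z x‖ₑ * ‖φ x‖ₑ + ‖z x‖ₑ * ‖φ x‖ₑ +
          ‖(semigroup β t h x - h x) * φ x‖ₑ) := by
        refine lintegral_mono fun x => ?_
        rw [hlin x, add_mul]
        refine (enorm_add_le _ _).trans (add_le_add ?_ le_rfl)
        rw [enorm_mul, ← add_mul]
        exact mul_le_mul_left enorm_sub_le _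
    _ = (∫⁻ x, ‖semigroup β t z x‖ₑ * ‖φ x‖ₑ) + (∫⁻ x, ‖z x‖ₑ * ‖φ x‖ₑ) +
          ∫⁻ x, ‖(semigroup β t h x - h x) * φ x‖ₑ := by
        rw [lintegral_add_left (by fun_prop), lintegral_add_left (by fun_prop)]
    _ ≤ ENNReal.ofReal (e / 3) + ENNReal.ofReal (e / 3) + ENNReal.ofReal (e / 3) :=
        add_le_add (add_le_add
          (hint _ ((lintegral_enorm_semigroup_rpow_le hβ hβ2 hp ht hzm).trans hzp))
          (hint _ hzp)) hth
    _ = ENNReal.ofReal e := by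
        rw [← ENNReal.ofReal_add (by positivity) (by positivity),
          ← ENNReal.ofReal_add (by positivity) (by positivity)]
        congr 1
        ring

/-- Cut `φ` at height `N`. The bounded part is the previous case. On the tail, `e^{-tA}v - v` has
modular at most one at radius `2k` for every `t > 0`, so the Young inequality makes the contribution
small uniformly in time. -/
lemma tendsto_lintegral_semigroup_sub_mul (hβ : 0 < β) (hβ2 : β < 2) (hp : 1 < p)
    {v φ : EuclideanSpace ℝ (Fin n) → ℝ} (hv : Measurable v) {k : ℝ} (hk : 0 < k)
    (hmod : expModular p v k ≤ 1) (hφ : Measurable φ)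
    (hφL : ∫⁻ x, ENNReal.ofReal (|φ x| * Real.log (2 + |φ x|) ^ (1 / p)) < ∞) :
    Tendsto (fun t => ∫⁻ x, ‖(semigroup β t v x - v x) * φ x‖ₑ) (𝓝[>] 0) (𝓝 0) := by
  have hp0 : 0 < p := by linarith
  have hφi := lintegral_enorm_ne_top_of_memLLogL hp0 hφL
  obtain ⟨c, hc, hyoung⟩ := exists_mul_le_log_add_young hp
  have hGm : Measurable fun x => ENNReal.ofReal (|φ x| * Real.log (2 + |φ x|) ^ (1 / p)) := by
    have := (Real.measurable_log.comp (hφ.abs.const_add 2)).pow_const (1 / p)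
    exact (hφ.abs.mul this).ennreal_ofReal
  have hvp : ∫⁻ x, ‖v x‖ₑ ^ p ≠ ∞ := by
    obtain ⟨c', -, hc'⟩ := exists_lintegral_rpow_le_expModular n hp0 (le_refl p)
    have h1 := hc' v k hk
    refine ne_top_of_le_ne_top (ENNReal.mul_ne_top ENNReal.ofReal_ne_top
      (hmod.trans_lt ENNReal.one_lt_top).ne) (le_trans (le_of_eq ?_) h1)
    refine lintegral_congr fun x => ?_
    rw [Real.enorm_eq_ofReal_abs, ENNReal.ofReal_rpow_of_nonneg (abs_nonneg _) hp0.le]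
  have hvi : ∀ t, 0 < t → ∀ x, Integrable fun y => kernel β t (x - y) * v y := fun t ht x =>
    integrable_kernel_mul hβ hβ2 hp.le hv hk (hmod.trans_lt ENNReal.one_lt_top) ht x
  have htail : Tendsto (fun N : ℕ => ENNReal.ofReal (2 * k * 2 ^ (1 / p)) *
      (∫⁻ x in {x | (N : ℝ) < |φ x|},
        ENNReal.ofReal (|φ x| * Real.log (2 + |φ x|) ^ (1 / p))) +
      ENNReal.ofReal (2 * k * (c * (2 * Real.log (2 + (N : ℝ))) ^ (-((p - 1) / p)))))
      atTop (𝓝 0) := by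
    have h1 := ENNReal.Tendsto.const_mul (a := ENNReal.ofReal (2 * k * 2 ^ (1 / p)))
      (tendsto_lintegral_tail (μ := volume) hφ hGm hφL.ne) (Or.inr ENNReal.ofReal_ne_top)
    have h2 := ENNReal.tendsto_ofReal (((tendsto_log_tail hp).const_mul c).const_mul (2 * k))
    simpa using h1.add h2
  rw [ENNReal.tendsto_nhds_zero]
  intro ε hε
  obtain ⟨N, hN⟩ := ((ENNReal.tendsto_nhds_zero.1 htail) (ε / 2) (ENNReal.half_pos hε.ne')).exists
  have hs : MeasurableSet {x | (N : ℝ) < |φ x|} := measurableSet_lt measurable_const hφ.abs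
  set ψ : EuclideanSpace ℝ (Fin n) → ℝ := {x | (N : ℝ) < |φ x|}ᶜ.indicator φ with hψ
  have hψm : Measurable ψ := hφ.indicator hs.compl
  have hψφ : ∀ x, ‖ψ x‖ₑ ≤ ‖φ x‖ₑ := fun x => enorm_indicator_le_enorm_self _ _
  have hψN : ∀ x, |ψ x| ≤ N := by
    intro x
    by_cases hx : (N : ℝ) < |φ x|
    · have : ψ x = 0 := Set.indicator_of_notMem (by simpa using hx) _
      rw [this, abs_zero]
      positivity
    · have : ψ x = φ x := Set.indicator_of_mem (by simpa using hx) _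
      rw [this]
      exact not_lt.1 hx
  have hψi : ∫⁻ x, ‖ψ x‖ₑ ≠ ∞ := ne_top_of_le_ne_top hφi (lintegral_mono hψφ)
  filter_upwards [self_mem_nhdsWithin, ENNReal.tendsto_nhds_zero.1
    (tendsto_lintegral_semigroup_sub_mul_of_le hβ hβ2 hp hv hvi hvp hψm hψi hψN) (ε / 2)
    (ENNReal.half_pos hε.ne')] with t ht hbd
  have ht : 0 < t := ht
  have hsv : Measurable (semigroup β t v) :=
    measurable_semigroup_slice hv t
  set d : EuclideanSpace ℝ (Fin n) → ℝ := fun x => semigroup β t v x - v x with hd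
  have hdm : Measurable d := hsv.sub hv
  have hdmod : expModular p d (2 * k) ≤ 1 := by
    have h1 : expModular p (fun x => -v x) k ≤ 1 := by simpa [expModular] using hmod
    have h2 := expModular_add_le hp.le hsv hk hk
      ((expModular_semigroup_le hβ hβ2 hp.le ht hv hk).trans hmod) h1
    rw [two_mul]
    simpa only [hd, sub_eq_add_neg] using h2
  calc ∫⁻ x, ‖d x * φ x‖ₑ
      = (∫⁻ x in {x | (N : ℝ) < |φ x|}ᶜ, ‖d x * φ x‖ₑ) +
          ∫⁻ x in {x | (N : ℝ) < |φ x|}, ‖d x * φ x‖ₑ := by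
        rw [add_comm, lintegral_add_compl _ hs]
    _ ≤ ε / 2 + ε / 2 := by
        refine add_le_add (le_trans ?_ hbd) (le_trans ?_ hN)
        · rw [← lintegral_indicator hs.compl]
          refine lintegral_mono fun x => Set.indicator_apply_le' (fun hx => ?_) fun _ => zero_le
          have : ψ x = φ x := Set.indicator_of_mem hx _
          rw [this]
        · exact lintegral_mul_le_of_young hyoung hc hφ (by positivity) hdmod N
    _ = ε := ENNReal.add_halves ε

/-- The linear part is the previous lemma. The Duhamel part tends to zero uniformly while the test
function is integrable. -/
lemma DuhamelPart.weakStarInitial {κ γ k B : ℝ} {f : ℝ → ℝ} {u₀ : EuclideanSpace ℝ (Fin n) → ℝ}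
    {w : ℝ → EuclideanSpace ℝ (Fin n) → ℝ} (h : DuhamelPart β p κ γ k B f u₀ w) (hβ : 0 < β)
    (hβ2 : β < 2) (hp : 1 < p) (hk : 0 < k) (hκ : 0 ≤ κ) (hγ1 : γ ≤ 1) (hf : Measurable f)
    (hu : Measurable u₀) (hmod : expModular p u₀ k ≤ 1) :
    WeakStarInitial p (fun t x => semigroup β t u₀ x + w t x) u₀ := by
  rintro φ ⟨hφloc, hφL⟩
  obtain ⟨ψ, hψ, hφψ⟩ := hφloc.aestronglyMeasurable
  have hψm : Measurable ψ := hψ.measurable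
  have hψL : ∫⁻ x, ENNReal.ofReal (|ψ x| * Real.log (2 + |ψ x|) ^ (1 / p)) < ∞ := by
    refine lt_of_eq_of_lt (lintegral_congr_ae ?_) hφL
    filter_upwards [hφψ] with x hx
    rw [hx]
  have hψi := lintegral_enorm_ne_top_of_memLLogL (by linarith : 0 < p) hψL
  have hlin := tendsto_lintegral_semigroup_sub_mul hβ hβ2 hp hu hk hmod hψm hψL
  have hdu : Tendsto (fun t => ∫⁻ x, ‖w t x * ψ x‖ₑ) (𝓝[>] 0) (𝓝 0) := by
    rw [ENNReal.tendsto_nhds_zero]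
    intro ε hε
    obtain ⟨e, he, hle⟩ : ∃ e : ℝ, 0 < e ∧ ENNReal.ofReal e * ∫⁻ x, ‖ψ x‖ₑ ≤ ε := by
      have h1 : Tendsto (fun e : ℝ => ENNReal.ofReal e * ∫⁻ x, ‖ψ x‖ₑ) (𝓝[>] 0)
          (𝓝 (ENNReal.ofReal 0 * ∫⁻ x, ‖ψ x‖ₑ)) :=
        ENNReal.Tendsto.mul_const (ENNReal.tendsto_ofReal
          (tendsto_id.mono_left nhdsWithin_le_nhds)) (Or.inr hψi)
      rw [ENNReal.ofReal_zero, zero_mul] at h1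
      obtain ⟨e, he⟩ := ((ENNReal.tendsto_nhds_zero.1 h1 ε hε).and self_mem_nhdsWithin).exists
      exact ⟨e, he.2, he.1⟩
    filter_upwards [h.eventually_small hβ hβ2 hκ hγ1 hf hu he] with t ht
    refine le_trans ?_ hle
    rw [← lintegral_const_mul' _ _ ENNReal.ofReal_ne_top]
    refine lintegral_mono fun x => ?_
    rw [enorm_mul]
    exact mul_le_mul_left ((enorm_le_to_abs he.le).2 (ht.1 x)) _
  have hsum := hlin.add hdu
  rw [add_zero] at hsum
  rw [tendsto_iff_enorm_sub_tendsto_zero]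
  refine tendsto_of_tendsto_of_tendsto_of_le_of_le tendsto_const_nhds hsum
    (fun t => zero_le) fun t => ?_
  rw [sub_zero]
  have hsv : Measurable (semigroup β t u₀) :=
    measurable_semigroup_slice hu t
  refine (enorm_integral_le_lintegral_enorm _).trans ?_
  have hm : Measurable fun x => ‖(semigroup β t u₀ x - u₀ x) * ψ x‖ₑ :=
    ((hsv.sub hu).mul hψm).enorm
  rw [← lintegral_add_left hm]
  refine lintegral_mono_ae ?_
  filter_upwards [hφψ] with x hx
  rw [hx]
  refine le_trans (le_of_eq ?_) (enorm_add_le _ _)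
  congr 1
  ring

end InitialTrace

/-! ### Assembly of the solution -/

variable {n : ℕ}

lemma expModular_congr_ae {p : ℝ} {u v : EuclideanSpace ℝ (Fin n) → ℝ} (h : u =ᵐ[volume] v)
    (k : ℝ) : expModular p u k = expModular p v k :=
  lintegral_congr_ae (h.mono fun x hx => by simp only [hx])

lemma semigroup_congr_ae {u v : EuclideanSpace ℝ (Fin n) → ℝ} (h : u =ᵐ[volume] v) (β t : ℝ) :
    semigroup β t u = semigroup β t v :=
  funext fun _ => integral_congr_ae (h.mono fun y hy => by simp only [hy])

/-- This permits the fixed point argument to run with a Borel measurable representative of the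
initial datum. -/
lemma IsGlobalWeakMildSolution.congr_initial {β p : ℝ} {f : ℝ → ℝ}
    {u₀ v₀ : EuclideanSpace ℝ (Fin n) → ℝ} {u : ℝ → EuclideanSpace ℝ (Fin n) → ℝ}
    (h : IsGlobalWeakMildSolution β p f v₀ u) (he : u₀ =ᵐ[volume] v₀) :
    IsGlobalWeakMildSolution β p f u₀ u where
  jointly_measurable := h.jointly_measurable
  bounded := h.bounded
  absolutely_convergent := h.absolutely_convergent
  integral_equation := by simpa only [semigroup_congr_ae he] using h.integral_equation
  weak_star φ hφ := by
    refine (h.weak_star φ hφ).congr fun t => integral_congr_ae ?_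
    filter_upwards [he] with x hx
    rw [hx]

variable [NeZero n]

lemma DuhamelPart.isGlobalWeakMildSolution {β p κ γ k B : ℝ} {f : ℝ → ℝ}
    {u₀ : EuclideanSpace ℝ (Fin n) → ℝ} {w : ℝ → EuclideanSpace ℝ (Fin n) → ℝ}
    (h : DuhamelPart β p κ γ k B f u₀ w) (hβ : 0 < β) (hβ2 : β < 2) (hp : 1 < p) (hk : 0 < k)
    (hκ : 0 ≤ κ) (hγ : γ = κ * (p - 1)) (hγ0 : 0 < γ) (hγ1 : γ ≤ 1) (hf : Measurable f)
    (hu : Measurable u₀) (hmod : expModular p u₀ k ≤ 1) :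
    IsGlobalWeakMildSolution β p f u₀ (fun t x => semigroup β t u₀ x + w t x) := by
  obtain ⟨η, H, hη, hS, hFH⟩ := h.source
  have hF := h.measurable_source hf hu
  have hd : ∀ t, 0 < t → duhamel β f (fun t x => semigroup β t u₀ x + w t x) t = w t := by
    intro t ht
    funext x
    rw [hS.duhamel_eq hη hβ hβ2 hκ hF hFH ht x, h.eq t ht x]
  refine ⟨?_, h.memLInftyExpL hβ hβ2 hk hκ hp.le hγ hγ0 hγ1 hf hu hmod, ?_, ?_,
    h.weakStarInitial hβ hβ2 hp hk hκ hγ1 hf hu hmod⟩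
  · exact ((measurable_semigroup (β := β) hu).add h.meas).aestronglyMeasurable
  · refine (ae_restrict_iff' measurableSet_Ioi).2 (Eventually.of_forall fun t ht =>
      Eventually.of_forall fun x => ?_)
    exact hS.integrable_duhamel hη hβ hβ2 hκ hF hFH ht x
  · refine (ae_restrict_iff' measurableSet_Ioi).2 (Eventually.of_forall fun t ht => ?_)
    rw [hd t ht]
    exact ⟨memExpL_of_modular_le hp.le (measurable_semigroup_slice hu t) hk
      ((expModular_semigroup_le hβ hβ2 hp.le ht hu hk).trans hmod),
      memExpL_of_modular_le hp.le (h.measurable_slice t) (by positivity)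
      (h.modular hk hκ hp.le hγ ht), Eventually.of_forall fun x => rfl⟩

end FracHeat

end

theorem theorem2 (n : ℕ) (hn : 1 ≤ n) (β p m : ℝ) (hβ0 : 0 < β) (hβ2 : β < 2)
    (hp : 1 < p) (hpm : p ≤ n * (m - 1) / β) (hm : p ≤ m)
    (f : ℝ → ℝ) (C lam : ℝ) (hC : 0 < C) (hlam : 0 < lam) (hf0 : f 0 = 0)
    (hf : ∀ a b : ℝ, |f a - f b| ≤
      C * |a - b| * (|a| ^ (m - 1) * Real.exp (lam * |a| ^ p) +
        |b| ^ (m - 1) * Real.exp (lam * |b| ^ p))) :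
    ∃ ε : ℝ, 0 < ε ∧
      ∀ u₀ : EuclideanSpace ℝ (Fin n) → ℝ, FracHeat.MemExpL p u₀ →
        FracHeat.expLNorm p u₀ ≤ ENNReal.ofReal ε →
        ∃ u : ℝ → EuclideanSpace ℝ (Fin n) → ℝ,
          FracHeat.IsGlobalWeakMildSolution β p f u₀ u ∧
          Tendsto (fun t => FracHeat.expLNorm p (fun x => u t x - FracHeat.semigroup β t u₀ x))
            (𝓝[>] 0) (𝓝 0) ∧
          ∀ q : ℝ, FracHeat.DecayRange n β p m q →
            0 < FracHeat.decayExponent n β m q ∧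
            ∃ K : ℝ, 0 < K ∧ ∀ t : ℝ, 0 < t →
              eLpNorm (u t) (ENNReal.ofReal q) volume ≤
                ENNReal.ofReal (K * t ^ (-FracHeat.decayExponent n β m q)) := by
  have : NeZero n := ⟨by omega⟩
  have hm1 : 1 < m := hp.trans_le hm
  have hm0 : 0 < m - 1 := by linarith
  have hfL : FracHeat.LipExp C lam m p f := hf
  have hfm : Measurable f := (hfL.continuous hm1 (by linarith)).measurable
  set κ := 1 / (m - 1) with hκdef
  have hκ : κ * (m - 1) = 1 := one_div_mul_cancel hm0.ne'
  have hκ0 : 0 < κ := by positivity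
  obtain ⟨γ, hγ⟩ : ∃ γ, γ = κ * (p - 1) := ⟨_, rfl⟩
  have hγ0 : 0 < γ := by rw [hγ]; exact mul_pos hκ0 (by linarith)
  have hγ1 : γ ≤ 1 := by rw [hγ, ← hκ]; exact mul_le_mul_of_nonneg_left (by linarith) hκ0.le
  have hpc : p ≤ n / β * (m - 1) := by rwa [div_mul_eq_mul_div]
  obtain ⟨k, B, hk, hB, hex⟩ := FracHeat.exists_duhamelPart n hβ0 hβ2 hp hm hκ hγ hpc hC hlam
    hf0 hfL
  -- Half of `k` leaves a strict gap, so the modular at radius `k` is at most one without attainment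
  -- of the infimum.
  refine ⟨k / 2, by positivity, fun u₀ hmem hnorm => ?_⟩
  obtain ⟨v₀, hv₀, huv⟩ := hmem.1.aestronglyMeasurable
  have hv : Measurable v₀ := hv₀.measurable
  have hmod : FracHeat.expModular p v₀ k ≤ 1 := by
    rw [← FracHeat.expModular_congr_ae huv]
    refine FracHeat.expModular_le_one_of_expLNorm_lt (by linarith) (hnorm.trans_lt ?_)
    exact (ENNReal.ofReal_lt_ofReal_iff hk).2 (by linarith)
  obtain ⟨w, hw⟩ := hex v₀ hv hmod
  refine ⟨fun t x => FracHeat.semigroup β t v₀ x + w t x,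
    (hw.isGlobalWeakMildSolution hβ0 hβ2 hp hk hκ0.le hγ hγ0 hγ1 hfm hv hmod).congr_initial huv,
    ?_, fun q hq => ?_⟩
  · refine FracHeat.tendsto_expLNorm_zero fun e he => ?_
    filter_upwards [hw.eventually_small hβ0 hβ2 hκ0.le hγ1 hfm hv
      (show 0 < e / 2 by positivity)] with t ht
    have h1 := FracHeat.expModular_le_one_of_small hp.le (show 0 < e / 2 by positivity) ht.1 ht.2
    rw [mul_div_cancel₀ e two_ne_zero] at h1
    simpa [FracHeat.semigroup_congr_ae huv] using h1
  · have hlt := hq.lt hβ0 hp hm1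
    have hpq : p < q := hpm.trans_lt hlt
    have hq0 : 0 < q := by linarith
    have hσ := FracHeat.decayExponent_pos hβ0 hm1 hq0 hlt
    refine ⟨hσ, ?_⟩
    -- Here `σq = κq - n/β`, and `κp ≤ n/β` is once more the hypothesis `p ≤ n(m-1)/β`.
    have hσq : FracHeat.decayExponent n β m q * q ≤ κ * (q - p) := by
      have h1 : FracHeat.decayExponent n β m q * q = κ * q - n / β := by
        rw [FracHeat.decayExponent, ← hκdef]
        field_simp
      have h2 : κ * p ≤ n / β := by
        calc κ * p ≤ κ * (n / β * (m - 1)) := mul_le_mul_of_nonneg_left hpc hκ0.le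
          _ = κ * (m - 1) * (n / β) := by ring
          _ = n / β := by rw [hκ, one_mul]
      rw [h1]
      linarith
    obtain ⟨K, hK, hdecay⟩ := FracHeat.exists_eLpNorm_decay (κ := κ) n (by linarith : 0 < p) hpq
      hσ.le hσq (show 0 < k + 2 * k by positivity) (show 0 < (B + 1) * k by positivity)
    exact ⟨K, hK, hdecay _
      (fun t ht => hw.modular_add hβ0 hβ2 hk hκ0.le hp.le hγ hv hmod ht)
      (fun t ht x => hw.abs_add_le hβ0 hβ2 hk hκ0.le ht x)⟩
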